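/- **Setting.** Let $0<\alpha\le 1$ and, for $c>0$, $\lambda\in\mathbb R$, put $f_n(x)=c\,e^{-\lambda x/n}x^{\alpha-1}$ for $n,x\in\mathbb N$. *EML processes.* Let $0<b\le 1$, $T>0$, $\lambda\ge(\alpha-1)/T$. A process $(X_t)_{0<t\le T}$ with values in $[0,\infty)$ is an EML$(\alpha,\lambda,b,T)$ process if for some $c\in(0,2^{\alpha-1})$ the finite-dimensional distributions of $n^{-\alpha}\sum_{1\le i\le\lfloor nt\rfloor}\xi^{(n)}_i$ $(0<t\le T)$ converge weakly, as $n\to\infty$, to those of $c\,\Gamma(\alpha)X_t$, where, for all large $n$, $(\xi^{(n)}_i)$ is a binary sequence with $$P(\xi^{(n)}_{i_1}=1,\dots,\xi^{(n)}_{i_k}=1)=b\,f_n(\lfloor nT\rfloor)\prod_{j=1}^{k-1}f_n(i_{j+1}-i_j),\qquad 1\le i_1<\dots<i_k\le\lfloor nT\rfloor,\ k\ge 1 .$$ Let $\lambda\ge 0$. A process $(X^*_t)_{t>0}$ with values in $[0,\infty)$ is an EML$^*(\alpha,\lambda)$ process if the same holds on $t>0$ with binary sequences $(\xi^{(*,n)}_i)$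 such that $$P(\xi^{(*,n)}_{i_1}=1,\dots,\xi^{(*,n)}_{i_k}=1)=f_n(i_1)\prod_{j=1}^{k-1}f_n(i_{j+1}-i_j),\qquad 1\le i_1<\dots<i_k,\ k\ge 1.$$ *The functions $m$ and $m^*$.* Let $0=t_0<t_1<\dots<t_m$ and $\sigma\in\mathbb C^m$. For $\emptyset\ne C\subset\{1,\dots,m\}$ let $C(1)<\dots<C(p)$, $p=|C|$, be its elements and $\tau=t_{C(p)}$. For $k\in\{1,2,\dots\}^p$ use integration variables $x_1,\dots,x_p$ and $x'_i$ for those $i$ with $k_i\ge 2$; write $y_i=x'_i$ if $k_i\ge2$ and $y_i=x_i$ if $k_i=1$, and $x_0=0$. Let $Q_{C,k}$ be the set where $t_{C(i)-1}/\tau<x'_i<x_i<t_{C(i)}/\tau$ if $k_i\ge2$ and $t_{C(i)-1}/\tau<x_i<t_{C(i)}/\tau$ if $k_i=1$. Put $$A(C,k)=\int_{Q_{C,k}}\ \prod_{i:\,k_i\ge2}\frac{(x_i-x'_i)^{\alpha(k_i-1)-1}}{\Gamma((k_i-1)\alpha)}\ \prod_{i=2}^{p}\frac{(y_i-x_{i-1})^{\alpha-1}}{\Gamma(\alpha)}\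 e^{-\lambda\tau(x_p-y_1)}\,dx'\,dx,$$ $$A^*(C,k)=\int_{Q_{C,k}}\ \prod_{i:\,k_i\ge2}\frac{(x_i-x'_i)^{\alpha(k_i-1)-1}}{\Gamma((k_i-1)\alpha)}\ \prod_{i=1}^{p}\frac{(y_i-x_{i-1})^{\alpha-1}}{\Gamma(\alpha)}\ e^{-\lambda\tau x_p}\,dx'\,dx,$$ and, with $a_T=b\,e^{-\lambda T}T^{\alpha-1}/\Gamma(\alpha)$, $$m(\sigma,t)=1+a_T\sum_{C\neq\emptyset}\ \sum_{k}\tau^{\alpha(\sum_i k_i-1)+1}\Big(\prod_{i=1}^{p}\sigma_{C(i)}^{k_i}\Big)A(C,k),\qquad m^*(\sigma,t)=1+\sum_{C\neq\emptyset}\ \sum_{k}\tau^{\alpha\sum_i k_i}\Big(\prod_{i=1}^{p}\sigma_{C(i)}^{k_i}\Big)A^*(C,k).$$ **Theorem.** Let $Y=(Y(u))_{u\ge0}$ be a real-valued Lévy process with $\mathrm E\,e^{\mathrm i sY(u)}=e^{u\psi(s)}$ for all $u\ge 0$, $s\in\mathbb R$. For $s_1,\dots,s_m\in\mathbb R$ put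 $S_i=\sum_{j=i}^m s_j$. (i) If $X$ is an EML$(\alpha,\lambda,b,T)$ process independent of $Y$ and $Z_t=Y(X_t)$, then for all $m$, all $0<t_1<\dots<t_m\le T$ and all $s_1,\dots,s_m\in\mathbb R$, $$\mathrm E\big(e^{\mathrm i s_1Z_{t_1}+\dots+\mathrm i s_mZ_{t_m}}\big)=m\big((\psi(S_1),\dots,\psi(S_m)),(t_1,\dots,t_m)\big).$$ (ii) If $X^*$ is an EML$^*(\alpha,\lambda)$ process independent of $Y$ and $Z^*_t=Y(X^*_t)$, then for all $m$, all $0<t_1<\dots<t_m$ and all $s_1,\dots,s_m\in\mathbb R$, $$\mathrm E\big(e^{\mathrm i s_1Z^*_{t_1}+\dots+\mathrm i s_mZ^*_{t_m}}\big)=m^*\big((\psi(S_1),\dots,\psi(S_m)),(t_1,\dots,t_m)\big).$$ In both cases the integrals $A(C,k)$, $A^*(C,k)$ exist and the series that define the right-hand sides converge absolutely. -/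

import Mathlib

open MeasureTheory ProbabilityTheory Filter Topology
open scoped NNReal

noncomputable section

namespace EMLProcess

/-! ### Generalized Bernoulli processes and their scaled walks

A binary sequence `(ξ_i)` is represented by its law on `ℕ → Bool`, with `ξ_i = 1` iff `ω i = true`.
The probabilities that given sites all carry a one determine, by inclusion and exclusion, all the
joint probabilities of ones and zeros at these sites. -/

/-- `f_n(x) = c exp(-λ x / n) x ^ (α - 1)`. -/
def gbpFun (α lam c : ℝ) (n x : ℕ) : ℝ :=
  c * Real.exp (-lam * x / n) * (x : ℝ) ^ (α - 1)

/-- `Q` is the law of a generalized Bernoulli process with `N` sites: for all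
`1 ≤ i_0 < i_1 < ... < i_k ≤ N`,
`P(ξ_{i_0} = 1, ..., ξ_{i_k} = 1) = b f(N) ∏_{j<k} f(i_{j+1} - i_j)`. -/
def IsGBP (f : ℕ → ℝ) (b : ℝ) (N : ℕ) (Q : Measure (ℕ → Bool)) : Prop :=
  ∀ (k : ℕ) (i : Fin (k + 1) → ℕ), StrictMono i → (∀ j, 1 ≤ i j ∧ i j ≤ N) →
    Q.real {ω | ∀ j, ω (i j) = true}
      = b * f N * ∏ j : Fin k, f (i j.succ - i j.castSucc)

/-- `Q` is the law of the nonstationary generalized Bernoulli process, that is, of the sequence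
`(ξ_{i+1})_{i ≥ 1}` conditioned on `ξ_1 = 1`, for `ξ` a generalized Bernoulli process:
for all `1 ≤ i_0 < i_1 < ... < i_k`,
`P(ξ*_{i_0} = 1, ..., ξ*_{i_k} = 1) = f(i_0) ∏_{j<k} f(i_{j+1} - i_j)`. -/
def IsGBPStar (f : ℕ → ℝ) (Q : Measure (ℕ → Bool)) : Prop :=
  ∀ (k : ℕ) (i : Fin (k + 1) → ℕ), StrictMono i → (∀ j, 1 ≤ i j) →
    Q.real {ω | ∀ j, ω (i j) = true}
      = f (i 0) * ∏ j : Fin k, f (i j.succ - i j.castSucc)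

/-- The scaled walk `n ^ (-α) ∑_{1 ≤ i ≤ ⌊n t⌋} ξ_i`. -/
def walk (α : ℝ) (n : ℕ) (t : ℝ) (ω : ℕ → Bool) : ℝ :=
  (∑ i ∈ Finset.Icc 1 ⌊(n : ℝ) * t⌋₊, if ω i = true then (1 : ℝ) else 0) / (n : ℝ) ^ α

variable {Ω : Type*} [MeasurableSpace Ω]

/-- `X ∼ EML(α, λ, b, T)`: for some admissible constant `c`, the process `ν X` with `ν = c Γ(α)` is
the scaling limit, in the sense of finite-dimensional distributions, of the walks driven by the
generalized Bernoulli processes with `⌊n T⌋` sites. The division by `ν` is the normalization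
under which the limit does not depend on `c`. -/
structure IsEML (α lam b T : ℝ) (X : Set.Ioc (0 : ℝ) T → Ω → ℝ≥0) (μ : Measure Ω)
    [IsProbabilityMeasure μ] : Prop where
  measurable : ∀ t, Measurable (X t)
  scaling_limit : ∃ c : ℝ, 0 < c ∧ c < 2 ^ (α - 1) ∧
    ∃ Q : ℕ → ProbabilityMeasure (ℕ → Bool),
      (∀ᶠ n : ℕ in atTop, IsGBP (gbpFun α lam c n) b ⌊(n : ℝ) * T⌋₊ (Q n)) ∧
      ∀ (m : ℕ) (t : Fin m → Set.Ioc (0 : ℝ) T),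
        TendstoInDistribution (fun (n : ℕ) ω (j : Fin m) ↦ walk α n (t j) ω) atTop
          (fun ω (j : Fin m) ↦ c * Real.Gamma α * (X (t j) ω : ℝ))
          (fun n ↦ (Q n : Measure (ℕ → Bool))) μ

/-- `X ∼ EML*(α, λ)`: the same for the nonstationary generalized Bernoulli processes, on the
whole half-line. -/
structure IsEMLStar (α lam : ℝ) (X : Set.Ioi (0 : ℝ) → Ω → ℝ≥0) (μ : Measure Ω)
    [IsProbabilityMeasure μ] : Prop where
  measurable : ∀ t, Measurable (X t)
  scaling_limit : ∃ c : ℝ, 0 < c ∧ c < 2 ^ (α - 1) ∧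
    ∃ Q : ℕ → ProbabilityMeasure (ℕ → Bool),
      (∀ᶠ n : ℕ in atTop, IsGBPStar (gbpFun α lam c n) (Q n)) ∧
      ∀ (m : ℕ) (t : Fin m → Set.Ioi (0 : ℝ)),
        TendstoInDistribution (fun (n : ℕ) ω (j : Fin m) ↦ walk α n (t j) ω) atTop
          (fun ω (j : Fin m) ↦ c * Real.Gamma α * (X (t j) ω : ℝ))
          (fun n ↦ (Q n : Measure (ℕ → Bool))) μ

/-! ### Lévy processes -/

/-- A real-valued Lévy process. -/
structure IsLevy (Y : ℝ≥0 → Ω → ℝ) (μ : Measure Ω) : Prop where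
  measurable : ∀ t, Measurable (Y t)
  zero : ∀ᵐ ω ∂μ, Y 0 ω = 0
  indep_increments : HasIndepIncrements Y μ
  stationary_increments : ∀ s h : ℝ≥0, IdentDistrib (fun ω ↦ Y (s + h) ω - Y s ω) (Y h) μ μ
  cadlag : ∀ᵐ ω ∂μ, ∀ t : ℝ≥0, ContinuousWithinAt (fun u ↦ Y u ω) (Set.Ici t) t ∧
    ∃ l : ℝ, Tendsto (fun u ↦ Y u ω) (𝓝[<] t) (𝓝 l)

/-! ### The functions `m` and `m*`

`C ⊆ {1, ..., m}` is enumerated increasingly by `Fin C.card`. The integration variables are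
`x_i`, `i ∈ Fin C.card`, and `x'_i` for the `i` with `k_i ≥ 2`; they form a point `z = (x, x')`. -/

/-- The sequence `0, v 0, v 1, ..., v (p - 1), 0, 0, ...`: the entries of `v` numbered from one,
with the convention `v_0 = 0`. -/
def pad {p : ℕ} (v : Fin p → ℝ) : ℕ → ℝ
  | 0 => 0
  | n + 1 => if h : n < p then v ⟨n, h⟩ else 0

/-- The integration variables. -/
abbrev Vars {p : ℕ} (k : Fin p → ℕ) : Type := (Fin p → ℝ) × ({i : Fin p // 2 ≤ k i} → ℝ)

/-- `x'_i` if `k_i ≥ 2`, and `x_i` if `k_i = 1`. -/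
def entry {p : ℕ} (k : Fin p → ℕ) (z : Vars k) (i : Fin p) : ℝ :=
  if h : 2 ≤ k i then z.2 ⟨i, h⟩ else z.1 i

section Kernels

variable {m : ℕ} (t : Fin m → ℝ) (C : Finset (Fin m)) (k : Fin C.card → ℕ)

/-- The `i`-th smallest element of `C` (counted from zero). -/
def nth (i : Fin C.card) : Fin m := C.orderEmbOfFin rfl i

/-- `t_{C(|C|)}`, the time that belongs to the largest element of `C`. -/
def lastTime : ℝ := pad (fun i ↦ t (nth C i)) C.card

/-- The domain `Q_C` (and `Q*_C`): with `τ = t_{C(|C|)}`,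
`t_{C(i)-1} / τ < x'_i < x_i < t_{C(i)} / τ` if `k_i ≥ 2`, and
`t_{C(i)-1} / τ < x_i < t_{C(i)} / τ` if `k_i = 1`; here `t_0 = 0`. -/
def domain : Set (Vars k) :=
  {z | ∀ i : Fin C.card,
    pad t (nth C i : ℕ) / lastTime t C < entry k z i ∧
    (2 ≤ k i → entry k z i < z.1 i) ∧
    z.1 i < pad t ((nth C i : ℕ) + 1) / lastTime t C}

/-- The factor `ν ^ (k_i - 1) (x_i - x'_i) ^ (α (k_i - 1) - 1) / Γ((k_i - 1) α)` for the `i` with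
`k_i ≥ 2`, and one for those with `k_i = 1`. -/
def blockFactor {p : ℕ} (α ν : ℝ) (k : Fin p → ℕ) (z : Vars k) (i : Fin p) : ℝ :=
  if 2 ≤ k i then
    ν ^ (k i - 1) * (z.1 i - entry k z i) ^ (α * ((k i : ℝ) - 1) - 1)
      / Real.Gamma (((k i : ℝ) - 1) * α)
  else 1

/-- The factor `c (x'_i - x_{i-1}) ^ (α - 1)` if `k_i ≥ 2`, and `c (x_i - x_{i-1}) ^ (α - 1)` if
`k_i = 1`; for the first index, `x_{i-1} = 0`. -/
def linkFactor {p : ℕ} (α c : ℝ) (k : Fin p → ℕ) (z : Vars k) (i : Fin p) : ℝ :=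
  c * (entry k z i - pad z.1 (i : ℕ)) ^ (α - 1)

/-- The integrand of `A(C, k)`. There is no link factor for the first index, and the exponential
factors combine to `exp(-λ τ (x_{|C|} - x'_1))` if `k_1 ≥ 2` and to `exp(-λ τ (x_{|C|} - x_1))` if
`k_1 = 1`. -/
def kernel (α lam c ν : ℝ) (z : Vars k) : ℝ :=
  (∏ i, blockFactor α ν k z i)
    * (∏ i : Fin C.card, if (i : ℕ) = 0 then 1 else linkFactor α c k z i)
    * Real.exp (-lam * lastTime t C * (pad z.1 C.card - pad (entry k z) 1))

/-- The integrand of `A*(C, k)`. -/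
def kernelStar (α lam c ν : ℝ) (z : Vars k) : ℝ :=
  (∏ i, blockFactor α ν k z i)
    * (∏ i, linkFactor α c k z i)
    * Real.exp (-lam * lastTime t C * pad z.1 C.card)

/-- `A(C, k)`. -/
def coeff (α lam c ν : ℝ) : ℝ := ∫ z in domain t C k, kernel t C k α lam c ν z

/-- `A*(C, k)`. -/
def coeffStar (α lam c ν : ℝ) : ℝ := ∫ z in domain t C k, kernelStar t C k α lam c ν z

end Kernels

/-- The `(C, k)` term of `m(σ, t)`, in the normalization `c = 1 / Γ(α)`, `ν = 1`. -/
def mgfTerm (α lam : ℝ) {m : ℕ} (σ : Fin m → ℂ) (t : Fin m → ℝ) (C : Finset (Fin m))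
    (k : Fin C.card → ℕ+) : ℂ :=
  ((lastTime t C ^ (α * ((∑ i, (k i : ℝ)) - 1) + 1)
      * coeff t C (fun i ↦ (k i : ℕ)) α lam (1 / Real.Gamma α) 1 : ℝ) : ℂ)
    * ∏ i, σ (nth C i) ^ (k i : ℕ)

/-- The `(C, k)` term of `m*(σ, t)`, in the normalization `c = 1 / Γ(α)`, `ν = 1`. -/
def mgfStarTerm (α lam : ℝ) {m : ℕ} (σ : Fin m → ℂ) (t : Fin m → ℝ) (C : Finset (Fin m))
    (k : Fin C.card → ℕ+) : ℂ :=
  ((lastTime t C ^ (α * ∑ i, (k i : ℝ))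
      * coeffStar t C (fun i ↦ (k i : ℕ)) α lam (1 / Real.Gamma α) 1 : ℝ) : ℂ)
    * ∏ i, σ (nth C i) ^ (k i : ℕ)

/-- `a_T = c b exp(-λ T) T ^ (α - 1)` with `c = 1 / Γ(α)`. -/
def aT (α lam b T : ℝ) : ℝ := 1 / Real.Gamma α * b * Real.exp (-lam * T) * T ^ (α - 1)

/-- `m((σ_1, ..., σ_m), (t_1, ..., t_m))`, where `σ_i` stands in the place of `S_i`. -/
def mgf (α lam b T : ℝ) {m : ℕ} (σ : Fin m → ℂ) (t : Fin m → ℝ) : ℂ :=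
  1 + (aT α lam b T : ℂ)
    * ∑ C : Finset (Fin m) with C.Nonempty, ∑' k : Fin C.card → ℕ+, mgfTerm α lam σ t C k

/-- `m*((σ_1, ..., σ_m), (t_1, ..., t_m))`. -/
def mgfStar (α lam : ℝ) {m : ℕ} (σ : Fin m → ℂ) (t : Fin m → ℝ) : ℂ :=
  1 + ∑ C : Finset (Fin m) with C.Nonempty, ∑' k : Fin C.card → ℕ+, mgfStarTerm α lam σ t C k

/-- The series that defines `m(σ, t)` is meaningful: its integrals exist and it converges
absolutely. -/
def MgfConverges (α lam : ℝ) {m : ℕ} (σ : Fin m → ℂ) (t : Fin m → ℝ) : Prop :=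
  ∀ C : Finset (Fin m), C.Nonempty →
    (∀ k : Fin C.card → ℕ+,
      IntegrableOn (kernel t C (fun i ↦ (k i : ℕ)) α lam (1 / Real.Gamma α) 1)
        (domain t C fun i ↦ (k i : ℕ))) ∧
    Summable (mgfTerm α lam σ t C)

/-- The series that defines `m*(σ, t)` is meaningful. -/
def MgfStarConverges (α lam : ℝ) {m : ℕ} (σ : Fin m → ℂ) (t : Fin m → ℝ) : Prop :=
  ∀ C : Finset (Fin m), C.Nonempty →
    (∀ k : Fin C.card → ℕ+,
      IntegrableOn (kernelStar t C (fun i ↦ (k i : ℕ)) α lam (1 / Real.Gamma α) 1)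
        (domain t C fun i ↦ (k i : ℕ))) ∧
    Summable (mgfStarTerm α lam σ t C)

end EMLProcess

end

/-! Given `X`, the variables `Y (X t_j)` are sums of independent increments of `Y` over the
increments of `X`. Summation by parts turns the exponent into a sum over these increments, so the
characteristic function equals `E exp (∑ i, ψ (S_i) * (X t_i - X t_{i-1}))`
(`IsLevy.integral_exp_subordinated`). Since `Re ψ ≤ 0`, this is the expectation of a bounded
continuous functional of `X`, hence the limit of the same functional of the scaled walks
(`tendsto_integral_exp_increments`). It remains to compute that limit directly.

For a binary `ξ`, `exp (w ξ) = 1 + (exp w - 1) ξ`. Multiplying out over all sites gives a sum over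
finite sets of sites, weighted by the probability that all of them carry a one, and these
probabilities are products over consecutive gaps. Grouping the sets by the list of blocks `(t_{j-1},
t_j]` that their elements visit gives a series over lists `l` (`IsRenewal.hasSum_integral_exp`).
With `s_n = c Γ(α) n ^ α`, each one-probability is `s_n` per site times a normalized weight, and
each `exp (σ / s_n) - 1` is asymptotically `σ / s_n`. The powers of `s_n`, and with them `c`,
cancel, and the normalized sums are Riemann sums of iterated integrals of gamma densities
(`tendsto_siteChainStart`).

The limit passes through the series by dominated convergence. Tilting the gaps by `exp (-θ d)`
bounds a chain by a constant times `((λ + θ) ^ (-α)) ^ l.length`. As `θ` is free, the ratio can be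
made small enough to beat both the number of lists and the size of `σ` (`siteChainStart_le`,
`tendsto_integral_exp_sum`). The same bound yields the finiteness of the integrals and the absolute
convergence of the series.

Finally the limiting series is identified. Only nondecreasing lists contribute, and they correspond
to pairs `(C, k)` (`tsum_list_eq`). Inside a block, the gamma kernels convolve to a single one of
shape `(k_i - 1) α`, which leaves the first and last sites `x'_i`, `x_i` as variables. Rescaling by
`τ` produces the powers of `τ` (`chainStart_eq_lintegral_domain`). -/

noncomputable section

namespace EMLProcess

open scoped ENNReal

/-! ### Sums over finite sets of sites, grouped by the blocks that are visited -/

/-- The total weight of the chains of sites that start after `x` and visit the blocks `J j` in the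
order of the list. -/
def siteChain {ι : Type*} (F : ℕ → ℝ) (J : ι → Finset ℕ) : List ι → ℕ → ℝ
  | [], _ => 1
  | j :: l, x => ∑ y ∈ J j with x < y, F (y - x) * siteChain F J l y

/-- The same with a separate weight `q` for the first site. -/
def siteChainStart {ι : Type*} (q F : ℕ → ℝ) (J : ι → Finset ℕ) : List ι → ℝ
  | [] => 1
  | j :: l => ∑ y ∈ J j, q y * siteChain F J l y

lemma siteChain_nonneg {ι : Type*} {F : ℕ → ℝ} (hF : ∀ d, 0 ≤ F d) (J : ι → Finset ℕ)
    (l : List ι) (x : ℕ) : 0 ≤ siteChain F J l x := by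
  induction l generalizing x with
  | nil => simp [siteChain]
  | cons j l ih => exact Finset.sum_nonneg fun y _ ↦ mul_nonneg (hF _) (ih y)

lemma siteChainStart_nonneg {ι : Type*} {q F : ℕ → ℝ} (hq : ∀ d, 0 ≤ q d) (hF : ∀ d, 0 ≤ F d)
    (J : ι → Finset ℕ) (l : List ι) : 0 ≤ siteChainStart q F J l := by
  cases l with
  | nil => simp [siteChainStart]
  | cons j l => exact Finset.sum_nonneg fun y _ ↦ mul_nonneg (hq _) (siteChain_nonneg hF J l y)

lemma siteChain_smul {ι : Type*} (c : ℝ) (F : ℕ → ℝ) (J : ι → Finset ℕ) (l : List ι) (x : ℕ) :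
    siteChain (fun d ↦ c * F d) J l x = c ^ l.length * siteChain F J l x := by
  induction l generalizing x with
  | nil => simp [siteChain]
  | cons j l ih =>
    simp only [siteChain, ih, List.length_cons, Finset.mul_sum]
    exact Finset.sum_congr rfl fun y _ ↦ by ring

/-- One factor per visited site. With `c = s_n` these powers later cancel against the factors `exp
(σ / s_n) - 1`. -/
lemma siteChainStart_smul {ι : Type*} (c : ℝ) (q F : ℕ → ℝ) (J : ι → Finset ℕ) (l : List ι) :
    siteChainStart (fun y ↦ c * q y) (fun d ↦ c * F d) J l
      = c ^ l.length * siteChainStart q F J l := by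
  cases l with
  | nil => simp [siteChainStart]
  | cons j l =>
    simp only [siteChainStart, siteChain_smul, List.length_cons, Finset.mul_sum]
    exact Finset.sum_congr rfl fun y _ ↦ by ring

/-- A sum over the subsets of `A`, split according to the least element. -/
lemma sum_powerset_eq_sum_min {M : Type*} [AddCommMonoid M]
    (A : Finset ℕ) (φ : Finset ℕ → M) :
    ∑ S ∈ A.powerset, φ S
      = φ ∅ + ∑ y ∈ A, ∑ S ∈ (A.filter (y < ·)).powerset, φ (insert y S) := by
  induction A using Finset.induction_on_min with
  | empty => simp
  | insert a s ha ih =>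
    have has : a ∉ s := fun h ↦ lt_irrefl _ (ha a h)
    have h1 : (insert a s).filter (a < ·) = s := by
      ext x; simp only [Finset.mem_filter, Finset.mem_insert]
      exact ⟨fun ⟨h, h'⟩ ↦ h.resolve_left h'.ne', fun h ↦ ⟨.inr h, ha x h⟩⟩
    have h2 : ∀ y ∈ s, (insert a s).filter (y < ·) = s.filter (y < ·) := by
      intro y hy
      ext x; simp only [Finset.mem_filter, Finset.mem_insert]
      refine ⟨fun ⟨h, h'⟩ ↦ ⟨h.resolve_left ?_, h'⟩, fun h ↦ ⟨.inr h.1, h.2⟩⟩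
      rintro rfl
      exact lt_asymm h' (ha y hy)
    rw [Finset.sum_powerset_insert has, Finset.sum_insert has, h1, ih]
    simp only [Finset.sum_congr (s₁ := s) rfl fun y hy ↦ congrArg
      (fun B : Finset ℕ ↦ ∑ S ∈ B.powerset, φ (insert y S)) (h2 y hy)]
    abel

/-- Peeling off the head of a list runs parallel to peeling off the least site of a set, as in
`sum_powerset_eq_sum_min`. -/
lemma hasSum_list_of_hasSum_cons {ι M : Type*} [Fintype ι] [AddCommMonoid M] [TopologicalSpace M]
    [ContinuousAdd M] {g : List ι → M} {a : ι → M}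
    (h : ∀ j, HasSum (fun l ↦ g (j :: l)) (a j)) : HasSum g (g [] + ∑ j, a j) := by
  classical
  have h1 : HasSum (fun l : List ι ↦ if l = [] then g [] else 0) (g []) := hasSum_ite_eq [] (g [])
  have h2 : ∀ j, HasSum (fun l : List ι ↦ if l.head? = some j then g l else 0) (a j) := by
    intro j
    rw [← (List.cons_injective (a := j)).hasSum_iff]
    · simpa [Function.comp_def] using h j
    · rintro (_ | ⟨i, l⟩) hl
      · rfl
      · refine if_neg fun he ↦ hl ⟨l, ?_⟩
        simp only [List.head?_cons, Option.some.injEq] at he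
        rw [he]
  convert h1.add (hasSum_sum fun j _ ↦ h2 j) using 1
  ext l
  revert l
  rintro (_ | ⟨i, l⟩) <;> simp

/-! ### Expansion of generating functions over sets of sites -/

section Expansion

variable {ι : Type*} [Fintype ι]

/-- The value at the site `y` of the function that equals `z j` on the block `J j`. -/
def siteWeight (z : ι → ℂ) (J : ι → Finset ℕ) (y : ℕ) : ℂ :=
  ∑ j, if y ∈ J j then z j else 0

lemma sum_siteWeight_mul (z : ι → ℂ) (J : ι → Finset ℕ) (A : Finset ℕ) (hJ : ∀ j, J j ⊆ A)
    (p : ℕ → Prop) [DecidablePred p] (g : ℕ → ℂ) :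
    ∑ y ∈ A with p y, siteWeight z J y * g y = ∑ j, ∑ y ∈ J j with p y, z j * g y := by
  simp only [siteWeight, Finset.sum_mul]
  rw [Finset.sum_comm]
  refine Finset.sum_congr rfl fun j _ ↦ ?_
  simp only [ite_mul, zero_mul]
  rw [← Finset.sum_filter, Finset.filter_filter]
  refine Finset.sum_congr ?_ fun _ _ ↦ rfl
  ext y
  simp only [Finset.mem_filter]
  exact ⟨fun h ↦ ⟨h.2.2, h.2.1⟩, fun h ↦ ⟨hJ j h.1, h.2, h.1⟩⟩

/-- The probability that all sites in `S` carry a one. -/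
def onesProb (Q : Measure (ℕ → Bool)) (S : Finset ℕ) : ℝ := Q.real {ω | ∀ y ∈ S, ω y = true}

/-- The law `Q` has the Markov property of a renewal sequence on the sites in `A`. -/
structure IsRenewal (q f : ℕ → ℝ) (A : Finset ℕ) (Q : Measure (ℕ → Bool)) : Prop where
  start : ∀ y ∈ A, onesProb Q {y} = q y
  step : ∀ S ⊆ A, ∀ x ∈ S, (∀ s ∈ S, s ≤ x) → ∀ y ∈ A, x < y →
    onesProb Q (insert y S) = onesProb Q S * f (y - x)

/-- The least new site `y` releases its weight and joins the set `S₀` of sites already fixed. -/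
lemma sum_insert_min_eq (z : ι → ℂ) (J : ι → Finset ℕ) (A : Finset ℕ)
    (Q : Measure (ℕ → Bool)) (y : ℕ) (S₀ : Finset ℕ) :
    ∑ S ∈ (A.filter (y < ·)).powerset,
        (∏ y ∈ insert y S, siteWeight z J y) * (onesProb Q (S₀ ∪ insert y S) : ℂ)
      = siteWeight z J y * ∑ S ∈ (A.filter (y < ·)).powerset,
        (∏ y ∈ S, siteWeight z J y) * (onesProb Q (insert y S₀ ∪ S) : ℂ) := by
  rw [Finset.mul_sum]
  refine Finset.sum_congr rfl fun S hS ↦ ?_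
  have hyS : y ∉ S := fun hm ↦ lt_irrefl _
    (Finset.mem_filter.1 (Finset.mem_powerset.1 hS hm)).2
  rw [Finset.prod_insert hyS, Finset.union_insert, Finset.insert_union, mul_assoc]

/-- `S₀` accumulates the sites chosen so far and `x` is the last of them. The induction is on the
number of sites to the right of `x`, which drops with each new site `y`. The renewal property
replaces the probability for `insert y S₀` by that for `S₀` times `f (y - x)`, one link of
`siteChain`. -/
lemma IsRenewal.hasSum_aux {q f : ℕ → ℝ} {A : Finset ℕ} {Q : Measure (ℕ → Bool)}
    (h : IsRenewal q f A Q) (z : ι → ℂ) (J : ι → Finset ℕ) (hJ : ∀ j, J j ⊆ A)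
    (n : ℕ) (x : ℕ) (hn : (A.filter (x < ·)).card ≤ n) (S₀ : Finset ℕ) (hS₀ : S₀ ⊆ A)
    (hx : x ∈ S₀) (hmax : ∀ s ∈ S₀, s ≤ x) :
    HasSum (fun l : List ι ↦ (l.map z).prod * (onesProb Q S₀ * siteChain f J l x : ℝ))
      (∑ S ∈ (A.filter (x < ·)).powerset,
        (∏ y ∈ S, siteWeight z J y) * (onesProb Q (S₀ ∪ S) : ℂ)) := by
  induction n generalizing x S₀ with
  | zero =>
    have h0 : A.filter (x < ·) = ∅ := by simpa using hn
    have h1 : ∀ j, (J j).filter (x < ·) = ∅ := fun j ↦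
      Finset.subset_empty.1 (h0 ▸ Finset.filter_subset_filter _ (hJ j))
    rw [h0]
    convert hasSum_single ([] : List ι) ?_ using 1
    · simp [siteChain]
    · rintro (_ | ⟨j, l⟩) hl
      · exact absurd rfl hl
      · simp [siteChain, h1]
  | succ n ih =>
    rw [sum_powerset_eq_sum_min]
    have key : ∀ j, HasSum (fun l : List ι ↦ ((j :: l).map z).prod
          * (onesProb Q S₀ * siteChain f J (j :: l) x : ℝ))
          (∑ y ∈ J j with x < y, z j * ∑ S ∈ (A.filter (y < ·)).powerset,
            (∏ y ∈ S, siteWeight z J y) * (onesProb Q (insert y S₀ ∪ S) : ℂ)) := by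
        intro j
        have hs := hasSum_sum (s := (J j).filter (x < ·)) (f := fun y (l : List ι) ↦
          z j * ((l.map z).prod * (onesProb Q (insert y S₀) * siteChain f J l y : ℝ)))
          (a := fun y ↦ z j * ∑ S ∈ (A.filter (y < ·)).powerset,
            (∏ y ∈ S, siteWeight z J y) * (onesProb Q (insert y S₀ ∪ S) : ℂ)) (by
          intro y hy
          rw [Finset.mem_filter] at hy
          refine (ih y ?_ (insert y S₀) ?_ ?_ ?_).mul_left _
          · refine Nat.le_of_lt_succ (lt_of_lt_of_le (Finset.card_lt_card ?_) hn)
            refine Finset.ssubset_iff_subset_ne.2 ⟨?_, fun he ↦ ?_⟩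
            · intro w hw
              rw [Finset.mem_filter] at hw ⊢
              exact ⟨hw.1, hy.2.trans hw.2⟩
            · have : y ∈ A.filter (y < ·) := by
                rw [he]; exact Finset.mem_filter.2 ⟨hJ j hy.1, hy.2⟩
              exact lt_irrefl _ (Finset.mem_filter.1 this).2
          · exact Finset.insert_subset (hJ j hy.1) hS₀
          · exact Finset.mem_insert_self _ _
          · intro s hs
            rcases Finset.mem_insert.1 hs with rfl | hs
            · exact le_rfl
            · exact (hmax s hs).trans hy.2.le)
        convert hs using 1
        ext l
        simp only [siteChain, List.map_cons, List.prod_cons, Finset.mul_sum]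
        push_cast
        rw [Finset.mul_sum]
        refine Finset.sum_congr rfl fun y hy ↦ ?_
        rw [Finset.mem_filter] at hy
        rw [h.step S₀ hS₀ x hx hmax y (hJ j hy.1) hy.2]
        push_cast
        ring
    convert hasSum_list_of_hasSum_cons (g := fun l : List ι ↦
      (l.map z).prod * (onesProb Q S₀ * siteChain f J l x : ℝ)) key using 1
    rw [← sum_siteWeight_mul z J A hJ (x < ·) (fun y ↦ ∑ S ∈ (A.filter (y < ·)).powerset,
      (∏ y ∈ S, siteWeight z J y) * (onesProb Q (insert y S₀ ∪ S) : ℂ))]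
    congr 1
    · simp [siteChain]
    · refine Finset.sum_congr rfl fun y hy ↦ ?_
      have hf : (A.filter (x < ·)).filter (y < ·) = A.filter (y < ·) := by
        rw [Finset.filter_filter]
        exact Finset.filter_congr fun w _ ↦
          ⟨fun h ↦ h.2, fun h ↦ ⟨(Finset.mem_filter.1 hy).2.trans h, h⟩⟩
      rw [hf]
      exact sum_insert_min_eq z J A Q y S₀

/-- The sum over all sets of sites, grouped by the list of the blocks that are visited. -/
lemma IsRenewal.hasSum {q f : ℕ → ℝ} {A : Finset ℕ} {Q : Measure (ℕ → Bool)}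
    [IsProbabilityMeasure Q] (h : IsRenewal q f A Q) (z : ι → ℂ) (J : ι → Finset ℕ)
    (hJ : ∀ j, J j ⊆ A) :
    HasSum (fun l : List ι ↦ (l.map z).prod * (siteChainStart q f J l : ℂ))
      (∑ S ∈ A.powerset, (∏ y ∈ S, siteWeight z J y) * (onesProb Q S : ℂ)) := by
  rw [sum_powerset_eq_sum_min]
  have key : ∀ j, HasSum (fun l : List ι ↦ ((j :: l).map z).prod
      * (siteChainStart q f J (j :: l) : ℂ))
      (∑ y ∈ J j, z j * ∑ S ∈ (A.filter (y < ·)).powerset,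
        (∏ y ∈ S, siteWeight z J y) * (onesProb Q (insert y ∅ ∪ S) : ℂ)) := by
    intro j
    have hs := hasSum_sum (s := J j) (f := fun y (l : List ι) ↦
      z j * ((l.map z).prod * (onesProb Q (insert y ∅) * siteChain f J l y : ℝ)))
      (a := fun y ↦ z j * ∑ S ∈ (A.filter (y < ·)).powerset,
        (∏ y ∈ S, siteWeight z J y) * (onesProb Q (insert y ∅ ∪ S) : ℂ)) (fun y hy ↦
      (h.hasSum_aux z J hJ _ y le_rfl (insert y ∅) (by simpa using hJ j hy)
        (by simp) (by simp)).mul_left _)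
    convert hs using 1
    ext l
    simp only [siteChainStart, List.map_cons, List.prod_cons]
    push_cast
    rw [Finset.mul_sum]
    refine Finset.sum_congr rfl fun y hy ↦ ?_
    rw [insert_empty_eq, h.start y (hJ j hy)]
    ring
  convert hasSum_list_of_hasSum_cons (g := fun l : List ι ↦
    (l.map z).prod * (siteChainStart q f J l : ℂ)) key using 1
  have := sum_siteWeight_mul z J A hJ (fun _ ↦ True) (fun y ↦ ∑ S ∈ (A.filter (y < ·)).powerset,
      (∏ y ∈ S, siteWeight z J y) * (onesProb Q (insert y ∅ ∪ S) : ℂ))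
  simp only [Finset.filter_true] at this
  rw [← this]
  congr 1
  · simp [siteChainStart, onesProb]
  · refine Finset.sum_congr rfl fun y _ ↦ ?_
    rw [← sum_insert_min_eq]
    simp

/-- The expectation of a product over the sites. -/
lemma integral_prod_one_add (Q : Measure (ℕ → Bool)) [IsProbabilityMeasure Q] (A : Finset ℕ)
    (w : ℕ → ℂ) :
    ∫ ω, ∏ y ∈ A, (1 + w y * if ω y = true then 1 else 0) ∂Q
      = ∑ S ∈ A.powerset, (∏ y ∈ S, w y) * (onesProb Q S : ℂ) := by
  have hm : ∀ S : Finset ℕ, MeasurableSet {ω : ℕ → Bool | ∀ y ∈ S, ω y = true} := by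
    intro S
    have : {ω : ℕ → Bool | ∀ y ∈ S, ω y = true} = ⋂ y ∈ S, (fun ω ↦ ω y) ⁻¹' {true} := by
      ext; simp
    rw [this]
    exact S.measurableSet_biInter fun y _ ↦ measurable_pi_apply y (measurableSet_singleton _)
  have h1 : ∀ ω : ℕ → Bool, ∏ y ∈ A, (1 + w y * if ω y = true then (1 : ℂ) else 0)
      = ∑ S ∈ A.powerset, (∏ y ∈ S, w y)
        * {ω : ℕ → Bool | ∀ y ∈ S, ω y = true}.indicator 1 ω := by
    intro ω
    rw [Finset.prod_one_add]
    refine Finset.sum_congr rfl fun S _ ↦ ?_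
    rw [Finset.prod_mul_distrib, Finset.prod_ite_zero]
    simp [Set.indicator_apply]
  simp only [h1]
  rw [integral_finsetSum]
  · refine Finset.sum_congr rfl fun S _ ↦ ?_
    rw [integral_const_mul, integral_indicator (hm S)]
    simp [onesProb]
  · intro S _
    exact ((integrable_const (1 : ℂ)).indicator (hm S)).const_mul _

/-- The generating function of the numbers of ones in the blocks `J j`. -/
lemma IsRenewal.hasSum_integral_exp {q f : ℕ → ℝ} {A : Finset ℕ} {Q : Measure (ℕ → Bool)}
    [IsProbabilityMeasure Q] (h : IsRenewal q f A Q) (w : ι → ℂ) (J : ι → Finset ℕ)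
    (hJ : ∀ j, J j ⊆ A) (hd : Pairwise fun i j ↦ Disjoint (J i) (J j)) :
    HasSum (fun l : List ι ↦ (l.map fun j ↦ Complex.exp (w j) - 1).prod
        * (siteChainStart q f J l : ℂ))
      (∫ ω, Complex.exp (∑ j, w j * ∑ y ∈ J j, if ω y = true then 1 else 0) ∂Q) := by
  classical
  convert h.hasSum (fun j ↦ Complex.exp (w j) - 1) J hJ using 1
  rw [← integral_prod_one_add]
  congr 1
  ext ω
  rw [Complex.exp_sum]
  -- Sites outside all blocks have weight zero and contribute a factor one. Inside, disjointness
  -- leaves a single summand in `siteWeight`.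
  have h1 : ∀ y ∈ A, y ∉ Finset.univ.biUnion J → (1 + siteWeight
      (fun j ↦ Complex.exp (w j) - 1) J y * if ω y = true then (1 : ℂ) else 0) = 1 := by
    intro y _ hy
    simp only [Finset.mem_biUnion, Finset.mem_univ, true_and, not_exists] at hy
    simp [siteWeight, hy]
  rw [← Finset.prod_subset (Finset.biUnion_subset.2 fun j _ ↦ hJ j) h1,
    Finset.prod_biUnion fun i _ j _ hij ↦ hd hij]
  refine Finset.prod_congr rfl fun j _ ↦ ?_
  rw [Finset.mul_sum, Complex.exp_sum]
  refine Finset.prod_congr rfl fun y hy ↦ ?_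
  have : siteWeight (fun j ↦ Complex.exp (w j) - 1) J y = Complex.exp (w j) - 1 := by
    rw [siteWeight, Finset.sum_eq_single j, if_pos hy]
    · exact fun i _ hij ↦ if_neg fun hi ↦ Finset.disjoint_left.1 (hd hij) hi hy
    · simp
  rw [this]
  split_ifs <;> simp

end Expansion

/-- Enumerate `S` increasingly. Appending a site beyond its maximum keeps the enumeration increasing
and adds exactly one factor to the product. -/
lemma isRenewal_of_forall_strictMono {q f : ℕ → ℝ} {A : Finset ℕ} {Q : Measure (ℕ → Bool)}
    (h : ∀ (k : ℕ) (i : Fin (k + 1) → ℕ), StrictMono i → (∀ j, i j ∈ A) →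
      Q.real {ω | ∀ j, ω (i j) = true}
        = q (i 0) * ∏ j : Fin k, f (i j.succ - i j.castSucc)) : IsRenewal q f A Q where
  start y hy := by
    have := h 0 (fun _ ↦ y) (fun a b hab ↦ absurd hab (by omega)) (fun _ ↦ hy)
    simpa [onesProb] using this
  step S hS x hx hmax y hy hxy := by
    have hpos : 0 < S.card := Finset.card_pos.2 ⟨x, hx⟩
    obtain ⟨k, hk⟩ := Nat.exists_eq_succ_of_ne_zero hpos.ne'
    have hk' : S.card = k + 1 := hk
    let i : Fin (k + 1) → ℕ := fun j ↦ S.orderEmbOfFin hk' j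
    have hmem : ∀ j, i j ∈ S := fun j ↦ Finset.orderEmbOfFin_mem S hk' j
    have hrange : ∀ s, s ∈ S ↔ ∃ j, i j = s := fun s ↦ by
      have := Finset.range_orderEmbOfFin S hk'
      rw [Set.ext_iff] at this
      exact (this s).symm
    have hmono : StrictMono i := (S.orderEmbOfFin hk').strictMono
    have hlast : i (Fin.last k) = x := by
      obtain ⟨j, hj⟩ := (hrange x).1 hx
      exact le_antisymm (hmax _ (hmem _)) (hj ▸ hmono.monotone (Fin.le_last j))
    have hmono' : StrictMono (Fin.snoc i y : Fin (k + 2) → ℕ) := by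
      rw [Fin.strictMono_iff_lt_succ]
      intro j
      induction j using Fin.lastCases with
      | last => simpa [hlast] using hxy
      | cast j =>
        rw [Fin.succ_castSucc, Fin.snoc_castSucc, Fin.snoc_castSucc]
        exact hmono j.castSucc_lt_succ
    have h1 := h k i hmono fun j ↦ hS (hmem j)
    have h2 := h (k + 1) (Fin.snoc i y) hmono' fun j ↦ by
      induction j using Fin.lastCases with
      | last => simpa using hy
      | cast j => simpa using hS (hmem j)
    have e1 : {ω : ℕ → Bool | ∀ j, ω (i j) = true} = {ω | ∀ s ∈ S, ω s = true} := by
      ext ω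
      refine ⟨fun H s hs ↦ ?_, fun H j ↦ H _ (hmem j)⟩
      obtain ⟨j, rfl⟩ := (hrange s).1 hs
      exact H j
    have e2 : {ω : ℕ → Bool | ∀ j, ω ((Fin.snoc i y : Fin (k + 2) → ℕ) j) = true}
        = {ω | ∀ s ∈ insert y S, ω s = true} := by
      ext ω
      simp only [Set.mem_ofPred_eq, Finset.forall_mem_insert, Fin.forall_fin_succ', Fin.snoc_last,
        Fin.snoc_castSucc]
      rw [and_comm]
      refine and_congr_right fun _ ↦ ?_
      simpa [Fin.forall_fin_succ'] using Set.ext_iff.1 e1 ω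
    rw [e1] at h1
    rw [e2] at h2
    rw [onesProb, onesProb, h1, h2, Fin.prod_univ_castSucc, ← mul_assoc]
    have e3 : (Fin.snoc i y : Fin (k + 2) → ℕ) 0 = i 0 := by
      change (Fin.snoc i y : Fin (k + 2) → ℕ) (Fin.castSucc 0) = _
      rw [Fin.snoc_castSucc]
    have e4 : ∀ j : Fin k, f ((Fin.snoc i y : Fin (k + 2) → ℕ) j.castSucc.succ
        - (Fin.snoc i y : Fin (k + 2) → ℕ) j.castSucc.castSucc) = f (i j.succ - i j.castSucc) :=
      fun j ↦ by rw [Fin.succ_castSucc, Fin.snoc_castSucc, Fin.snoc_castSucc]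
    rw [e3, Finset.prod_congr rfl fun j _ ↦ e4 j, Fin.succ_last, Fin.snoc_last,
      Fin.snoc_castSucc, hlast]

lemma IsGBP.isRenewal {f : ℕ → ℝ} {b : ℝ} {N : ℕ} {Q : Measure (ℕ → Bool)} (h : IsGBP f b N Q) :
    IsRenewal (fun _ ↦ b * f N) f (Finset.Icc 1 N) Q :=
  isRenewal_of_forall_strictMono fun k i hi hA ↦ h k i hi fun j ↦ Finset.mem_Icc.1 (hA j)

lemma IsGBPStar.isRenewal {f : ℕ → ℝ} {Q : Measure (ℕ → Bool)} (h : IsGBPStar f Q) (N : ℕ) :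
    IsRenewal f f (Finset.Icc 1 N) Q :=
  isRenewal_of_forall_strictMono fun k i hi hA ↦ h k i hi fun j ↦ (Finset.mem_Icc.1 (hA j)).1

/-! ### Continuous chains -/

/-- The density `d ^ (a - 1) exp (-λ d) / Γ(a)` of an exponentially tilted gamma law. -/
def gammaKernel (a lam d : ℝ) : ℝ≥0∞ :=
  if 0 < d then ENNReal.ofReal (d ^ (a - 1) / Real.Gamma a * Real.exp (-lam * d)) else 0

/-- The continuous counterpart of `siteChain`. -/
def chain {ι : Type*} (κ : ℝ → ℝ≥0∞) (I : ι → Set ℝ) : List ι → ℝ → ℝ≥0∞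
  | [], _ => 1
  | j :: l, x => ∫⁻ y in I j, κ (y - x) * chain κ I l y

/-- The continuous counterpart of `siteChainStart`. -/
def chainStart {ι : Type*} (q κ : ℝ → ℝ≥0∞) (I : ι → Set ℝ) : List ι → ℝ≥0∞
  | [] => 1
  | j :: l => ∫⁻ y in I j, q y * chain κ I l y

lemma gammaKernel_ne_top (a lam d : ℝ) : gammaKernel a lam d ≠ ∞ := by
  unfold gammaKernel; split_ifs <;> simp

@[fun_prop]
lemma measurable_gammaKernel (a lam : ℝ) : Measurable (gammaKernel a lam) :=
  Measurable.ite measurableSet_Ioi (by fun_prop) measurable_const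

lemma measurable_chain {ι : Type*} {κ : ℝ → ℝ≥0∞} (hκ : Measurable κ) (I : ι → Set ℝ)
    (l : List ι) : Measurable (chain κ I l) := by
  induction l with
  | nil => exact measurable_const
  | cons j l ih =>
    refine Measurable.lintegral_prod_right' (f := fun p : ℝ × ℝ ↦ κ (p.2 - p.1) * chain κ I l p.2) ?_
    fun_prop

/-- Away from `d = 0` the kernel is `θ ^ (-a)` times the gamma probability density. That this mass
is small for large `θ` is the source of all geometric bounds below. -/
lemma lintegral_gammaKernel {a θ : ℝ} (ha : 0 < a) (hθ : 0 < θ) :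
    ∫⁻ d, gammaKernel a θ d = ENNReal.ofReal (θ ^ (-a)) := by
  have h1 : ∀ d, d ≠ 0 →
      gammaKernel a θ d = ENNReal.ofReal (θ ^ (-a)) * gammaPDF a θ d := by
    intro d hd
    rw [gammaKernel, gammaPDF_eq]
    rcases lt_or_gt_of_ne hd with h | h
    · rw [if_neg h.le.not_gt, if_neg h.not_ge]; simp
    · rw [if_pos h, if_pos h.le, ← ENNReal.ofReal_mul (by positivity)]
      congr 1
      rw [Real.rpow_neg hθ.le]
      have := (Real.rpow_pos_of_pos hθ a).ne'
      have := (Real.Gamma_pos_of_pos ha).ne'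
      rw [neg_mul]
      field_simp
  rw [lintegral_congr_ae (g := fun d ↦ ENNReal.ofReal (θ ^ (-a)) * gammaPDF a θ d),
    lintegral_const_mul' _ _ ENNReal.ofReal_ne_top, lintegral_gammaPDF_eq_one ha hθ, mul_one]
  filter_upwards [compl_mem_ae_iff.2 (measure_singleton (0 : ℝ))] with d hd using h1 d hd

/-! ### Sums over sites as integrals of step functions -/

/-- The site `i` owns the cell `((i - 1) / n, i / n]`, where `⌈n * y⌉₊ = i`, and the factor `n`
cancels its length. The site `0` is excluded because its cell would lie in `y ≤ 0`. -/
lemma sum_eq_lintegral_ceil {n : ℕ} (hn : 0 < n) (A : Finset ℕ) (hA : ∀ i ∈ A, 1 ≤ i)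
    (h : ℕ → ℝ≥0∞) :
    ∑ i ∈ A, h i = ∫⁻ y in Set.Ioi (0 : ℝ),
      n * if ⌈n * y⌉₊ ∈ A then h ⌈n * y⌉₊ else 0 := by
  have hn' : (0 : ℝ) < n := by exact_mod_cast hn
  have h1 : ∀ y : ℝ, ((n : ℝ≥0∞) * if ⌈n * y⌉₊ ∈ A then h ⌈n * y⌉₊ else 0)
      = ∑ i ∈ A, {y : ℝ | ⌈n * y⌉₊ = i}.indicator (fun _ ↦ n * h i) y := by
    intro y
    simp only [Set.indicator_apply, Set.mem_ofPred_eq]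
    rw [Finset.sum_ite_eq]
    split_ifs <;> simp
  have hm : ∀ i : ℕ, MeasurableSet {y : ℝ | ⌈n * y⌉₊ = i} := fun i ↦
    (Nat.measurable_ceil.comp (measurable_const_mul (n : ℝ))) (measurableSet_singleton i)
  simp only [h1]
  rw [lintegral_finsetSum _ fun i _ ↦ measurable_const.indicator (hm i)]
  refine Finset.sum_congr rfl fun i hi ↦ ?_
  rw [lintegral_indicator_const (hm i), Measure.restrict_apply (hm i)]
  have hset : {y : ℝ | ⌈n * y⌉₊ = i} ∩ Set.Ioi 0 = Set.Ioc (((i : ℝ) - 1) / n) (i / n) := by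
    ext y
    have hi1 := hA i hi
    simp only [Set.mem_inter_iff, Set.mem_ofPred_eq, Set.mem_Ioi, Set.mem_Ioc]
    rw [Nat.ceil_eq_iff (by omega), Nat.cast_pred hi1, div_lt_iff₀ hn', le_div_iff₀ hn',
      mul_comm y]
    refine ⟨fun h ↦ h.1, fun h ↦ ⟨h, ?_⟩⟩
    have : (1 : ℝ) ≤ i := by exact_mod_cast hi1
    have : 0 < n * y := by linarith [h.1]
    exact pos_of_mul_pos_right this hn'.le
  rw [hset, Real.volume_Ioc, ← sub_div, sub_sub_cancel, mul_right_comm, ENNReal.ofReal_div_of_pos hn']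
  simp only [ENNReal.ofReal_one, ENNReal.ofReal_natCast]
  rw [ENNReal.mul_div_cancel (by exact_mod_cast hn.ne') (ENNReal.natCast_ne_top n), one_mul]

/-- The normalized renewal probabilities `n ^ (-α) d ^ (α - 1) exp (-λ d / n) / Γ(α)`. -/
def siteKernel (α lam : ℝ) (n d : ℕ) : ℝ :=
  Real.exp (-lam * d / n) * (d : ℝ) ^ (α - 1) / Real.Gamma α / (n : ℝ) ^ α

lemma siteKernel_nonneg {α : ℝ} (hα : 0 < α) (lam : ℝ) (n d : ℕ) : 0 ≤ siteKernel α lam n d := by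
  have := Real.Gamma_pos_of_pos hα
  unfold siteKernel
  positivity

lemma mul_siteKernel (α lam : ℝ) {n : ℕ} (hn : 0 < n) (d : ℕ) :
    n * siteKernel α lam n d
      = ((d : ℝ) / n) ^ (α - 1) / Real.Gamma α * Real.exp (-lam * (d / n)) := by
  have hn' : (0 : ℝ) < n := by exact_mod_cast hn
  rw [siteKernel, Real.div_rpow (Nat.cast_nonneg d) hn'.le, Real.rpow_sub_one hn'.ne',
    mul_div_assoc (-lam)]
  have := (Real.rpow_pos_of_pos hn' α).ne'
  field_simp

/-- The step function takes on each cell the value of the gamma density of rate `lam + θ` at the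
right end point. This density decreases because `α ≤ 1`, so the sum is at most its integral. -/
lemma sum_siteKernel_mul_exp_le {α lam θ : ℝ} (hα : 0 < α) (hα1 : α ≤ 1) (hθ : 0 < lam + θ)
    {n : ℕ} (hn : 0 < n) (A : Finset ℕ) (hA : ∀ i ∈ A, 1 ≤ i) :
    ∑ d ∈ A, siteKernel α lam n d * Real.exp (-θ * (d / n)) ≤ (lam + θ) ^ (-α) := by
  have hn' : (0 : ℝ) < n := by exact_mod_cast hn
  have hΓ := Real.Gamma_pos_of_pos hα
  rw [← ENNReal.ofReal_le_ofReal_iff (by positivity), ENNReal.ofReal_sum_of_nonneg fun d _ ↦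
    mul_nonneg (siteKernel_nonneg hα lam n d) (Real.exp_pos _).le,
    sum_eq_lintegral_ceil hn A hA, ← lintegral_gammaKernel hα hθ]
  refine (setLIntegral_mono' measurableSet_Ioi fun y hy ↦ ?_).trans (setLIntegral_le_lintegral _ _)
  rw [Set.mem_Ioi] at hy
  rw [gammaKernel, if_pos hy]
  split_ifs with hm
  · rw [← ENNReal.ofReal_natCast, ← ENNReal.ofReal_mul (by positivity), ← mul_assoc,
      mul_siteKernel α lam hn, mul_assoc, ← Real.exp_add]
    refine ENNReal.ofReal_le_ofReal ?_
    have hle : y ≤ (⌈n * y⌉₊ : ℝ) / n := by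
      rw [le_div_iff₀ hn', mul_comm]; exact Nat.le_ceil _
    gcongr ?_ / _ * Real.exp ?_
    · exact Real.rpow_le_rpow_of_nonpos hy hle (by linarith)
    · nlinarith
  · simp

/-- The factor `exp (θ (N - x) / n)` pays for the tilt. Passing from `x` to `y` it splits off `exp
(-θ (y - x) / n)`, and the sum over the tilted link is at most `(lam + θ) ^ (-α)`. -/
lemma siteChain_le {ι : Type*} {α lam θ : ℝ} (hα : 0 < α) (hα1 : α ≤ 1) (hθ0 : 0 ≤ θ) (hθ : 0 < lam + θ)
    {n N : ℕ} (hn : 0 < n) (J : ι → Finset ℕ) (hJ : ∀ j, J j ⊆ Finset.Icc 1 N) (l : List ι)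
    {x : ℕ} (hx : x ≤ N) :
    siteChain (siteKernel α lam n) J l x
      ≤ Real.exp (θ * (((N : ℝ) - x) / n)) * ((lam + θ) ^ (-α)) ^ l.length := by
  have hΓ := Real.Gamma_pos_of_pos hα
  have hn' : (0 : ℝ) < n := by exact_mod_cast hn
  induction l generalizing x with
  | nil =>
    simp only [siteChain, List.length_nil, pow_zero, mul_one]
    have : (x : ℝ) ≤ N := by exact_mod_cast hx
    exact Real.one_le_exp (mul_nonneg hθ0 (div_nonneg (sub_nonneg.2 this) hn'.le))
  | cons j l ih =>
    set ρ := (lam + θ) ^ (-α) with hρ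
    have hρ0 : 0 ≤ ρ := by positivity
    calc siteChain (siteKernel α lam n) J (j :: l) x
        ≤ ∑ y ∈ J j with x < y, siteKernel α lam n (y - x)
            * (Real.exp (θ * (((N : ℝ) - y) / n)) * ρ ^ l.length) := by
          refine Finset.sum_le_sum fun y hy ↦ mul_le_mul_of_nonneg_left (ih ?_)
            (siteKernel_nonneg hα lam n _)
          exact (Finset.mem_Icc.1 (hJ j (Finset.mem_filter.1 hy).1)).2
      _ = Real.exp (θ * (((N : ℝ) - x) / n)) * ρ ^ l.length
            * ∑ y ∈ J j with x < y, siteKernel α lam n (y - x)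
              * Real.exp (-θ * (((y - x : ℕ) : ℝ) / n)) := by
          rw [Finset.mul_sum]
          refine Finset.sum_congr rfl fun y hy ↦ ?_
          have hxy := (Finset.mem_filter.1 hy).2
          have he : Real.exp (θ * (((N : ℝ) - y) / n)) = Real.exp (θ * (((N : ℝ) - x) / n))
              * Real.exp (-θ * (((y - x : ℕ) : ℝ) / n)) := by
            rw [← Real.exp_add, Nat.cast_sub hxy.le]
            congr 1
            ring
          rw [he]
          ring
      _ ≤ Real.exp (θ * (((N : ℝ) - x) / n)) * ρ ^ l.length * ρ := by
          refine mul_le_mul_of_nonneg_left ?_ (by positivity)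
          have hinj : Set.InjOn (fun y ↦ y - x) ((J j).filter (x < ·) : Set ℕ) := by
            intro y hy y' hy' h
            simp only [Finset.coe_filter, Set.mem_ofPred_eq] at hy hy' h
            omega
          rw [← Finset.sum_image (g := fun y ↦ y - x) (f := fun d : ℕ ↦ siteKernel α lam n d
            * Real.exp (-θ * ((d : ℝ) / n))) hinj]
          refine sum_siteKernel_mul_exp_le hα hα1 hθ hn _ fun i hi ↦ ?_
          obtain ⟨y, hy, rfl⟩ := Finset.mem_image.1 hi
          have := (Finset.mem_filter.1 hy).2
          omega
      _ = _ := by rw [List.length_cons, pow_succ]; ring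

/-! ### Convergence of the sums over sites -/

/-- The sites in the block `(a, b]`, at scale `n`. -/
def siteBlock (n : ℕ) (a b : ℝ) : Finset ℕ := Finset.Ioc ⌊n * a⌋₊ ⌊n * b⌋₊

lemma eventually_add_one_lt_mul {a b : ℝ} (h : a < b) : ∀ᶠ n : ℕ in atTop, n * a + 1 < n * b := by
  have h1 : Tendsto (fun n : ℕ ↦ (n : ℝ) * (b - a)) atTop atTop :=
    tendsto_natCast_atTop_atTop.atTop_mul_const (sub_pos.2 h)
  filter_upwards [h1.eventually_gt_atTop 1] with n hn
  linarith

lemma ceil_le_floor_of_add_one_lt {u v : ℝ} (h : u + 1 < v) : ⌈u⌉₊ ≤ ⌊v⌋₊ := by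
  rcases le_or_gt u 0 with hu | hu
  · simp [Nat.ceil_eq_zero.2 hu]
  · refine Nat.le_floor ((Nat.ceil_lt_add_one hu.le).trans h).le

lemma floor_lt_ceil_of_lt {u v : ℝ} (h : u < v) (hv : 0 < v) : ⌊u⌋₊ < ⌈v⌉₊ := by
  rcases le_or_gt 0 u with hu | hu
  · exact Nat.lt_ceil.2 ((Nat.floor_le hu).trans_lt h)
  · rw [Nat.floor_of_nonpos hu.le]; exact Nat.ceil_pos.2 hv

/-- The mesh limit of a weighted sum over the sites in a block. -/
lemma tendsto_sum_siteBlock {a b : ℝ} (ha : 0 ≤ a) (hab : a < b) {q V : ℕ → ℕ → ℝ}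
    (hq : ∀ n y, 0 ≤ q n y) {κ W D : ℝ → ℝ≥0∞} {M : ℝ} (hκ : ∀ y, κ y ≠ ∞) (hW : ∀ y, 0 < y → y < b → W y ≠ ∞)
    (hqκ : ∀ᵐ y : ℝ, 0 < y →
      Tendsto (fun n : ℕ ↦ ENNReal.ofReal (n * q n ⌈n * y⌉₊)) atTop (𝓝 (κ y)))
    (hVW : ∀ y, 0 < y → y < b →
      Tendsto (fun n : ℕ ↦ ENNReal.ofReal (V n ⌈n * y⌉₊)) atTop (𝓝 (W y)))
    (hD : ∀ᶠ n : ℕ in atTop, ∀ y, 0 < y → y ≤ b → ENNReal.ofReal (n * q n ⌈n * y⌉₊) ≤ D y)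
    (hDint : ∫⁻ y in Set.Ioc 0 b, D y ≠ ∞)
    (hM : ∀ᶠ n : ℕ in atTop, ∀ y ≤ ⌊n * b⌋₊, V n y ≤ M) (hV : ∀ n y, 0 ≤ V n y) :
    Tendsto (fun n ↦ ENNReal.ofReal (∑ y ∈ siteBlock n a b, q n y * V n y)) atTop
      (𝓝 (∫⁻ y in Set.Ioo a b, κ y * W y)) := by
  have hb : 0 < b := ha.trans_lt hab
  have hG : ∀ᶠ n : ℕ in atTop, ∫⁻ y in Set.Ioi (0 : ℝ),
      (n * if ⌈n * y⌉₊ ∈ siteBlock n a b then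
        ENNReal.ofReal (q n ⌈n * y⌉₊ * V n ⌈n * y⌉₊) else 0)
      = ENNReal.ofReal (∑ y ∈ siteBlock n a b, q n y * V n y) := by
    filter_upwards [eventually_gt_atTop 0] with n hn
    rw [ENNReal.ofReal_sum_of_nonneg fun y _ ↦ mul_nonneg (hq n y) (hV n y),
      sum_eq_lintegral_ceil hn _ fun i hi ↦ by
        have := (Finset.mem_Ioc.1 hi).1; omega]
  refine Tendsto.congr' hG ?_
  have hlim : ∫⁻ y in Set.Ioo a b, κ y * W y
      = ∫⁻ y in Set.Ioi (0 : ℝ), (Set.Ioo a b).indicator (fun y ↦ κ y * W y) y := by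
    have hs : Set.Ioo a b ∩ Set.Ioi 0 = Set.Ioo a b :=
      Set.inter_eq_left.2 fun y hy ↦ ha.trans_lt hy.1
    rw [lintegral_indicator measurableSet_Ioo, Measure.restrict_restrict measurableSet_Ioo, hs]
  rw [hlim]
  refine tendsto_lintegral_filter_of_dominated_convergence
    ((Set.Ioc 0 b).indicator fun y ↦ D y * ENNReal.ofReal M) ?_ ?_ ?_ ?_
  · refine Eventually.of_forall fun n ↦ ?_
    have : Measurable fun i : ℕ ↦ (n : ℝ≥0∞) * if i ∈ siteBlock n a b then
        ENNReal.ofReal (q n i * V n i) else 0 := measurable_from_top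
    exact this.comp (Nat.measurable_ceil.comp (measurable_const_mul (n : ℝ)))
  · filter_upwards [hD, hM, eventually_gt_atTop 0] with n hDn hMn hn
    refine (ae_restrict_iff' measurableSet_Ioi).2 (Eventually.of_forall fun y hy ↦ ?_)
    split_ifs with hm
    · have hle := (Finset.mem_Ioc.1 hm).2
      have hn' : (0 : ℝ) < n := by exact_mod_cast hn
      have hyb : y ≤ b := by
        have h1 : (n : ℝ) * y ≤ n * b := (Nat.le_ceil _).trans
          ((Nat.cast_le.2 hle).trans (Nat.floor_le (by positivity)))
        exact le_of_mul_le_mul_left h1 hn'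
      rw [Set.indicator_of_mem (show y ∈ Set.Ioc 0 b from ⟨hy, hyb⟩), ← ENNReal.ofReal_natCast,
        ← ENNReal.ofReal_mul (by positivity), ← mul_assoc,
        ENNReal.ofReal_mul (mul_nonneg hn'.le (hq n _))]
      exact mul_le_mul' (hDn y hy hyb) (ENNReal.ofReal_le_ofReal (hMn _ hle))
    · simp
  · refine ne_top_of_le_ne_top (ENNReal.mul_ne_top hDint (ENNReal.ofReal_ne_top (r := M))) ?_
    refine (setLIntegral_le_lintegral _ _).trans ?_
    rw [lintegral_indicator measurableSet_Ioc, lintegral_mul_const' _ _ ENNReal.ofReal_ne_top]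
  · have hne : ∀ᵐ y : ℝ, y ≠ a ∧ y ≠ b := by
      filter_upwards [compl_mem_ae_iff.2 (measure_singleton a),
        compl_mem_ae_iff.2 (measure_singleton b)] with y h1 h2 using ⟨h1, h2⟩
    rw [ae_restrict_iff' measurableSet_Ioi]
    filter_upwards [hqκ, hne] with y hy1 ⟨hya, hyb⟩ hy
    have hy0 : (0 : ℝ) < y := hy
    rcases lt_or_gt_of_ne hya with h | h
    · rw [Set.indicator_of_notMem fun h' ↦ lt_asymm h h'.1]
      refine tendsto_const_nhds.congr' ?_
      filter_upwards [eventually_add_one_lt_mul h] with n hn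
      rw [if_neg, mul_zero]
      exact fun hm ↦ absurd (Finset.mem_Ioc.1 hm).1 (not_lt.2 (ceil_le_floor_of_add_one_lt hn))
    rcases lt_or_gt_of_ne hyb with h' | h'
    · rw [Set.indicator_of_mem (show y ∈ Set.Ioo a b from ⟨h, h'⟩)]
      refine ((ENNReal.Tendsto.mul (hy1 hy0) (.inr (hW y hy0 h')) (hVW y hy0 h')
        (.inr (hκ y)))).congr' ?_
      filter_upwards [eventually_add_one_lt_mul h', eventually_gt_atTop 0] with n hn hn0
      have hn' : (0 : ℝ) < n := by exact_mod_cast hn0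
      rw [if_pos, ← ENNReal.ofReal_natCast, ← ENNReal.ofReal_mul (mul_nonneg hn'.le (hq n _)),
        ← ENNReal.ofReal_mul hn'.le, mul_assoc]
      exact Finset.mem_Ioc.2 ⟨floor_lt_ceil_of_lt (by gcongr) (by positivity),
        ceil_le_floor_of_add_one_lt hn⟩
    · rw [Set.indicator_of_notMem fun h'' ↦ lt_asymm h' h''.2]
      refine tendsto_const_nhds.congr' ?_
      filter_upwards [eventually_gt_atTop 0] with n hn0
      have hn' : (0 : ℝ) < n := by exact_mod_cast hn0
      rw [if_neg, mul_zero]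
      exact fun hm ↦ absurd (Finset.mem_Ioc.1 hm).2
        (not_le.2 (floor_lt_ceil_of_lt (by gcongr) (by positivity)))

/-- The blocks `(lo j, hi j]` lie in `[0, t]`. -/
structure IsBlocks {ι : Type*} (lo hi : ι → ℝ) (t : ℝ) : Prop where
  nonneg : ∀ j, 0 ≤ lo j
  lt : ∀ j, lo j < hi j
  le : ∀ j, hi j ≤ t

lemma siteBlock_subset {n : ℕ} {a b t : ℝ} (h : b ≤ t) :
    siteBlock n a b ⊆ Finset.Icc 1 ⌊n * t⌋₊ := by
  intro y hy
  rw [siteBlock, Finset.mem_Ioc] at hy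
  refine Finset.mem_Icc.2 ⟨by omega, hy.2.trans (Nat.floor_le_floor ?_)⟩
  gcongr

lemma siteChain_le_exp {ι : Type*} {α lam θ : ℝ} (hα : 0 < α) (hα1 : α ≤ 1) (hθ0 : 0 ≤ θ)
    (hθ : 0 < lam + θ) {lo hi : ι → ℝ} {t : ℝ} (ht : 0 ≤ t) (hI : IsBlocks lo hi t) (l : List ι)
    {n : ℕ} (hn : 0 < n) {x : ℕ} (hx : x ≤ ⌊n * t⌋₊) :
    siteChain (siteKernel α lam n) (fun j ↦ siteBlock n (lo j) (hi j)) l x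
      ≤ Real.exp (θ * t) * ((lam + θ) ^ (-α)) ^ l.length := by
  have hn' : (0 : ℝ) < n := by exact_mod_cast hn
  refine (siteChain_le hα hα1 hθ0 hθ hn _ (fun j ↦ siteBlock_subset (hI.le j)) l hx).trans ?_
  gcongr
  rw [div_le_iff₀ hn', mul_comm t]
  have := Nat.floor_le (show 0 ≤ n * t by positivity)
  have : (0 : ℝ) ≤ x := Nat.cast_nonneg x
  linarith

/-- The normalized renewal probability from the site of `x` to the site of `y`. -/
def linkProb (α lam x : ℝ) (n y : ℕ) : ℝ :=
  if ⌈n * x⌉₊ < y then siteKernel α lam n (y - ⌈n * x⌉₊) else 0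

lemma tendsto_linkProb {α lam x y : ℝ} (hx : 0 ≤ x) (hy : 0 < y) (hxy : y ≠ x) :
    Tendsto (fun n : ℕ ↦ ENNReal.ofReal (n * linkProb α lam x n ⌈n * y⌉₊)) atTop
      (𝓝 (gammaKernel α lam (y - x))) := by
  rcases lt_or_gt_of_ne hxy with h | h
  · rw [gammaKernel, if_neg (by linarith)]
    refine tendsto_const_nhds.congr fun n ↦ ?_
    rw [linkProb, if_neg, mul_zero, ENNReal.ofReal_zero]
    exact not_lt.2 (Nat.ceil_le_ceil (by gcongr))
  · have hd : 0 < y - x := sub_pos.2 h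
    rw [gammaKernel, if_pos hd]
    refine (ENNReal.continuous_ofReal.tendsto _).comp ?_
    have hc : ∀ u : ℝ, 0 ≤ u → Tendsto (fun n : ℕ ↦ (⌈n * u⌉₊ : ℝ) / n) atTop (𝓝 u) := by
      intro u hu
      have := (tendsto_nat_ceil_mul_div_atTop hu).comp tendsto_natCast_atTop_atTop
      simpa [Function.comp_def, mul_comm] using this
    have hdiv : Tendsto (fun n : ℕ ↦ ((⌈n * y⌉₊ - ⌈n * x⌉₊ : ℕ) : ℝ) / n) atTop (𝓝 (y - x)) := by
      refine ((hc y hy.le).sub (hc x hx)).congr fun n ↦ ?_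
      rw [Nat.cast_sub (Nat.ceil_le_ceil (by gcongr)), sub_div]
    have hcont : ContinuousAt (fun d : ℝ ↦ d ^ (α - 1) / Real.Gamma α * Real.exp (-lam * d))
        (y - x) := by
      refine ContinuousAt.mul (ContinuousAt.div_const ?_ _) (by fun_prop)
      exact Real.continuousAt_rpow_const _ _ (.inl hd.ne')
    refine (hcont.tendsto.comp hdiv).congr' ?_
    filter_upwards [eventually_add_one_lt_mul h, eventually_gt_atTop 0] with n hn hn0
    have : ⌈n * x⌉₊ < ⌈n * y⌉₊ := by
      refine Nat.lt_ceil.2 (lt_of_lt_of_le ?_ hn.le)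
      exact Nat.ceil_lt_add_one (by positivity)
    rw [linkProb, if_pos this, mul_siteKernel α lam hn0]
    rfl

/-- An integrable majorant, uniform in `n`. The rate one of the reference kernel makes it integrable
whatever the sign of `lam`; `exp b` undoes that tilt, and `exp (|lam| * (b + 1))` bounds the true
one. -/
lemma linkProb_le {α lam x y b : ℝ} (hα : 0 < α) (hα1 : α ≤ 1) (hx : 0 ≤ x) (hy : 0 < y)
    (hyb : y ≤ b) {n : ℕ} (hn : 0 < n) :
    ENNReal.ofReal (n * linkProb α lam x n ⌈n * y⌉₊)
      ≤ ENNReal.ofReal (2 ^ (1 - α) * Real.exp (|lam| * (b + 1)) * Real.exp b)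
        * gammaKernel α 1 (y - x) := by
  have hn' : (0 : ℝ) < n := by exact_mod_cast hn
  have hΓ := Real.Gamma_pos_of_pos hα
  rw [linkProb]
  split_ifs with hlt
  · have hxy : x < y := by
      by_contra! h
      exact absurd hlt (not_lt.2 (Nat.ceil_le_ceil (by gcongr)))
    have hd0 : 0 < y - x := sub_pos.2 hxy
    rw [gammaKernel, if_pos hd0, ← ENNReal.ofReal_mul (by positivity), mul_siteKernel α lam hn]
    refine ENNReal.ofReal_le_ofReal ?_
    set d : ℝ := ((⌈n * y⌉₊ - ⌈n * x⌉₊ : ℕ) : ℝ) / n with hd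
    have hcast : ((⌈n * y⌉₊ - ⌈n * x⌉₊ : ℕ) : ℝ) = (⌈n * y⌉₊ : ℝ) - ⌈n * x⌉₊ := Nat.cast_sub hlt.le
    have hone : (⌈n * x⌉₊ : ℝ) + 1 ≤ ⌈n * y⌉₊ := by exact_mod_cast hlt
    have hcy : (⌈n * y⌉₊ : ℝ) < n * y + 1 := Nat.ceil_lt_add_one (by positivity)
    have hcx : (⌈n * x⌉₊ : ℝ) < n * x + 1 := Nat.ceil_lt_add_one (by positivity)
    have hcy' : n * y ≤ (⌈n * y⌉₊ : ℝ) := Nat.le_ceil _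
    -- The rounded gap is at least `1 / n` and at least `(y - x) - 1 / n`; the average of these
    -- bounds is `(y - x) / 2`. This is the origin of `2 ^ (1 - α)`.
    have h1 : (y - x) / 2 ≤ d := by
      rw [hd, hcast, le_div_iff₀ hn']
      nlinarith
    have hn1 : (1 : ℝ) ≤ n := by exact_mod_cast hn
    have h2 : d ≤ b + 1 := by
      rw [hd, hcast, div_le_iff₀ hn']
      have : (0 : ℝ) ≤ ⌈n * x⌉₊ := Nat.cast_nonneg _
      nlinarith
    have hdpos : 0 < d := lt_of_lt_of_le (by positivity) h1
    have h3 : d ^ (α - 1) ≤ 2 ^ (1 - α) * (y - x) ^ (α - 1) := by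
      refine (Real.rpow_le_rpow_of_nonpos (by positivity) h1 (by linarith)).trans_eq ?_
      rw [Real.div_rpow hd0.le (by norm_num), div_eq_mul_inv, ← Real.rpow_neg (by norm_num),
        neg_sub, mul_comm]
    have h4 : Real.exp (-lam * d) ≤ Real.exp (|lam| * (b + 1)) := by
      refine Real.exp_le_exp.2 ?_
      have : -lam * d ≤ |lam| * d := by
        gcongr
        exact neg_le_abs lam
      exact this.trans (by gcongr)
    have h5 : 1 ≤ Real.exp b * Real.exp (-1 * (y - x)) := by
      rw [← Real.exp_add]
      exact Real.one_le_exp (by linarith)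
    calc d ^ (α - 1) / Real.Gamma α * Real.exp (-lam * d)
        ≤ (2 ^ (1 - α) * (y - x) ^ (α - 1)) / Real.Gamma α * Real.exp (|lam| * (b + 1)) * 1 := by
          rw [mul_one]; gcongr
      _ ≤ (2 ^ (1 - α) * (y - x) ^ (α - 1)) / Real.Gamma α * Real.exp (|lam| * (b + 1))
          * (Real.exp b * Real.exp (-1 * (y - x))) := by gcongr
      _ = _ := by ring
  · simp

lemma lintegral_gammaKernel_sub_ne_top {α : ℝ} (hα : 0 < α) (x : ℝ) (C : ℝ) (s : Set ℝ) :
    ∫⁻ y in s, ENNReal.ofReal C * gammaKernel α 1 (y - x) ≠ ∞ := by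
  refine ne_top_of_le_ne_top ?_ (setLIntegral_le_lintegral _ _)
  rw [lintegral_const_mul' _ _ ENNReal.ofReal_ne_top,
    lintegral_sub_right_eq_self (gammaKernel α 1) x, lintegral_gammaKernel hα one_pos]
  exact ENNReal.mul_ne_top ENNReal.ofReal_ne_top ENNReal.ofReal_ne_top

lemma siteChain_cons_eq {ι : Type*} (α lam x : ℝ) (n : ℕ) (J : ι → Finset ℕ) (j : ι) (l : List ι) :
    siteChain (siteKernel α lam n) J (j :: l) ⌈n * x⌉₊
      = ∑ y ∈ J j, linkProb α lam x n y * siteChain (siteKernel α lam n) J l y := by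
  rw [siteChain, Finset.sum_filter]
  exact Finset.sum_congr rfl fun y _ ↦ by rw [linkProb, ite_mul, zero_mul]

/-- The conditions on the probabilities of the first site under which the weighted sums
converge. -/
structure StartLimit (q : ℕ → ℕ → ℝ) (κ : ℝ → ℝ≥0∞) (t : ℝ) : Prop where
  nonneg : ∀ n y, 0 ≤ q n y
  ne_top : ∀ y, κ y ≠ ∞
  tendsto : ∀ᵐ y : ℝ, 0 < y →
    Tendsto (fun n : ℕ ↦ ENNReal.ofReal (n * q n ⌈n * y⌉₊)) atTop (𝓝 (κ y))
  dominated : ∃ D : ℝ → ℝ≥0∞, ∫⁻ y in Set.Ioc 0 t, D y ≠ ∞ ∧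
    ∀ n : ℕ, 0 < n → ∀ y, 0 < y → y ≤ t → ENNReal.ofReal (n * q n ⌈n * y⌉₊) ≤ D y

lemma startLimit_linkProb {α lam x : ℝ} (hα : 0 < α) (hα1 : α ≤ 1) (hx : 0 ≤ x) (t : ℝ) :
    StartLimit (linkProb α lam x) (fun y ↦ gammaKernel α lam (y - x)) t where
  nonneg n y := by
    rw [linkProb]; split_ifs
    exacts [siteKernel_nonneg hα _ _ _, le_rfl]
  ne_top y := gammaKernel_ne_top _ _ _
  tendsto := by
    filter_upwards [compl_mem_ae_iff.2 (measure_singleton x)] with y hy hy0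
    exact tendsto_linkProb hx hy0 hy
  dominated := ⟨fun y ↦ ENNReal.ofReal (2 ^ (1 - α) * Real.exp (|lam| * (t + 1)) * Real.exp t)
        * gammaKernel α 1 (y - x), lintegral_gammaKernel_sub_ne_top hα x _ _,
    fun _ hn _ hy hyt ↦ linkProb_le hα hα1 hx hy hyt hn⟩

/-- The nonstationary start is a link from the origin: for `x = 0` the two weights agree at every
positive site. -/
lemma startLimit_siteKernel {α lam : ℝ} (hα : 0 < α) (hα1 : α ≤ 1) (t : ℝ) :
    StartLimit (siteKernel α lam) (gammaKernel α lam) t := by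
  have h := startLimit_linkProb (lam := lam) hα hα1 le_rfl t
  have heq : ∀ (n : ℕ) (y : ℝ), 0 < y →
      n * linkProb α lam 0 n ⌈n * y⌉₊ = n * siteKernel α lam n ⌈n * y⌉₊ := by
    intro n y hy
    rcases Nat.eq_zero_or_pos n with rfl | hn
    · simp
    · have : 0 < ⌈n * y⌉₊ := Nat.ceil_pos.2 (by positivity)
      simp [linkProb, this]
  refine ⟨siteKernel_nonneg hα lam, gammaKernel_ne_top _ _, ?_, ?_⟩
  · filter_upwards [h.tendsto] with y hy hy0
    simpa only [heq _ _ hy0, sub_zero] using hy hy0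
  · obtain ⟨D, hD, hle⟩ := h.dominated
    exact ⟨D, hD, fun n hn y hy hyt ↦ heq n y hy ▸ hle n hn y hy hyt⟩

/-- Adds one site at the front of a chain whose limit is known. It serves both for the first site
and, with `q = linkProb α lam x`, for a link from a fixed `x`. -/
lemma StartLimit.tendsto_sum {ι : Type*} {α lam : ℝ} (hα : 0 < α) (hα1 : α ≤ 1) {lo hi : ι → ℝ}
    {t : ℝ} (ht : 0 ≤ t) (hI : IsBlocks lo hi t) {q : ℕ → ℕ → ℝ} {κ W : ℝ → ℝ≥0∞}
    (hq : StartLimit q κ t) (j : ι) (l : List ι)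
    (hW : ∀ x, 0 < x → x < t → Tendsto (fun n : ℕ ↦ ENNReal.ofReal (siteChain (siteKernel α lam n)
        (fun j ↦ siteBlock n (lo j) (hi j)) l ⌈n * x⌉₊)) atTop (𝓝 (W x))) :
    Tendsto (fun n : ℕ ↦ ENNReal.ofReal (∑ y ∈ siteBlock n (lo j) (hi j),
        q n y * siteChain (siteKernel α lam n) (fun j ↦ siteBlock n (lo j) (hi j)) l y)) atTop
      (𝓝 (∫⁻ y in Set.Ioo (lo j) (hi j), κ y * W y)) := by
  -- Only boundedness in `n` matters here, so any `θ ≥ 0` with `lam + θ > 0` would do.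
  have hθ : 0 < lam + (|lam| + 1) := by linarith [neg_abs_le lam]
  set M := Real.exp ((|lam| + 1) * t) * ((lam + (|lam| + 1)) ^ (-α)) ^ l.length
  have hbd : ∀ᶠ n : ℕ in atTop, ∀ y ≤ ⌊n * t⌋₊, siteChain (siteKernel α lam n)
      (fun j ↦ siteBlock n (lo j) (hi j)) l y ≤ M := by
    filter_upwards [eventually_gt_atTop 0] with n hn y hy
    exact siteChain_le_exp hα hα1 (by positivity) hθ ht hI l hn hy
  obtain ⟨D, hD, hle⟩ := hq.dominated
  refine tendsto_sum_siteBlock (hI.nonneg j) (hI.lt j) hq.nonneg hq.ne_top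
    (fun y hy hyb ↦ ?_) hq.tendsto (fun y hy hyb ↦ hW y hy (hyb.trans_le (hI.le j)))
    (D := D) (M := M) ?_ ?_ ?_ fun n ↦ siteChain_nonneg (siteKernel_nonneg hα lam n) _ l
  · have hyt := hyb.trans_le (hI.le j)
    refine ne_top_of_le_ne_top (ENNReal.ofReal_ne_top (r := M)) (le_of_tendsto (hW y hy hyt) ?_)
    filter_upwards [hbd, eventually_add_one_lt_mul hyt] with n hn hn'
    exact ENNReal.ofReal_le_ofReal (hn _ (ceil_le_floor_of_add_one_lt hn'))
  · filter_upwards [eventually_gt_atTop 0] with n hn y hy hyb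
    exact hle n hn y hy (hyb.trans (hI.le j))
  · exact ne_top_of_le_ne_top hD (lintegral_mono_set (Set.Ioc_subset_Ioc_right (hI.le j)))
  · filter_upwards [hbd] with n hn y hy
    exact hn y (hy.trans (Nat.floor_le_floor (by gcongr; exact hI.le j)))

lemma tendsto_siteChain {ι : Type*} {α lam : ℝ} (hα : 0 < α) (hα1 : α ≤ 1) {lo hi : ι → ℝ} {t : ℝ}
    (hI : IsBlocks lo hi t) (l : List ι) {x : ℝ} (hx : 0 ≤ x) (hxt : x < t) :
    Tendsto (fun n : ℕ ↦ ENNReal.ofReal (siteChain (siteKernel α lam n)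
        (fun j ↦ siteBlock n (lo j) (hi j)) l ⌈n * x⌉₊)) atTop
      (𝓝 (chain (gammaKernel α lam) (fun j ↦ Set.Ioo (lo j) (hi j)) l x)) := by
  induction l generalizing x with
  | nil => simp [siteChain, chain]
  | cons j l ih =>
    simp only [siteChain_cons_eq, chain]
    exact (startLimit_linkProb hα hα1 hx t).tendsto_sum hα hα1 (hx.trans hxt.le) hI j l
      fun y hy hyt ↦ ih hy.le hyt

/-- The limit of the sums over the chains of sites. -/
lemma tendsto_siteChainStart {ι : Type*} {α lam : ℝ} (hα : 0 < α) (hα1 : α ≤ 1) {lo hi : ι → ℝ}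
    {t : ℝ} (ht : 0 ≤ t) (hI : IsBlocks lo hi t) {q : ℕ → ℕ → ℝ} {κ : ℝ → ℝ≥0∞}
    (hq : StartLimit q κ t) (l : List ι) :
    Tendsto (fun n : ℕ ↦ ENNReal.ofReal (siteChainStart (q n) (siteKernel α lam n)
        (fun j ↦ siteBlock n (lo j) (hi j)) l)) atTop
      (𝓝 (chainStart κ (gammaKernel α lam) (fun j ↦ Set.Ioo (lo j) (hi j)) l)) := by
  cases l with
  | nil => simp [siteChainStart, chainStart]
  | cons j l =>
    exact hq.tendsto_sum hα hα1 ht hI j l fun x hx hxt ↦ tendsto_siteChain hα hα1 hI l hx.le hxt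

lemma StartLimit.exists_sum_le {q : ℕ → ℕ → ℝ} {κ : ℝ → ℝ≥0∞} {t : ℝ} (ht : 0 ≤ t)
    (hq : StartLimit q κ t) :
    ∃ K : ℝ, 0 ≤ K ∧ ∀ n : ℕ, 0 < n → ∑ y ∈ Finset.Icc 1 ⌊n * t⌋₊, q n y ≤ K := by
  obtain ⟨D, hD, hle⟩ := hq.dominated
  refine ⟨(∫⁻ y in Set.Ioc 0 t, D y).toReal, ENNReal.toReal_nonneg, fun n hn ↦ ?_⟩
  have hn' : (0 : ℝ) < n := by exact_mod_cast hn
  rw [← ENNReal.ofReal_le_iff_le_toReal hD, ENNReal.ofReal_sum_of_nonneg fun y _ ↦ hq.nonneg n y,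
    sum_eq_lintegral_ceil hn _ fun i hi ↦ (Finset.mem_Icc.1 hi).1,
    ← lintegral_indicator measurableSet_Ioc]
  refine (setLIntegral_mono' measurableSet_Ioi fun y hy ↦ ?_).trans (setLIntegral_le_lintegral _ _)
  split_ifs with hm
  · have hyt : y ≤ t := by
      have h1 : (n : ℝ) * y ≤ n * t := (Nat.le_ceil _).trans
        ((Nat.cast_le.2 (Finset.mem_Icc.1 hm).2).trans (Nat.floor_le (by positivity)))
      exact le_of_mul_le_mul_left h1 hn'
    rw [Set.indicator_of_mem (show y ∈ Set.Ioc 0 t from ⟨hy, hyt⟩), ← ENNReal.ofReal_natCast,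
      ← ENNReal.ofReal_mul (by positivity)]
    exact hle n hn y hy hyt
  · simp

/-- The ratio `r` is arbitrary, at the price of the constant: chains decay faster than any geometric
sequence, uniformly in `n`. -/
lemma siteChainStart_le {ι : Type*} {α lam : ℝ} (hα : 0 < α) (hα1 : α ≤ 1) {lo hi : ι → ℝ}
    {t : ℝ} (ht : 0 ≤ t) (hI : IsBlocks lo hi t) {q : ℕ → ℕ → ℝ} {κ : ℝ → ℝ≥0∞}
    (hq : StartLimit q κ t) {r : ℝ} (hr : 0 < r) : ∃ C, 0 ≤ C ∧ ∀ n : ℕ, 0 < n → ∀ l : List ι,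
      siteChainStart (q n) (siteKernel α lam n) (fun j ↦ siteBlock n (lo j) (hi j)) l
        ≤ C * r ^ l.length := by
  obtain ⟨K, hK0, hK⟩ := hq.exists_sum_le ht
  -- Chosen so that `(lam + θ) ^ (-α) ≤ r`.
  set θ := |lam| + r ^ (-1 / α) with hθ
  have hr' : 0 < r ^ (-1 / α) := by positivity
  have hθ1 : r ^ (-1 / α) ≤ lam + θ := by linarith [neg_abs_le lam]
  have hρ : (lam + θ) ^ (-α) ≤ r := by
    refine (Real.rpow_le_rpow_of_nonpos hr' hθ1 (by linarith)).trans_eq ?_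
    rw [← Real.rpow_mul hr.le, div_mul_eq_mul_div, neg_one_mul, neg_neg, div_self hα.ne',
      Real.rpow_one]
  have hθ2 : 0 < lam + θ := hr'.trans_le hθ1
  have hρ0 : 0 ≤ (lam + θ) ^ (-α) := by positivity
  set M := Real.exp (θ * t)
  have hM : 0 < M := Real.exp_pos _
  -- The summand `1` covers the empty list. The division by `r` compensates for the first site,
  -- which is bounded by `K` instead of `r`.
  refine ⟨1 + K * M / r, by positivity, fun n hn l ↦ ?_⟩
  cases l with
  | nil =>
    simp only [siteChainStart, List.length_nil, pow_zero, mul_one]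
    have : 0 ≤ K * M / r := by positivity
    linarith
  | cons j l =>
    calc siteChainStart (q n) (siteKernel α lam n) (fun j ↦ siteBlock n (lo j) (hi j)) (j :: l)
        ≤ ∑ y ∈ siteBlock n (lo j) (hi j), q n y * (M * r ^ l.length) := by
          refine Finset.sum_le_sum fun y hy ↦ mul_le_mul_of_nonneg_left ?_ (hq.nonneg n y)
          refine (siteChain_le_exp hα hα1 (by positivity) hθ2 ht hI l hn
            (Finset.mem_Icc.1 (siteBlock_subset (hI.le j) hy)).2).trans ?_
          gcongr
      _ = (∑ y ∈ siteBlock n (lo j) (hi j), q n y) * (M * r ^ l.length) := by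
          rw [Finset.sum_mul]
      _ ≤ K * (M * r ^ l.length) := by
          refine mul_le_mul_of_nonneg_right (le_trans ?_ (hK n hn)) (by positivity)
          exact Finset.sum_le_sum_of_subset_of_nonneg (siteBlock_subset (hI.le j))
            fun y _ _ ↦ hq.nonneg n y
      _ = K * M / r * r ^ (j :: l).length := by
          rw [List.length_cons, pow_succ]; field_simp
      _ ≤ _ := by gcongr; linarith

/-! ### The limit of the generating functions -/

lemma summable_pow_length {m : ℕ} {x : ℝ} (hx : 0 ≤ x) (hmx : m * x < 1) :
    Summable fun l : List (Fin m) ↦ x ^ l.length := by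
  rw [← List.equivSigmaTuple.symm.summable_iff]
  have h : ∀ p : Σ n, Fin n → Fin m,
      ((fun l : List (Fin m) ↦ x ^ l.length) ∘ List.equivSigmaTuple.symm) p = x ^ p.1 := by
    rintro ⟨n, f⟩
    simp [List.equivSigmaTuple]
  rw [summable_congr h, summable_sigma_of_nonneg fun p ↦ by positivity]
  refine ⟨fun n ↦ Summable.of_finite, ?_⟩
  simp only [tsum_fintype, Finset.sum_const, Finset.card_univ, Fintype.card_pi, Fintype.card_fin,
    Finset.prod_const, nsmul_eq_mul]
  push_cast
  simp only [← mul_pow]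
  exact summable_geometric_of_lt_one (by positivity) hmx

/-- The derivative at zero of `h ↦ exp (h σ)`, taken along `h = 1 / s n`. -/
lemma tendsto_mul_exp_sub_one (σ : ℂ) {s : ℕ → ℝ} (hs : Tendsto s atTop atTop) :
    Tendsto (fun n ↦ (s n : ℂ) * (Complex.exp (σ / s n) - 1)) atTop (𝓝 σ) := by
  have h1 : HasDerivAt (fun h : ℝ ↦ Complex.exp (h * σ)) σ 0 := by
    have := ((Complex.hasDerivAt_exp ((0 : ℝ) * σ)).comp (0 : ℝ)
      ((Complex.ofRealCLM.hasDerivAt (x := (0 : ℝ))).mul_const σ))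
    simpa [Function.comp_def] using this
  rw [hasDerivAt_iff_tendsto_slope_zero] at h1
  have h2 : Tendsto (fun n ↦ (s n)⁻¹) atTop (𝓝[≠] 0) :=
    tendsto_nhdsWithin_iff.2 ⟨tendsto_inv_atTop_zero.comp hs, by
      filter_upwards [hs.eventually_gt_atTop 0] with n hn using (inv_pos.2 hn).ne'⟩
  refine (h1.comp h2).congr fun n ↦ ?_
  simp [div_eq_inv_mul, Complex.real_smul]

lemma norm_list_prod_le_pow {ι : Type*} {a : ι → ℂ} {B : ℝ} (ha : ∀ j, ‖a j‖ ≤ B) (l : List ι) :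
    ‖(l.map a).prod‖ ≤ B ^ l.length := by
  induction l with
  | nil => simp
  | cons j l ih =>
    rw [List.map_cons, List.prod_cons, norm_mul, List.length_cons, pow_succ']
    exact mul_le_mul (ha j) ih (norm_nonneg _) ((norm_nonneg _).trans (ha j))

/-- The weight of the walks: the probabilities are `s n` times the normalized ones. -/
structure RenewalLimit (α lam : ℝ) (q : ℕ → ℕ → ℝ) (κ : ℝ → ℝ≥0∞) (t : ℝ) (s : ℕ → ℝ)
    (Q : ℕ → ProbabilityMeasure (ℕ → Bool)) : Prop where
  start : StartLimit q κ t
  scale : Tendsto s atTop atTop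
  isRenewal : ∀ᶠ n : ℕ in atTop, IsRenewal (fun y ↦ s n * q n y)
    (fun d ↦ s n * siteKernel α lam n d) (Finset.Icc 1 ⌊n * t⌋₊) (Q n : Measure (ℕ → Bool))

lemma tendsto_integral_exp_sum {α lam : ℝ} (hα : 0 < α) (hα1 : α ≤ 1) {m : ℕ}
    {lo hi : Fin m → ℝ} {t : ℝ} (ht : 0 ≤ t) (hI : IsBlocks lo hi t)
    (hd : ∀ n, Pairwise fun i j ↦ Disjoint (siteBlock n (lo i) (hi i)) (siteBlock n (lo j) (hi j)))
    {q : ℕ → ℕ → ℝ} {κ : ℝ → ℝ≥0∞} {s : ℕ → ℝ} {Q : ℕ → ProbabilityMeasure (ℕ → Bool)}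
    (h : RenewalLimit α lam q κ t s Q) (σ : Fin m → ℂ) :
    (∀ l, chainStart κ (gammaKernel α lam) (fun j ↦ Set.Ioo (lo j) (hi j)) l ≠ ∞) ∧
    Summable (fun l : List (Fin m) ↦ (l.map σ).prod *
      ((chainStart κ (gammaKernel α lam) (fun j ↦ Set.Ioo (lo j) (hi j)) l).toReal : ℂ)) ∧
    Tendsto (fun n : ℕ ↦ ∫ ω, Complex.exp (∑ j, σ j / s n *
        ∑ y ∈ siteBlock n (lo j) (hi j), if ω y = true then 1 else 0)
        ∂(Q n : Measure (ℕ → Bool))) atTop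
      (𝓝 (∑' l : List (Fin m), (l.map σ).prod *
        ((chainStart κ (gammaKernel α lam) (fun j ↦ Set.Ioo (lo j) (hi j)) l).toReal : ℂ))) := by
  -- The factor two and the summand one leave strict room, so that `B` also bounds `s n * (exp (σ j
  -- / s n) - 1)` for large `n`.
  set B : ℝ := 1 + ∑ j, 2 * ‖σ j‖ with hB
  have hB1 : 1 ≤ B := by
    have : 0 ≤ ∑ j, 2 * ‖σ j‖ := Finset.sum_nonneg fun j _ ↦ by positivity
    linarith
  have hBσ : ∀ j, 2 * ‖σ j‖ ≤ B := fun j ↦ by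
    have := Finset.single_le_sum (f := fun j ↦ 2 * ‖σ j‖) (fun j _ ↦ by positivity)
      (Finset.mem_univ j)
    linarith
  -- Now `B * r = 1 / (m + 1)`, and there are only `m ^ k` lists of length `k`, so the dominating
  -- series converges.
  set r : ℝ := 1 / ((m + 1) * B) with hr
  have hr0 : 0 < r := by positivity
  obtain ⟨C, hC0, hC⟩ := siteChainStart_le hα hα1 ht hI h.start hr0
  set U : ℕ → List (Fin m) → ℝ := fun n l ↦ siteChainStart (q n) (siteKernel α lam n)
    (fun j ↦ siteBlock n (lo j) (hi j)) l with hU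
  set u : List (Fin m) → ℝ≥0∞ :=
    chainStart κ (gammaKernel α lam) (fun j ↦ Set.Ioo (lo j) (hi j)) with hu
  have hU0 : ∀ n l, 0 ≤ U n l := fun n l ↦
    siteChainStart_nonneg (h.start.nonneg n) (siteKernel_nonneg hα lam n) _ l
  have hlim := fun l ↦ tendsto_siteChainStart (lam := lam) hα hα1 ht hI h.start l
  have hule : ∀ l, u l ≤ ENNReal.ofReal (C * r ^ l.length) := fun l ↦ le_of_tendsto (hlim l) <| by
    filter_upwards [eventually_gt_atTop 0] with n hn using ENNReal.ofReal_le_ofReal (hC n hn l)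
  have hutop : ∀ l, u l ≠ ∞ := fun l ↦ ne_top_of_le_ne_top ENNReal.ofReal_ne_top (hule l)
  have hureal : ∀ l, (u l).toReal ≤ C * r ^ l.length := fun l ↦
    ENNReal.toReal_le_of_le_ofReal (by positivity) (hule l)
  have hlim' : ∀ l, Tendsto (fun n ↦ U n l) atTop (𝓝 (u l).toReal) := fun l ↦ by
    refine ((ENNReal.tendsto_toReal (hutop l)).comp (hlim l)).congr fun n ↦ ?_
    exact ENNReal.toReal_ofReal (hU0 n l)
  have hsum : Summable fun l : List (Fin m) ↦ C * (B * r) ^ l.length := by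
    refine (summable_pow_length (by positivity) ?_).mul_left C
    have : B * r = 1 / (m + 1) := by rw [hr]; field_simp
    rw [this, mul_one_div, div_lt_one (by positivity)]
    linarith
  have hbd : ∀ (a : Fin m → ℂ) (v : ℝ) (l : List (Fin m)), (∀ j, ‖a j‖ ≤ B) → 0 ≤ v →
      v ≤ C * r ^ l.length → ‖(l.map a).prod * (v : ℂ)‖ ≤ C * (B * r) ^ l.length := by
    intro a v l ha hv0 hv
    rw [norm_mul, Complex.norm_real, Real.norm_of_nonneg hv0, mul_pow, mul_left_comm]
    exact mul_le_mul (norm_list_prod_le_pow ha l) hv hv0 (by positivity)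
  refine ⟨hutop, hsum.of_norm_bounded fun l ↦ hbd σ _ l (fun j ↦ ?_) ENNReal.toReal_nonneg
    (hureal l), ?_⟩
  · linarith [hBσ j, norm_nonneg (σ j)]
  set a : ℕ → Fin m → ℂ := fun n j ↦ s n * (Complex.exp (σ j / s n) - 1) with ha
  have halim : ∀ j, Tendsto (fun n ↦ a n j) atTop (𝓝 (σ j)) := fun j ↦
    tendsto_mul_exp_sub_one (σ j) h.scale
  have hab : ∀ᶠ n in atTop, ∀ j, ‖a n j‖ ≤ B := by
    rw [eventually_all]
    intro j
    have : ‖σ j‖ < B := by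
      rcases (norm_nonneg (σ j)).eq_or_lt with h0 | h0
      · rw [← h0]; linarith
      · linarith [hBσ j]
    filter_upwards [(halim j).norm.eventually_lt_const this] with n hn using hn.le
  have hT : Tendsto (fun n ↦ ∑' l : List (Fin m), (l.map (a n)).prod * (U n l : ℂ)) atTop
      (𝓝 (∑' l : List (Fin m), (l.map σ).prod * ((u l).toReal : ℂ))) := by
    refine tendsto_tsum_of_dominated_convergence hsum (fun l ↦ ?_) ?_
    · refine Tendsto.mul ?_ ((Complex.continuous_ofReal.tendsto _).comp (hlim' l))
      exact tendsto_list_prod l fun j _ ↦ halim j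
    · filter_upwards [hab, eventually_gt_atTop 0] with n hn hn0 l
      exact hbd _ _ l hn (hU0 n l) (hC n hn0 l)
  refine hT.congr' ?_
  filter_upwards [h.isRenewal] with n hn
  rw [← (hn.hasSum_integral_exp (fun j ↦ σ j / s n) _ (fun j ↦ siteBlock_subset (hI.le j))
    (hd n)).tsum_eq]
  refine tsum_congr fun l ↦ ?_
  rw [siteChainStart_smul]
  -- The power of `s n` carried by the probabilities is absorbed into the weights `a n`.
  have : (l.map (a n)).prod = (s n : ℂ) ^ l.length
      * (l.map fun j ↦ Complex.exp (σ j / s n) - 1).prod := by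
    rw [ha, List.prod_map_mul, List.map_const', List.prod_replicate]
  rw [this]
  push_cast
  ring

/-! ### Semigroup and scaling properties of the kernels -/

/-- This vanishing is what orders the sites in the continuous chains, where no explicit constraint
is imposed. -/
lemma gammaKernel_of_nonpos (a lam : ℝ) {d : ℝ} (hd : d ≤ 0) : gammaKernel a lam d = 0 :=
  if_neg hd.not_gt

lemma lintegral_eq_mul_lintegral_comp_mul {c : ℝ} (hc : 0 < c) (f : ℝ → ℝ≥0∞) :
    ∫⁻ y, f y = ENNReal.ofReal c * ∫⁻ y, f (c * y) := by
  have h := Real.smul_map_volume_mul_left hc.ne'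
  rw [abs_of_pos hc] at h
  conv_lhs => rw [← h]
  rw [lintegral_smul_measure, (measurableEmbedding_mulLeft₀ hc.ne').lintegral_map, smul_eq_mul]

/-- The convolution of two gamma kernels. -/
lemma lintegral_gammaKernel_mul {a b : ℝ} (ha : 0 < a) (hb : 0 < b) (lam x v : ℝ) :
    ∫⁻ w, gammaKernel a lam (w - x) * gammaKernel b lam (v - w) = gammaKernel (a + b) lam (v - x) := by
  rcases le_or_gt v x with hvx | hxv
  · rw [gammaKernel_of_nonpos _ _ (by linarith)]
    refine (lintegral_congr fun w ↦ ?_).trans lintegral_zero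
    rcases le_or_gt w x with h | h
    · rw [gammaKernel_of_nonpos _ _ (by linarith), zero_mul]
    · rw [gammaKernel_of_nonpos (d := v - w) _ _ (by linarith), mul_zero]
  · set L := v - x with hL
    have hL0 : 0 < L := sub_pos.2 hxv
    have hΓa := Real.Gamma_pos_of_pos ha
    have hΓb := Real.Gamma_pos_of_pos hb
    have hΓab := Real.Gamma_pos_of_pos (add_pos ha hb)
    -- On the scale `L` the two exponentials combine to a constant, and what remains in `u` is a
    -- beta density.
    have h1 : ∀ u : ℝ, gammaKernel a lam (L * u) * gammaKernel b lam (L - L * u)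
        = ENNReal.ofReal (L ^ (a + b - 2) / Real.Gamma (a + b) * Real.exp (-lam * L))
          * betaPDF a b u := by
      intro u
      rcases le_or_gt u 0 with hu | hu
      · rw [betaPDF_eq_zero_of_nonpos hu, gammaKernel_of_nonpos _ _
          (mul_nonpos_of_nonneg_of_nonpos hL0.le hu), zero_mul, mul_zero]
      rcases le_or_gt 1 u with hu1 | hu1
      · rw [betaPDF_eq_zero_of_one_le hu1, gammaKernel_of_nonpos (d := L - L * u) _ _
          (by nlinarith), mul_zero, mul_zero]
      have hLu : L - L * u = L * (1 - u) := by ring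
      have hu1' : 0 < 1 - u := sub_pos.2 hu1
      rw [betaPDF_of_pos_lt_one hu hu1, hLu, gammaKernel, gammaKernel, if_pos (by positivity),
        if_pos (by positivity), ← ENNReal.ofReal_mul (by positivity),
        ← ENNReal.ofReal_mul (by positivity), Real.mul_rpow hL0.le hu.le,
        Real.mul_rpow hL0.le hu1'.le, beta,
        show a + b - 2 = (a - 1) + (b - 1) by ring, Real.rpow_add hL0,
        show -lam * L = -lam * (L * u) + -lam * (L * (1 - u)) by ring, Real.exp_add]
      congr 1
      field_simp
    calc ∫⁻ w, gammaKernel a lam (w - x) * gammaKernel b lam (v - w)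
        = ∫⁻ w, gammaKernel a lam w * gammaKernel b lam (L - w) := by
          rw [← lintegral_sub_right_eq_self
            (fun w ↦ gammaKernel a lam w * gammaKernel b lam (L - w)) x]
          refine lintegral_congr fun w ↦ ?_
          rw [hL, show v - x - (w - x) = v - w by ring]
      _ = ENNReal.ofReal L * ∫⁻ u, gammaKernel a lam (L * u) * gammaKernel b lam (L - L * u) := by
          exact lintegral_eq_mul_lintegral_comp_mul hL0 _
      _ = ENNReal.ofReal L * (ENNReal.ofReal (L ^ (a + b - 2) / Real.Gamma (a + b)
            * Real.exp (-lam * L))) := by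
          simp only [h1]
          rw [lintegral_const_mul' _ _ ENNReal.ofReal_ne_top, lintegral_betaPDF_eq_one ha hb, mul_one]
      _ = _ := by
          rw [gammaKernel, if_pos hL0, ← ENNReal.ofReal_mul hL0.le,
            show a + b - 1 = (a + b - 2) + 1 by ring, Real.rpow_add_one hL0.ne']
          congr 1
          ring

lemma gammaKernel_mul {c : ℝ} (hc : 0 < c) (a lam d : ℝ) :
    gammaKernel a lam (c * d) = ENNReal.ofReal (c ^ (a - 1)) * gammaKernel a (lam * c) d := by
  rcases le_or_gt d 0 with hd | hd
  · rw [gammaKernel_of_nonpos _ _ (mul_nonpos_of_nonneg_of_nonpos hc.le hd),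
      gammaKernel_of_nonpos _ _ hd, mul_zero]
  · rw [gammaKernel, gammaKernel, if_pos (by positivity), if_pos hd,
      ← ENNReal.ofReal_mul (by positivity), Real.mul_rpow hc.le hd.le]
    congr 1
    rw [show -lam * (c * d) = -(lam * c) * d by ring]
    ring

lemma setLIntegral_Ioo_eq_mul {c : ℝ} (hc : 0 < c) (a b : ℝ) (f : ℝ → ℝ≥0∞) :
    ∫⁻ y in Set.Ioo a b, f y
      = ENNReal.ofReal c * ∫⁻ y in Set.Ioo (a / c) (b / c), f (c * y) := by
  rw [← lintegral_indicator measurableSet_Ioo, lintegral_eq_mul_lintegral_comp_mul hc,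
    ← lintegral_indicator measurableSet_Ioo]
  congr 1
  refine lintegral_congr fun y ↦ ?_
  simp only [Set.indicator_apply, Set.mem_Ioo, div_lt_iff₀ hc, lt_div_iff₀ hc, mul_comm y]

/-- Each link gives `c` from the volume element and `c ^ (α - 1)` from the kernel, whose rate
becomes `lam * c`. -/
lemma chain_mul {ι : Type*} {α c : ℝ} (hc : 0 < c) (lam : ℝ) (lo hi : ι → ℝ) (l : List ι) (x : ℝ) :
    chain (gammaKernel α lam) (fun j ↦ Set.Ioo (lo j) (hi j)) l (c * x)
      = ENNReal.ofReal (c ^ (α * l.length))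
        * chain (gammaKernel α (lam * c)) (fun j ↦ Set.Ioo (lo j / c) (hi j / c)) l x := by
  induction l generalizing x with
  | nil => simp [chain]
  | cons j l ih =>
    rw [chain, setLIntegral_Ioo_eq_mul hc, chain]
    simp only [ih, ← mul_sub, gammaKernel_mul hc]
    rw [← lintegral_const_mul' _ _ ENNReal.ofReal_ne_top,
      ← lintegral_const_mul' _ _ ENNReal.ofReal_ne_top]
    refine lintegral_congr fun y ↦ ?_
    have : ENNReal.ofReal (c ^ (α * (j :: l).length)) = ENNReal.ofReal c
        * ENNReal.ofReal (c ^ (α - 1)) * ENNReal.ofReal (c ^ (α * l.length)) := by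
      rw [← ENNReal.ofReal_mul hc.le, ← ENNReal.ofReal_mul (by positivity), Real.rpow_sub_one hc.ne',
        mul_div_cancel₀ _ hc.ne', ← Real.rpow_add hc, List.length_cons]
      congr 2
      push_cast
      ring
    rw [this]
    ring

/-- The first site contributes `c ^ (e + 1)` and each of the other `l.length - 1` sites `c ^ α`.
Below, `e = α - 1` for the nonstationary start and `e = 0` for the start density one. -/
lemma chainStart_mul {ι : Type*} {α c e : ℝ} (hc : 0 < c) (lam : ℝ) (lo hi : ι → ℝ)
    {q q' : ℝ → ℝ≥0∞} (hq : ∀ y, q (c * y) = ENNReal.ofReal (c ^ e) * q' y) {l : List ι}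
    (hl : l ≠ []) :
    chainStart q (gammaKernel α lam) (fun j ↦ Set.Ioo (lo j) (hi j)) l
      = ENNReal.ofReal (c ^ (α * (l.length - 1) + (e + 1)))
        * chainStart q' (gammaKernel α (lam * c)) (fun j ↦ Set.Ioo (lo j / c) (hi j / c)) l := by
  obtain ⟨j, l, rfl⟩ := List.exists_cons_of_ne_nil hl
  rw [chainStart, setLIntegral_Ioo_eq_mul hc, chainStart]
  simp only [hq, chain_mul hc]
  rw [← lintegral_const_mul' _ _ ENNReal.ofReal_ne_top,
    ← lintegral_const_mul' _ _ ENNReal.ofReal_ne_top]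
  refine lintegral_congr fun y ↦ ?_
  have : ENNReal.ofReal (c ^ (α * (((j :: l).length : ℝ) - 1) + (e + 1))) = ENNReal.ofReal c
      * ENNReal.ofReal (c ^ e) * ENNReal.ofReal (c ^ (α * l.length)) := by
    rw [← ENNReal.ofReal_mul hc.le, ← ENNReal.ofReal_mul (by positivity), mul_comm c,
      ← Real.rpow_add_one hc.ne', ← Real.rpow_add hc, List.length_cons]
    congr 2
    push_cast
    ring
  rw [this]
  ring

/-! ### Integrating out the sites inside a block -/

/-- Sites strictly between `x` and `v` integrate out by the convolution law of the gamma kernels.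
Their restriction to the block is void: the block is an interval containing `x` and `v`, and the
kernels vanish unless the site lies between these. -/
lemma chain_replicate_append {ι : Type*} {α lam : ℝ} (hα : 0 < α) (lo hi : ι → ℝ) (j : ι)
    (l : List ι) (n : ℕ) {x : ℝ} (hx : x ∈ Set.Ioo (lo j) (hi j)) :
    chain (gammaKernel α lam) (fun j ↦ Set.Ioo (lo j) (hi j)) (List.replicate (n + 1) j ++ l) x
      = ∫⁻ v in Set.Ioo (lo j) (hi j), gammaKernel ((n + 1) * α) lam (v - x)
        * chain (gammaKernel α lam) (fun j ↦ Set.Ioo (lo j) (hi j)) l v := by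
  have hmeas := measurable_chain (measurable_gammaKernel α lam) (fun j ↦ Set.Ioo (lo j) (hi j)) l
  induction n generalizing x with
  | zero => simp [chain]
  | succ n ih =>
    rw [List.replicate_succ, List.cons_append, chain,
      setLIntegral_congr_fun measurableSet_Ioo fun y hy ↦ by rw [ih hy]]
    simp_rw [← lintegral_const_mul' _ _ (gammaKernel_ne_top _ _ _)]
    rw [lintegral_lintegral_swap (by fun_prop)]
    refine setLIntegral_congr_fun measurableSet_Ioo fun v hv ↦ ?_
    have h1 : ∀ y, gammaKernel α lam (y - x) * (gammaKernel ((n + 1) * α) lam (v - y)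
        * chain (gammaKernel α lam) (fun j ↦ Set.Ioo (lo j) (hi j)) l v)
        = (gammaKernel α lam (y - x) * gammaKernel ((n + 1) * α) lam (v - y))
        * chain (gammaKernel α lam) (fun j ↦ Set.Ioo (lo j) (hi j)) l v := fun y ↦ by ring
    simp only [h1]
    rw [lintegral_mul_const _ (by fun_prop), setLIntegral_eq_of_support_subset]
    · rw [lintegral_gammaKernel_mul hα (by positivity)]
      push_cast
      ring_nf
    · intro y hy
      rw [Function.mem_support] at hy
      by_contra hn
      refine hy ?_
      rw [Set.mem_Ioo, not_and_or, not_lt, not_lt] at hn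
      rcases hn with hn | hn
      · rw [gammaKernel_of_nonpos (d := y - x) _ _ (by linarith [hx.1]), zero_mul]
      · rw [gammaKernel_of_nonpos (d := v - y) _ _ (by linarith [hv.2]), mul_zero]

/-- The density of the last site in a block with `k` sites, when the first one has density `q`. -/
def blockDensity (α lam : ℝ) (I : Set ℝ) (q : ℝ → ℝ≥0∞) (k : ℕ) (v : ℝ) : ℝ≥0∞ :=
  I.indicator (fun v ↦ if 2 ≤ k then ∫⁻ w in I, q w * gammaKernel (((k : ℝ) - 1) * α) lam (v - w)
    else q v) v

lemma chainStart_replicate_append {ι : Type*} {α lam : ℝ} (hα : 0 < α) (lo hi : ι → ℝ)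
    {q : ℝ → ℝ≥0∞} (hq : Measurable q) (hq' : ∀ y, q y ≠ ∞) (j : ι) (l : List ι) {k : ℕ}
    (hk : 1 ≤ k) :
    chainStart q (gammaKernel α lam) (fun j ↦ Set.Ioo (lo j) (hi j)) (List.replicate k j ++ l)
      = ∫⁻ v, blockDensity α lam (Set.Ioo (lo j) (hi j)) q k v
        * chain (gammaKernel α lam) (fun j ↦ Set.Ioo (lo j) (hi j)) l v := by
  have hmeas := measurable_chain (measurable_gammaKernel α lam) (fun j ↦ Set.Ioo (lo j) (hi j)) l
  simp only [blockDensity, ← Set.indicator_mul_left]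
  rw [lintegral_indicator measurableSet_Ioo]
  obtain ⟨n, rfl⟩ := Nat.exists_eq_add_of_le' hk
  rw [List.replicate_succ, List.cons_append, chainStart]
  cases n with
  | zero => simp
  | succ n =>
    simp only [show 2 ≤ n + 1 + 1 by omega, if_true]
    rw [setLIntegral_congr_fun measurableSet_Ioo fun y hy ↦ by
      rw [chain_replicate_append hα lo hi j l n hy]]
    simp_rw [← lintegral_const_mul' _ _ (hq' _)]
    rw [lintegral_lintegral_swap (by fun_prop)]
    refine lintegral_congr fun v ↦ ?_
    rw [← lintegral_mul_const _ (by fun_prop)]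
    refine lintegral_congr fun w ↦ ?_
    push_cast
    rw [add_sub_cancel_right, mul_assoc]

lemma measurable_blockDensity (α lam : ℝ) {I : Set ℝ} (hI : MeasurableSet I) {X : Type*}
    [MeasurableSpace X] {q : X → ℝ → ℝ≥0∞} (hq : Measurable (Function.uncurry q)) (k : ℕ)
    {v : X → ℝ} (hv : Measurable v) :
    Measurable fun x ↦ blockDensity α lam I (q x) k (v x) := by
  have : (fun x ↦ blockDensity α lam I (q x) k (v x)) = (v ⁻¹' I).indicator fun x ↦
      if 2 ≤ k then ∫⁻ w in I, q x w * gammaKernel (((k : ℝ) - 1) * α) lam (v x - w)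
      else q x (v x) := by
    ext x
    by_cases hx : v x ∈ I <;> simp [blockDensity, hx]
  rw [this]
  refine Measurable.indicator ?_ (hv hI)
  split_ifs
  · refine Measurable.lintegral_prod_right' (f := fun p : X × ℝ ↦
      q p.1 p.2 * gammaKernel (((k : ℝ) - 1) * α) lam (v p.1 - p.2)) ?_
    have : Measurable fun p : X × ℝ ↦ q p.1 p.2 := hq
    fun_prop
  · exact hq.comp (measurable_id.prodMk hv)

/-! ### Iterated integrals as integrals over the product space -/

lemma lintegral_fin_succ {n : ℕ} {f : (Fin (n + 1) → ℝ) → ℝ≥0∞} (hf : Measurable f) :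
    ∫⁻ v, f v = ∫⁻ x, ∫⁻ v : Fin n → ℝ, f (Fin.cons x v) := by
  have h := (volume_preserving_piFinSuccAbove (fun _ : Fin (n + 1) ↦ ℝ) 0).symm
  rw [← h.lintegral_comp_emb (MeasurableEquiv.measurableEmbedding _), Measure.volume_eq_prod,
    lintegral_prod _ (by fun_prop)]
  simp [MeasurableEquiv.piFinSuccAbove, Fin.insertNthEquiv]

lemma lintegral_fin_prod {n : ℕ} {f : Fin n → ℝ → ℝ≥0∞} (hf : ∀ i, Measurable (f i)) :
    ∫⁻ v : Fin n → ℝ, ∏ i, f i (v i) = ∏ i, ∫⁻ x, f i x := by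
  induction n with
  | zero => simp [volume_pi]
  | succ n ih =>
    rw [lintegral_fin_succ (by fun_prop), Fin.prod_univ_succ, ← ih fun i ↦ hf i.succ]
    simp only [Fin.prod_univ_succ, Fin.cons_zero, Fin.cons_succ]
    rw [← lintegral_mul_const _ (hf 0)]
    refine lintegral_congr fun x ↦ ?_
    rw [lintegral_const_mul _ (by fun_prop)]

lemma lintegral_fintype_prod {ι : Type*} [Fintype ι] {f : ι → ℝ → ℝ≥0∞}
    (hf : ∀ i, Measurable (f i)) :
    ∫⁻ v : ι → ℝ, ∏ i, f i (v i) = ∏ i, ∫⁻ x, f i x := by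
  let e := (Fintype.equivFin ι).symm
  rw [← e.prod_comp, ← lintegral_fin_prod fun i ↦ hf (e i)]
  rw [← (volume_measurePreserving_piCongrLeft (fun _ : ι ↦ ℝ) e).lintegral_comp_emb
    (MeasurableEquiv.measurableEmbedding _)]
  refine lintegral_congr fun v ↦ ?_
  rw [← e.prod_comp]
  refine Finset.prod_congr rfl fun i _ ↦ ?_
  congr 1
  exact MeasurableEquiv.piCongrLeft_apply_apply ..

/-- The list that contains `j i` with multiplicity `k i`, in the order of the indices `i`. -/
def blockList {ι : Type*} {p : ℕ} (j : Fin p → ι) (k : Fin p → ℕ) : List ι :=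
  (List.ofFn fun i ↦ List.replicate (k i) (j i)).flatten

lemma blockList_succ {ι : Type*} {p : ℕ} (j : Fin (p + 1) → ι) (k : Fin (p + 1) → ℕ) :
    blockList j k = List.replicate (k 0) (j 0) ++ blockList (Fin.tail j) (Fin.tail k) := by
  rw [blockList, List.ofFn_succ, List.flatten_cons]
  rfl

lemma length_blockList {ι : Type*} {p : ℕ} (j : Fin p → ι) (k : Fin p → ℕ) :
    (blockList j k).length = ∑ i, k i := by
  simp [blockList, List.length_flatten, List.map_ofFn, Function.comp_def, List.sum_ofFn]

lemma prod_map_blockList {ι : Type*} {p : ℕ} (j : Fin p → ι) (k : Fin p → ℕ) (σ : ι → ℂ) :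
    ((blockList j k).map σ).prod = ∏ i, σ (j i) ^ k i := by
  induction p with
  | zero => simp [blockList]
  | succ p ih =>
    rw [blockList_succ, List.map_append, List.prod_append, ih, Fin.prod_univ_succ]
    simp [Fin.tail]

lemma measurable_cons_apply {n : ℕ} (a : Fin (n + 1)) :
    Measurable fun p : ℝ × (Fin n → ℝ) ↦ (Fin.cons p.1 p.2 : Fin (n + 1) → ℝ) a := by
  induction a using Fin.cases with
  | zero => simpa using measurable_fst
  | succ a => simpa [Function.comp_def] using (measurable_pi_apply a).comp measurable_snd

/-! ### Chains as integrals over the last sites of the blocks -/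

section Unfold

variable {ι : Type*} {α lam : ℝ} (lo hi : ι → ℝ)

/-- The transition density between the last sites in consecutive blocks. -/
def linkDensity (α lam : ℝ) (lo hi : ι → ℝ) (j : ι) (k : ℕ) (x v : ℝ) : ℝ≥0∞ :=
  blockDensity α lam (Set.Ioo (lo j) (hi j)) (fun w ↦ gammaKernel α lam (w - x)) k v

lemma measurable_linkDensity {X : Type*} [MeasurableSpace X] (j : ι) (k : ℕ) {x v : X → ℝ}
    (hx : Measurable x) (hv : Measurable v) :
    Measurable fun ω ↦ linkDensity α lam lo hi j k (x ω) (v ω) :=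
  measurable_blockDensity α lam measurableSet_Ioo
    (q := fun ω w ↦ gammaKernel α lam (w - x ω)) (by unfold Function.uncurry; fun_prop) k hv

/-- The next block sees only the last site of the previous one. Prepending `x` with `Fin.cons` makes
index `i.castSucc` point at the predecessor of `v i`. -/
lemma chain_blockList (hα : 0 < α) {p : ℕ} (j : Fin p → ι) (k : Fin p → ℕ) (hk : ∀ i, 1 ≤ k i)
    (x : ℝ) :
    chain (gammaKernel α lam) (fun j ↦ Set.Ioo (lo j) (hi j)) (blockList j k) x
      = ∫⁻ v : Fin p → ℝ, ∏ i, linkDensity α lam lo hi (j i) (k i)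
          ((Fin.cons x v : Fin (p + 1) → ℝ) i.castSucc) (v i) := by
  induction p generalizing x with
  | zero => simp [blockList, chain, volume_pi]
  | succ p ih =>
    have hne : blockList j k ≠ [] := by
      rw [ne_eq, ← List.length_eq_zero_iff, length_blockList, Fin.sum_univ_succ]
      have := hk 0
      omega
    have h1 : chain (gammaKernel α lam) (fun j ↦ Set.Ioo (lo j) (hi j)) (blockList j k) x
        = chainStart (fun w ↦ gammaKernel α lam (w - x)) (gammaKernel α lam)
          (fun j ↦ Set.Ioo (lo j) (hi j)) (blockList j k) := by
      obtain ⟨a, l, hl⟩ := List.exists_cons_of_ne_nil hne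
      rw [hl]; rfl
    rw [h1, blockList_succ, chainStart_replicate_append hα lo hi (by fun_prop)
      (fun _ ↦ gammaKernel_ne_top _ _ _) _ _ (hk 0), lintegral_fin_succ]
    · refine lintegral_congr fun v₀ ↦ ?_
      rw [ih (Fin.tail j) (Fin.tail k) fun i ↦ hk i.succ, ← lintegral_const_mul]
      · refine lintegral_congr fun v ↦ ?_
        rw [Fin.prod_univ_succ]
        rfl
      · exact Finset.measurable_prod _ fun i _ ↦ measurable_linkDensity lo hi _ _
          ((measurable_cons_apply _).comp (measurable_const.prodMk measurable_id))
          (measurable_pi_apply i)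
    · exact Finset.measurable_prod _ fun i _ ↦ measurable_linkDensity lo hi _ _
        ((measurable_cons_apply _).comp (measurable_const.prodMk measurable_id))
        (measurable_pi_apply i)

lemma cons_zero_castSucc {p : ℕ} (v : Fin p → ℝ) (i : Fin p) :
    (Fin.cons 0 v : Fin (p + 1) → ℝ) i.castSucc = pad v i := by
  cases p with
  | zero => exact i.elim0
  | succ p =>
    induction i using Fin.cases with
    | zero => rfl
    | succ i =>
      rw [← Fin.succ_castSucc, Fin.cons_succ, Fin.val_succ, pad, dif_pos (by omega)]
      rfl

lemma pad_succ {p : ℕ} (v : Fin p → ℝ) (i : Fin p) : pad v (i + 1) = v i := by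
  rw [pad, dif_pos i.2]

@[fun_prop]
lemma measurable_pad {p : ℕ} (n : ℕ) : Measurable fun v : Fin p → ℝ ↦ pad v n := by
  cases n with
  | zero => exact measurable_const
  | succ n =>
    simp only [pad]
    split_ifs
    · exact measurable_pi_apply _
    · exact measurable_const

/-- The density at `w` of the first site in the `i`-th block. -/
def entryDensity {p : ℕ} (α lam : ℝ) (q : ℝ → ℝ≥0∞) (v : Fin p → ℝ) (i : Fin p) (w : ℝ) : ℝ≥0∞ :=
  if (i : ℕ) = 0 then q w else gammaKernel α lam (w - pad v i)

lemma measurable_entryDensity {p : ℕ} {q : ℝ → ℝ≥0∞} (hq : Measurable q) (i : Fin p) :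
    Measurable (Function.uncurry fun (v : Fin p → ℝ) w ↦ entryDensity α lam q v i w) := by
  unfold Function.uncurry entryDensity
  split_ifs
  · fun_prop
  · fun_prop

lemma chainStart_blockList (hα : 0 < α) {p : ℕ} (hp : 0 < p) (j : Fin p → ι) (k : Fin p → ℕ)
    (hk : ∀ i, 1 ≤ k i) {q : ℝ → ℝ≥0∞} (hq : Measurable q) (hq' : ∀ y, q y ≠ ∞) :
    chainStart q (gammaKernel α lam) (fun j ↦ Set.Ioo (lo j) (hi j)) (blockList j k)
      = ∫⁻ v : Fin p → ℝ, ∏ i, blockDensity α lam (Set.Ioo (lo (j i)) (hi (j i)))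
          (entryDensity α lam q v i) (k i) (v i) := by
  obtain ⟨p, rfl⟩ := Nat.exists_eq_succ_of_ne_zero hp.ne'
  rw [blockList_succ, chainStart_replicate_append hα lo hi hq hq' _ _ (hk 0), lintegral_fin_succ]
  · refine lintegral_congr fun v₀ ↦ ?_
    rw [chain_blockList lo hi hα (Fin.tail j) (Fin.tail k) fun i ↦ hk i.succ, ← lintegral_const_mul]
    · refine lintegral_congr fun v ↦ ?_
      rw [Fin.prod_univ_succ]
      congr 1
      refine Finset.prod_congr rfl fun i _ ↦ ?_
      have : entryDensity α lam q (Fin.cons v₀ v : Fin (p + 1) → ℝ) i.succ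
          = fun w ↦ gammaKernel α lam (w - (Fin.cons v₀ v : Fin (p + 1) → ℝ) i.castSucc) := by
        ext w
        rw [entryDensity, if_neg (by simp), Fin.val_succ]
        rw [show (i : ℕ) = (i.castSucc : Fin (p + 1)) from rfl, pad_succ]
      rw [this]
      rfl
    · exact Finset.measurable_prod _ fun i _ ↦ measurable_linkDensity lo hi _ _
        ((measurable_cons_apply _).comp (measurable_const.prodMk measurable_id))
        (measurable_pi_apply i)
  · exact Finset.measurable_prod _ fun i _ ↦ measurable_blockDensity α lam measurableSet_Ioo
      (measurable_entryDensity hq i) _ (measurable_pi_apply i)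

end Unfold

/-! ### The first sites of the blocks as further variables -/

section Vars

variable {ι : Type*} {α lam : ℝ} (lo hi : ι → ℝ)

@[fun_prop]
lemma measurable_entry {p : ℕ} (k : Fin p → ℕ) (i : Fin p) :
    Measurable fun z : Vars k ↦ entry k z i := by
  unfold entry
  split_ifs
  · exact (measurable_pi_apply _).comp measurable_snd
  · exact (measurable_pi_apply _).comp measurable_fst

/-- The contribution of the `i`-th block to the density of the first and last sites. -/
def varsDensity {p : ℕ} (α lam : ℝ) (lo hi : ι → ℝ) (j : Fin p → ι) (k : Fin p → ℕ)
    (q : ℝ → ℝ≥0∞) (z : Vars k) (i : Fin p) : ℝ≥0∞ :=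
  (Set.Ioo (lo (j i)) (hi (j i))).indicator 1 (z.1 i) *
    ((Set.Ioo (lo (j i)) (hi (j i))).indicator (entryDensity α lam q z.1 i) (entry k z i) *
      if 2 ≤ k i then gammaKernel (((k i : ℝ) - 1) * α) lam (z.1 i - entry k z i) else 1)

/-- For fixed last sites `v` the integrand is a product over the blocks, so the integral over the
first sites factorizes. Blocks with a single site have no variable of their own and give the
constants `r`. -/
lemma chainStart_blockList_eq_lintegral_vars (hα : 0 < α) {p : ℕ} (hp : 0 < p) (j : Fin p → ι)
    (k : Fin p → ℕ) (hk : ∀ i, 1 ≤ k i) {q : ℝ → ℝ≥0∞} (hq : Measurable q) (hq' : ∀ y, q y ≠ ∞) :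
    chainStart q (gammaKernel α lam) (fun j ↦ Set.Ioo (lo j) (hi j)) (blockList j k)
      = ∫⁻ z : Vars k, ∏ i, varsDensity α lam lo hi j k q z i := by
  rw [chainStart_blockList lo hi hα hp j k hk hq hq', Measure.volume_eq_prod, lintegral_prod]
  swap
  · refine (Finset.measurable_prod _ fun i _ ↦ ?_).aemeasurable
    have hent : Measurable fun z : Vars k ↦ entryDensity α lam q z.1 i (entry k z i) :=
      (measurable_entryDensity hq i).comp (measurable_fst.prodMk (measurable_entry k i))
    have h1 : Measurable fun z : Vars k ↦
        (Set.Ioo (lo (j i)) (hi (j i))).indicator (1 : ℝ → ℝ≥0∞) (z.1 i) :=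
      (measurable_one.indicator measurableSet_Ioo).comp
        ((measurable_pi_apply i).comp measurable_fst)
    have h2 : Measurable fun z : Vars k ↦ (Set.Ioo (lo (j i)) (hi (j i))).indicator
        (entryDensity α lam q z.1 i) (entry k z i) :=
      hent.indicator (measurable_entry k i measurableSet_Ioo)
    unfold varsDensity
    refine h1.mul (h2.mul ?_)
    split_ifs
    · exact (measurable_gammaKernel _ _).comp
        (((measurable_pi_apply i).comp measurable_fst).sub (measurable_entry k i))
    · exact measurable_const
  refine lintegral_congr fun v ↦ ?_
  have hm : ∀ i, Measurable (entryDensity α lam q v i) := fun i ↦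
    (measurable_entryDensity hq i).comp (measurable_const.prodMk measurable_id)
  set g : {i : Fin p // 2 ≤ k i} → ℝ → ℝ≥0∞ := fun i w ↦
    (Set.Ioo (lo (j i)) (hi (j i))).indicator 1 (v i) *
      ((Set.Ioo (lo (j i)) (hi (j i))).indicator (entryDensity α lam q v i) w *
        gammaKernel (((k i : ℝ) - 1) * α) lam (v i - w)) with hg
  set r : {i : Fin p // ¬ 2 ≤ k i} → ℝ≥0∞ := fun i ↦
    (Set.Ioo (lo (j i)) (hi (j i))).indicator (entryDensity α lam q v i) (v i) with hr
  have h1 : ∀ w : {i : Fin p // 2 ≤ k i} → ℝ,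
      ∏ i, varsDensity α lam lo hi j k q (v, w) i = (∏ i, g i (w i)) * ∏ i, r i := by
    intro w
    rw [← Fintype.prod_subtype_mul_prod_subtype (fun i ↦ 2 ≤ k i)]
    congr 1
    · refine Finset.prod_congr rfl fun i _ ↦ ?_
      simp only [varsDensity, hg, entry, i.2, dif_pos, if_true]
    · refine Finset.prod_congr rfl fun i _ ↦ ?_
      simp only [varsDensity, hr, entry, i.2, dif_neg, if_false, not_false_iff, mul_one]
      by_cases hv : v i ∈ Set.Ioo (lo (j i)) (hi (j i)) <;> simp [hv]
  simp only [h1]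
  have hgm : ∀ i, Measurable (g i) := fun i ↦ by
    have := (hm i).indicator (measurableSet_Ioo (a := lo (j i)) (b := hi (j i)))
    fun_prop
  rw [lintegral_mul_const _ (by fun_prop), lintegral_fintype_prod hgm,
    ← Fintype.prod_subtype_mul_prod_subtype (fun i ↦ 2 ≤ k i)]
  congr 1
  · refine Finset.prod_congr rfl fun i _ ↦ ?_
    simp only [hg, blockDensity, i.2, if_true]
    rw [lintegral_const_mul' _ _ (by by_cases hv : v i ∈ Set.Ioo (lo (j i)) (hi (j i)) <;> simp [hv])]
    by_cases hv : v i ∈ Set.Ioo (lo (j i)) (hi (j i))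
    · simp only [Set.indicator_of_mem hv, Pi.one_apply, one_mul]
      rw [← lintegral_indicator measurableSet_Ioo]
      refine lintegral_congr fun w ↦ ?_
      by_cases hw : w ∈ Set.Ioo (lo (j i)) (hi (j i)) <;> simp [hw]
    · simp only [Set.indicator_of_notMem hv, zero_mul]
  · refine Finset.prod_congr rfl fun i _ ↦ ?_
    simp only [hr, blockDensity, i.2, if_false]

end Vars

/-! ### The coefficients -/

section Coeff

variable {m : ℕ} {t : Fin m → ℝ} (C : Finset (Fin m)) (k : Fin C.card → ℕ)

/-- The left end point of the `j`-th block, in units of `τ`. -/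
def blockLo (t : Fin m → ℝ) (τ : ℝ) (j : Fin m) : ℝ := pad t j / τ

/-- The right end point of the `j`-th block, in units of `τ`. -/
def blockHi (t : Fin m → ℝ) (τ : ℝ) (j : Fin m) : ℝ := t j / τ

lemma pad_nonneg (ht0 : ∀ j, 0 < t j) (n : ℕ) : 0 ≤ pad t n := by
  cases n with
  | zero => exact le_rfl
  | succ n =>
    rw [pad]
    split_ifs
    exacts [(ht0 _).le, le_rfl]

lemma le_pad_of_lt (ht : StrictMono t) {i j : Fin m} (hij : i < j) : t i ≤ pad t j := by
  obtain ⟨n, hn⟩ := Nat.exists_eq_succ_of_ne_zero (Nat.ne_zero_of_lt hij)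
  rw [hn, pad, dif_pos (by omega)]
  refine ht.monotone ?_
  rw [Fin.le_def]
  have := Fin.lt_def.1 hij
  simp only
  omega

/-- The form that matches `varsDensity`: both sites in the block, plus their order. The extra
inequalities follow from that order. -/
lemma mem_domain_iff (z : Vars k) : z ∈ domain t C k ↔ ∀ i,
    z.1 i ∈ Set.Ioo (blockLo t (lastTime t C) (nth C i)) (blockHi t (lastTime t C) (nth C i)) ∧
    entry k z i ∈ Set.Ioo (blockLo t (lastTime t C) (nth C i)) (blockHi t (lastTime t C) (nth C i)) ∧
    (2 ≤ k i → entry k z i < z.1 i) := by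
  refine forall_congr' fun i ↦ ?_
  simp only [blockLo, blockHi, Set.mem_Ioo, pad_succ]
  by_cases h : 2 ≤ k i
  · simp only [h, true_imp_iff]
    constructor
    · rintro ⟨h1, h2, h3⟩
      exact ⟨⟨h1.trans h2, h3⟩, ⟨h1, h2.trans h3⟩, h2⟩
    · rintro ⟨h1, h2, h3⟩
      exact ⟨h2.1, h3, h1.2⟩
  · have : entry k z i = z.1 i := dif_neg h
    simp only [this, h, false_imp_iff, true_and, and_true, and_self]

lemma measurableSet_domain : MeasurableSet (domain t C k) := by
  have hfst : ∀ i, Measurable fun z : Vars k ↦ z.1 i := fun i ↦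
    (measurable_pi_apply i).comp measurable_fst
  have : domain t C k = ⋂ i : Fin C.card,
      ({z | pad t (nth C i : ℕ) / lastTime t C < entry k z i} ∩
        ({z | 2 ≤ k i → entry k z i < z.1 i} ∩
        {z | z.1 i < pad t ((nth C i : ℕ) + 1) / lastTime t C})) := by
    ext z; simp [domain]
  rw [this]
  refine MeasurableSet.iInter fun i ↦ ?_
  refine (measurableSet_lt measurable_const (measurable_entry k i)).inter
    (MeasurableSet.inter ?_ (measurableSet_lt (hfst i) measurable_const))
  by_cases h : 2 ≤ k i
  · simpa only [h, true_imp_iff] using measurableSet_lt (measurable_entry k i) (hfst i)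
  · simp [h]

lemma nth_strictMono : StrictMono (nth C) := (C.orderEmbOfFin rfl).strictMono

/-- Distinct blocks are separated, so the order between them is automatic on `domain`, and the bases
of the link factors are positive there. -/
lemma pad_lt_entry (ht : StrictMono t) (ht0 : ∀ j, 0 < t j) (hτ : 0 < lastTime t C) {z : Vars k}
    (hz : z ∈ domain t C k) (i : Fin C.card) : pad z.1 i < entry k z i := by
  rw [mem_domain_iff] at hz
  obtain ⟨⟨i, hi⟩, rfl⟩ : ∃ i', i' = i := ⟨i, rfl⟩
  cases i with
  | zero => exact (div_nonneg (pad_nonneg ht0 _) hτ.le).trans_lt (hz _).2.1.1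
  | succ i =>
    have hi' : i < C.card := by omega
    have h1 : pad z.1 (i + 1) = z.1 ⟨i, hi'⟩ := pad_succ z.1 ⟨i, hi'⟩
    change pad z.1 (i + 1) < _
    rw [h1]
    refine ((hz _).1.2.trans_le ?_).trans (hz _).2.1.1
    refine div_le_div_of_nonneg_right (le_pad_of_lt ht (nth_strictMono C ?_)) hτ.le
    exact Fin.mk_lt_mk.2 (Nat.lt_succ_self i)

lemma blockFactor_nonneg {p : ℕ} {α : ℝ} (hα : 0 < α) (k : Fin p → ℕ) (z : Vars k) (i : Fin p)
    (h : 2 ≤ k i → entry k z i < z.1 i) : 0 ≤ blockFactor α 1 k z i := by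
  rw [blockFactor]
  split_ifs with h2
  · have := Real.rpow_nonneg (sub_nonneg.2 (h h2).le) (α * ((k i : ℝ) - 1) - 1)
    have h3 : (2 : ℝ) ≤ k i := by exact_mod_cast h2
    have := Real.Gamma_pos_of_pos (mul_pos (show 0 < (k i : ℝ) - 1 by linarith) hα)
    positivity
  · exact zero_le_one

/-- The real counterpart of `varsDensity`. -/
def realDensity {p : ℕ} (α lam : ℝ) (q : ℝ → ℝ) (k : Fin p → ℕ) (z : Vars k) (i : Fin p) : ℝ :=
  (if (i : ℕ) = 0 then q (entry k z i)
    else linkFactor α (1 / Real.Gamma α) k z i * Real.exp (-lam * (entry k z i - pad z.1 i)))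
  * (blockFactor α 1 k z i * Real.exp (-lam * (z.1 i - entry k z i)))

lemma realDensity_nonneg (ht : StrictMono t) (ht0 : ∀ j, 0 < t j) (hτ : 0 < lastTime t C)
    {α lam : ℝ} (hα : 0 < α) {q : ℝ → ℝ} (hq : ∀ y, 0 < y → 0 ≤ q y) {z : Vars k}
    (hz : z ∈ domain t C k) (i : Fin C.card) : 0 ≤ realDensity α lam q k z i := by
  have hΓ := Real.Gamma_pos_of_pos hα
  have h1 := pad_lt_entry C k ht ht0 hτ hz i
  refine mul_nonneg ?_ (mul_nonneg (blockFactor_nonneg hα k z i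
    ((mem_domain_iff C k z).1 hz i).2.2) (Real.exp_pos _).le)
  split_ifs with h
  · refine hq _ ?_
    rwa [h] at h1
  · have := Real.rpow_nonneg (sub_nonneg.2 h1.le) (α - 1)
    rw [linkFactor]
    positivity

/-- Outside `domain` some factor vanishes: either a site leaves its block, or first and last site
are in the wrong order and the gamma kernel is zero. -/
lemma prod_varsDensity_eq (ht : StrictMono t) (ht0 : ∀ j, 0 < t j) (hτ : 0 < lastTime t C)
    {α lam : ℝ} (hα : 0 < α) {q : ℝ → ℝ} (hq : ∀ y, 0 < y → 0 ≤ q y) {q' : ℝ → ℝ≥0∞}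
    (hq' : ∀ y, 0 < y → q' y = ENNReal.ofReal (q y)) (z : Vars k) :
    ∏ i, varsDensity α lam (blockLo t (lastTime t C)) (blockHi t (lastTime t C)) (nth C) k q' z i
      = (domain t C k).indicator
          (fun z ↦ ENNReal.ofReal (∏ i, realDensity α lam q k z i)) z := by
  by_cases hz : z ∈ domain t C k
  · rw [Set.indicator_of_mem hz, ENNReal.ofReal_prod_of_nonneg fun i _ ↦
      realDensity_nonneg C k ht ht0 hτ hα hq hz i]
    refine Finset.prod_congr rfl fun i _ ↦ ?_
    have h1 := pad_lt_entry C k ht ht0 hτ hz i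
    have hzi := (mem_domain_iff C k z).1 hz i
    have hB := blockFactor_nonneg hα k z i hzi.2.2
    rw [varsDensity, Set.indicator_of_mem hzi.1, Set.indicator_of_mem hzi.2.1, Pi.one_apply,
      one_mul, realDensity, ENNReal.ofReal_mul' (mul_nonneg hB (Real.exp_pos _).le)]
    congr 1
    · rw [entryDensity]
      split_ifs with h0
      · rw [h0] at h1
        exact hq' _ h1
      · rw [gammaKernel, if_pos (sub_pos.2 h1), linkFactor]
        congr 1
        ring
    · by_cases h2 : 2 ≤ k i
      · rw [if_pos h2, gammaKernel, if_pos (sub_pos.2 (hzi.2.2 h2)), blockFactor, if_pos h2,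
          one_pow, one_mul, mul_comm α]
      · have : entry k z i = z.1 i := dif_neg h2
        rw [if_neg h2, this, blockFactor, if_neg h2]
        simp
  · rw [Set.indicator_of_notMem hz]
    rw [mem_domain_iff, not_forall] at hz
    obtain ⟨i, hi⟩ := hz
    refine Finset.prod_eq_zero (Finset.mem_univ i) ?_
    rw [varsDensity]
    by_cases h1 : z.1 i ∈ Set.Ioo (blockLo t (lastTime t C) (nth C i))
        (blockHi t (lastTime t C) (nth C i))
    · by_cases h2 : entry k z i ∈ Set.Ioo (blockLo t (lastTime t C) (nth C i))
          (blockHi t (lastTime t C) (nth C i))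
      · have h3 : ¬(2 ≤ k i → entry k z i < z.1 i) := fun h ↦ hi ⟨h1, h2, h⟩
        rw [Classical.not_imp, not_lt] at h3
        rw [if_pos h3.1, gammaKernel_of_nonpos _ _ (sub_nonpos.2 h3.2), mul_zero, mul_zero]
      · rw [Set.indicator_of_notMem h2, zero_mul, mul_zero]
    · rw [Set.indicator_of_notMem h1, zero_mul]

lemma sum_sub_pad {p : ℕ} (x : Fin p → ℝ) : ∑ i, (x i - pad x i) = pad x p := by
  have h := Fin.sum_univ_eq_sum_range (fun n ↦ pad x (n + 1) - pad x n) p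
  simp only [pad_succ] at h
  rw [h, Finset.sum_range_sub, pad, sub_zero]

/-- The exponentials of the gaps telescope to that of the last site, since the first gap is measured
from `0`. -/
lemma kernelStar_eq_prod {α lam : ℝ} (z : Vars k) :
    kernelStar t C k α lam (1 / Real.Gamma α) 1 z
      = ∏ i, realDensity α (lam * lastTime t C)
          (fun y ↦ y ^ (α - 1) / Real.Gamma α * Real.exp (-(lam * lastTime t C) * y)) k z i := by
  have h : ∀ i, realDensity α (lam * lastTime t C)
      (fun y ↦ y ^ (α - 1) / Real.Gamma α * Real.exp (-(lam * lastTime t C) * y)) k z i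
      = blockFactor α 1 k z i * linkFactor α (1 / Real.Gamma α) k z i
        * Real.exp (-(lam * lastTime t C) * (z.1 i - pad z.1 i)) := by
    intro i
    have he : Real.exp (-(lam * lastTime t C) * (z.1 i - pad z.1 i))
        = Real.exp (-(lam * lastTime t C) * (entry k z i - pad z.1 i))
          * Real.exp (-(lam * lastTime t C) * (z.1 i - entry k z i)) := by
      rw [← Real.exp_add]; congr 1; ring
    rw [realDensity, he]
    split_ifs with h0
    · simp only [linkFactor, h0, pad, sub_zero]
      ring
    · ring
  simp only [h, Finset.prod_mul_distrib]
  rw [← Real.exp_sum, ← Finset.mul_sum, sum_sub_pad, kernelStar, neg_mul]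

/-- Here no exponential precedes the first entry, so the telescoping sum has to be corrected by
`entry k z ⟨0, hp⟩` at index zero. -/
lemma kernel_eq_prod (hC : C.Nonempty) {α lam : ℝ} (z : Vars k) :
    kernel t C k α lam (1 / Real.Gamma α) 1 z
      = ∏ i, realDensity α (lam * lastTime t C) (fun _ ↦ 1) k z i := by
  have hp : 0 < C.card := hC.card_pos
  have h : ∀ i, realDensity α (lam * lastTime t C) (fun _ ↦ 1) k z i
      = blockFactor α 1 k z i
        * (if (i : ℕ) = 0 then 1 else linkFactor α (1 / Real.Gamma α) k z i)
        * Real.exp (-(lam * lastTime t C) * ((z.1 i - pad z.1 i)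
          - if i = ⟨0, hp⟩ then entry k z ⟨0, hp⟩ else 0)) := by
    intro i
    rw [realDensity]
    by_cases h0 : (i : ℕ) = 0
    · have hi : i = ⟨0, hp⟩ := Fin.ext h0
      rw [if_pos h0, if_pos h0, if_pos hi, h0, pad, sub_zero, hi]
      ring
    · have hi : i ≠ ⟨0, hp⟩ := fun h ↦ h0 (by rw [h])
      have he : Real.exp (-(lam * lastTime t C) * ((z.1 i - pad z.1 i) - 0))
          = Real.exp (-(lam * lastTime t C) * (entry k z i - pad z.1 i))
            * Real.exp (-(lam * lastTime t C) * (z.1 i - entry k z i)) := by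
        rw [← Real.exp_add]; congr 1; ring
      rw [if_neg h0, if_neg h0, if_neg hi, he]
      ring
  simp only [h, Finset.prod_mul_distrib]
  have hpad : pad (entry k z) 1 = entry k z ⟨0, hp⟩ := pad_succ (entry k z) ⟨0, hp⟩
  rw [← Real.exp_sum, ← Finset.mul_sum, Finset.sum_sub_distrib, sum_sub_pad, kernel, hpad,
    Finset.sum_ite_eq' Finset.univ, if_pos (Finset.mem_univ _), neg_mul]

lemma measurable_realDensity {p : ℕ} (α lam : ℝ) {q : ℝ → ℝ} (hq : Measurable q) (k : Fin p → ℕ)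
    (i : Fin p) : Measurable fun z : Vars k ↦ realDensity α lam q k z i := by
  have h1 : Measurable fun z : Vars k ↦ z.1 i := (measurable_pi_apply i).comp measurable_fst
  have h2 : Measurable fun z : Vars k ↦ pad z.1 i := (measurable_pad i).comp measurable_fst
  unfold realDensity blockFactor linkFactor
  split_ifs <;> fun_prop

lemma integrableOn_and_integral_eq {X : Type*} [MeasurableSpace X] {μ : Measure X} {f : X → ℝ}
    (hf : Measurable f) {s : Set X} (hs : MeasurableSet s) (h0 : ∀ x ∈ s, 0 ≤ f x)
    (hfin : ∫⁻ x in s, ENNReal.ofReal (f x) ∂μ ≠ ∞) :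
    IntegrableOn f s μ ∧ ∫ x in s, f x ∂μ = (∫⁻ x in s, ENNReal.ofReal (f x) ∂μ).toReal := by
  have hae : 0 ≤ᵐ[μ.restrict s] f := (ae_restrict_iff' hs).2 (Eventually.of_forall h0)
  refine ⟨⟨hf.aestronglyMeasurable, ?_⟩, ?_⟩
  · rw [hasFiniteIntegral_iff_ofReal hae]
    exact hfin.lt_top
  · exact integral_eq_lintegral_of_nonneg_ae hae hf.aestronglyMeasurable

lemma lastTime_eq (t : Fin m → ℝ) (hC : C.Nonempty) :
    ∃ j ∈ C, lastTime t C = t j := by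
  have hp : 0 < C.card := hC.card_pos
  have h := pad_succ (fun i ↦ t (nth C i)) ⟨C.card - 1, by omega⟩
  refine ⟨nth C ⟨C.card - 1, by omega⟩, Finset.orderEmbOfFin_mem C rfl _, ?_⟩
  rw [lastTime, ← h]
  congr 1
  change C.card = C.card - 1 + 1
  omega

/-- The chain function of a list of blocks as an integral over the first and last sites. -/
lemma chainStart_eq_lintegral_domain (hC : C.Nonempty) (ht : StrictMono t) (ht0 : ∀ j, 0 < t j)
    {α lam e : ℝ} (hα : 0 < α) {r : ℝ → ℝ} (hr : ∀ y, 0 < y → 0 ≤ r y) (hrm : Measurable r)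
    {q q' : ℝ → ℝ≥0∞} (hq' : ∀ y, 0 < y → q' y = ENNReal.ofReal (r y)) (hq'm : Measurable q')
    (hq'top : ∀ y, q' y ≠ ∞)
    (hqq' : ∀ y, q (lastTime t C * y) = ENNReal.ofReal (lastTime t C ^ e) * q' y)
    (hk : ∀ i, 1 ≤ k i)
    (hfin : chainStart q (gammaKernel α lam) (fun j : Fin m ↦ Set.Ioo (pad t j) (t j))
      (blockList (nth C) k) ≠ ∞) :
    IntegrableOn (fun z ↦ ∏ i, realDensity α (lam * lastTime t C) r k z i) (domain t C k) ∧
    (chainStart q (gammaKernel α lam) (fun j : Fin m ↦ Set.Ioo (pad t j) (t j))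
      (blockList (nth C) k)).toReal = lastTime t C ^ (α * ((∑ i, (k i : ℝ)) - 1) + (e + 1))
        * ∫ z in domain t C k, ∏ i, realDensity α (lam * lastTime t C) r k z i := by
  obtain ⟨j₀, -, hj₀⟩ := lastTime_eq C t hC
  have hτ : 0 < lastTime t C := hj₀ ▸ ht0 j₀
  have hne : blockList (nth C) k ≠ [] := by
    rw [ne_eq, ← List.length_eq_zero_iff, length_blockList, Finset.sum_eq_zero_iff]
    intro h
    have h1 := h ⟨0, hC.card_pos⟩ (Finset.mem_univ _)
    have h2 := hk ⟨0, hC.card_pos⟩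
    omega
  have hpow : 0 < lastTime t C ^ (α * ((∑ i, (k i : ℝ)) - 1) + (e + 1)) :=
    Real.rpow_pos_of_pos hτ _
  have key : chainStart q (gammaKernel α lam) (fun j : Fin m ↦ Set.Ioo (pad t j) (t j))
      (blockList (nth C) k)
      = ENNReal.ofReal (lastTime t C ^ (α * ((∑ i, (k i : ℝ)) - 1) + (e + 1)))
        * ∫⁻ z in domain t C k,
          ENNReal.ofReal (∏ i, realDensity α (lam * lastTime t C) r k z i) := by
    rw [chainStart_mul hτ lam _ _ hqq' hne, length_blockList,
      chainStart_blockList_eq_lintegral_vars _ _ hα hC.card_pos (nth C) k hk hq'm hq'top,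
      ← lintegral_indicator (measurableSet_domain C k)]
    push_cast
    congr 1
    refine lintegral_congr fun z ↦ ?_
    exact prod_varsDensity_eq C k ht ht0 hτ hα hr hq' z
  rw [key] at hfin ⊢
  -- A positive multiple of this integral is the finite chain function; the bound on chains thus
  -- gives integrability of the kernel.
  have hfin' : ∫⁻ z in domain t C k,
      ENNReal.ofReal (∏ i, realDensity α (lam * lastTime t C) r k z i) ≠ ∞ := by
    intro h
    rw [h, ENNReal.mul_top (ENNReal.ofReal_pos.2 hpow).ne'] at hfin
    exact hfin rfl
  have hmain := integrableOn_and_integral_eq (μ := volume)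
    (f := fun z : Vars k ↦ ∏ i, realDensity α (lam * lastTime t C) r k z i)
    (Finset.measurable_prod _ fun i _ ↦ measurable_realDensity α _ hrm k i)
    (measurableSet_domain C k)
    (fun z hz ↦ Finset.prod_nonneg fun i _ ↦ realDensity_nonneg C k ht ht0 hτ hα hr hz i) hfin'
  refine ⟨hmain.1, ?_⟩
  rw [hmain.2, ENNReal.toReal_mul, ENNReal.toReal_ofReal hpow.le]

lemma chainStart_star_eq (hC : C.Nonempty) (ht : StrictMono t) (ht0 : ∀ j, 0 < t j)
    {α lam : ℝ} (hα : 0 < α) (hk : ∀ i, 1 ≤ k i)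
    (hfin : chainStart (gammaKernel α lam) (gammaKernel α lam)
      (fun j : Fin m ↦ Set.Ioo (pad t j) (t j)) (blockList (nth C) k) ≠ ∞) :
    IntegrableOn (kernelStar t C k α lam (1 / Real.Gamma α) 1) (domain t C k) ∧
    (chainStart (gammaKernel α lam) (gammaKernel α lam)
      (fun j : Fin m ↦ Set.Ioo (pad t j) (t j)) (blockList (nth C) k)).toReal
      = lastTime t C ^ (α * ∑ i, (k i : ℝ)) * coeffStar t C k α lam (1 / Real.Gamma α) 1 := by
  obtain ⟨j₀, -, hj₀⟩ := lastTime_eq C t hC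
  have hτ : 0 < lastTime t C := hj₀ ▸ ht0 j₀
  have hΓ := Real.Gamma_pos_of_pos hα
  have h := chainStart_eq_lintegral_domain C k hC ht ht0 (e := α - 1) hα
    (r := fun y ↦ y ^ (α - 1) / Real.Gamma α * Real.exp (-(lam * lastTime t C) * y))
    (fun y hy ↦ by positivity) (by fun_prop) (q' := gammaKernel α (lam * lastTime t C))
    (fun y hy ↦ by rw [gammaKernel, if_pos hy]) (by fun_prop) (fun y ↦ gammaKernel_ne_top _ _ _)
    (fun y ↦ gammaKernel_mul hτ α lam y) hk hfin
  simp only [← kernelStar_eq_prod] at h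
  refine ⟨h.1, h.2.trans ?_⟩
  rw [coeffStar]
  congr 2
  ring

lemma chainStart_const {ι : Type*} (a : ℝ) (κ : ℝ → ℝ≥0∞) (I : ι → Set ℝ) {l : List ι}
    (hl : l ≠ []) : chainStart (fun _ ↦ ENNReal.ofReal a) κ I l
      = ENNReal.ofReal a * chainStart (fun _ ↦ 1) κ I l := by
  obtain ⟨j, l, rfl⟩ := List.exists_cons_of_ne_nil hl
  simp only [chainStart, one_mul]
  rw [lintegral_const_mul' _ _ ENNReal.ofReal_ne_top]

lemma chainStart_one_eq (hC : C.Nonempty) (ht : StrictMono t) (ht0 : ∀ j, 0 < t j)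
    {α lam : ℝ} (hα : 0 < α) (hk : ∀ i, 1 ≤ k i)
    (hfin : chainStart (fun _ ↦ 1) (gammaKernel α lam)
      (fun j : Fin m ↦ Set.Ioo (pad t j) (t j)) (blockList (nth C) k) ≠ ∞) :
    IntegrableOn (kernel t C k α lam (1 / Real.Gamma α) 1) (domain t C k) ∧
    (chainStart (fun _ ↦ 1) (gammaKernel α lam)
      (fun j : Fin m ↦ Set.Ioo (pad t j) (t j)) (blockList (nth C) k)).toReal
      = lastTime t C ^ (α * ((∑ i, (k i : ℝ)) - 1) + 1)
        * coeff t C k α lam (1 / Real.Gamma α) 1 := by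
  have h := chainStart_eq_lintegral_domain C k hC ht ht0 (e := 0) hα
    (r := fun _ ↦ 1) (fun y hy ↦ zero_le_one) measurable_const (q' := fun _ ↦ 1)
    (fun y hy ↦ by simp) measurable_const (fun y ↦ ENNReal.one_ne_top)
    (fun y ↦ by simp) hk hfin
  simp only [← kernel_eq_prod C k hC, zero_add] at h
  exact ⟨h.1, h.2⟩

end Coeff

/-! ### Sorted lists of blocks -/

section Reindex

variable {m : ℕ}

lemma count_blockList (C : Finset (Fin m)) (k : Fin C.card → ℕ) (a : Fin m) :
    (blockList (nth C) k).count a = ∑ i, if nth C i = a then k i else 0 := by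
  simp [blockList, List.count_flatten, List.map_ofFn, Function.comp_def, List.sum_ofFn,
    List.count_replicate]

lemma count_blockList_nth (C : Finset (Fin m)) (k : Fin C.card → ℕ) (i : Fin C.card) :
    (blockList (nth C) k).count (nth C i) = k i := by
  rw [count_blockList, Finset.sum_eq_single i]
  · simp
  · intro i' _ hi'
    exact if_neg fun h ↦ hi' ((nth_strictMono C).injective h)
  · simp

lemma exists_nth_eq {C : Finset (Fin m)} {a : Fin m} (ha : a ∈ C) : ∃ i, nth C i = a := by
  have := Finset.range_orderEmbOfFin C rfl
  rw [Set.ext_iff] at this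
  exact (this a).2 ha

lemma mem_blockList {C : Finset (Fin m)} {k : Fin C.card → ℕ} (hk : ∀ i, 0 < k i) (a : Fin m) :
    a ∈ blockList (nth C) k ↔ a ∈ C := by
  simp only [blockList, List.mem_flatten, List.mem_ofFn', Set.mem_range, exists_exists_eq_and,
    List.mem_replicate]
  constructor
  · rintro ⟨i, -, rfl⟩
    exact Finset.orderEmbOfFin_mem C rfl i
  · intro ha
    obtain ⟨i, rfl⟩ := exists_nth_eq ha
    exact ⟨i, (hk i).ne', rfl⟩

lemma pairwise_blockList (C : Finset (Fin m)) (k : Fin C.card → ℕ) :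
    (blockList (nth C) k).Pairwise (· ≤ ·) := by
  rw [blockList, List.pairwise_flatten]
  constructor
  · intro l hl
    obtain ⟨i, rfl⟩ := (List.mem_ofFn' _ _).1 hl
    exact List.pairwise_replicate.2 (.inr le_rfl)
  · rw [List.pairwise_ofFn]
    intro i j hij x hx y hy
    rw [List.eq_of_mem_replicate hx, List.eq_of_mem_replicate hy]
    exact (nth_strictMono C hij).le

/-- The list of blocks that belongs to a set `C` of blocks with multiplicities. -/
def multList (p : Σ C : Finset (Fin m), Fin C.card → ℕ+) : List (Fin m) :=
  blockList (nth p.1) fun i ↦ (p.2 i : ℕ)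

/-- `C` is recovered as the set of entries of the list and `k` as their multiplicities. -/
lemma multList_injective : Function.Injective (multList (m := m)) := by
  rintro ⟨C, k⟩ ⟨C', k'⟩ h
  simp only [multList] at h
  have hC : C = C' := by
    ext a
    rw [← mem_blockList (k := fun i ↦ (k i : ℕ)) (fun i ↦ (k i).pos), h,
      mem_blockList fun i ↦ (k' i).pos]
  subst hC
  congr 1
  ext i
  have h1 := count_blockList_nth C (fun i ↦ (k i : ℕ)) i
  rw [h, count_blockList_nth] at h1
  exact PNat.eq h1.symm

/-- A sorted list is determined by the multiplicities of its entries. -/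
lemma mem_range_multList {l : List (Fin m)} (hl : l.Pairwise (· ≤ ·)) :
    l ∈ Set.range (multList (m := m)) := by
  have hpos : ∀ i : Fin l.toFinset.card, 0 < l.count (nth l.toFinset i) := fun i ↦
    List.count_pos_iff.2 (List.mem_toFinset.1 (Finset.orderEmbOfFin_mem l.toFinset rfl i))
  refine ⟨⟨l.toFinset, fun i ↦ ⟨l.count (nth l.toFinset i), hpos i⟩⟩, ?_⟩
  refine List.Perm.eq_of_pairwise (fun _ _ _ _ ↦ le_antisymm) (pairwise_blockList _ _) hl ?_
  rw [List.perm_iff_count]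
  intro a
  by_cases ha : a ∈ l
  · obtain ⟨i, rfl⟩ := exists_nth_eq (List.mem_toFinset.2 ha)
    rw [multList, count_blockList_nth]
    rfl
  · rw [List.count_eq_zero_of_not_mem ha, List.count_eq_zero_of_not_mem]
    rw [multList, mem_blockList fun i ↦ PNat.pos _]
    simpa using ha

lemma tsum_list_eq {g : List (Fin m) → ℂ} (hg : Summable g)
    (hs : ∀ l, g l ≠ 0 → l.Pairwise (· ≤ ·)) :
    (∀ C : Finset (Fin m), Summable fun k : Fin C.card → ℕ+ ↦ g (multList ⟨C, k⟩)) ∧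
    ∑' l, g l = g [] + ∑ C : Finset (Fin m) with C.Nonempty,
      ∑' k : Fin C.card → ℕ+, g (multList ⟨C, k⟩) := by
  have h1 : Summable fun p ↦ g (multList p) := hg.comp_injective multList_injective
  have h2 : ∀ C : Finset (Fin m), Summable fun k : Fin C.card → ℕ+ ↦ g (multList ⟨C, k⟩) :=
    fun C ↦ h1.sigma_factor C
  refine ⟨h2, ?_⟩
  rw [← multList_injective.tsum_eq (fun l hl ↦ mem_range_multList (hs l hl)),
    h1.tsum_sigma' h2, tsum_fintype,
    ← Finset.sum_filter_not_add_sum_filter Finset.univ fun C : Finset (Fin m) ↦ C.Nonempty]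
  congr 1
  -- The empty `C` carries a single `k` and stands for the empty list, the source of the summand `1`
  -- in `mgf` and `mgfStar`.
  have : (Finset.univ.filter fun C : Finset (Fin m) ↦ ¬ C.Nonempty) = {∅} := by
    ext C; simp
  rw [this, Finset.sum_singleton]
  have : Unique (Fin (∅ : Finset (Fin m)).card → ℕ+) := by
    rw [Finset.card_empty]; infer_instance
  rw [tsum_eq_single default fun k hk ↦ absurd (Subsingleton.elim _ _) hk]
  rfl

/-- A return to an earlier block would need a negative gap, where the kernel vanishes. -/
lemma isChain_of_chain_ne_zero {t : Fin m → ℝ} (ht : StrictMono t) (α lam : ℝ) (a : Fin m)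
    (l : List (Fin m)) {x : ℝ} (hx : x ∈ Set.Ioo (pad t a) (t a))
    (h : chain (gammaKernel α lam) (fun j : Fin m ↦ Set.Ioo (pad t j) (t j)) l x ≠ 0) :
    (a :: l).IsChain (· ≤ ·) := by
  induction l generalizing a x with
  | nil => exact List.isChain_singleton _
  | cons b l ih =>
    obtain ⟨y, hy, hne⟩ : ∃ y ∈ Set.Ioo (pad t b) (t b), gammaKernel α lam (y - x)
        * chain (gammaKernel α lam) (fun j : Fin m ↦ Set.Ioo (pad t j) (t j)) l y ≠ 0 := by
      by_contra! hcon
      exact h (setLIntegral_eq_zero measurableSet_Ioo hcon)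
    refine List.isChain_cons_cons.2 ⟨?_, ih b hy (right_ne_zero_of_mul hne)⟩
    by_contra! hba
    refine left_ne_zero_of_mul hne (gammaKernel_of_nonpos _ _ ?_)
    linarith [hy.2, hx.1, le_pad_of_lt ht hba]

lemma pairwise_of_chainStart_ne_zero {t : Fin m → ℝ} (ht : StrictMono t) {α lam : ℝ}
    {q : ℝ → ℝ≥0∞} {l : List (Fin m)}
    (h : chainStart q (gammaKernel α lam) (fun j : Fin m ↦ Set.Ioo (pad t j) (t j)) l ≠ 0) :
    l.Pairwise (· ≤ ·) := by
  rw [← List.isChain_iff_pairwise]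
  cases l with
  | nil => exact List.isChain_nil
  | cons a l =>
    obtain ⟨y, hy, hne⟩ : ∃ y ∈ Set.Ioo (pad t a) (t a), q y
        * chain (gammaKernel α lam) (fun j : Fin m ↦ Set.Ioo (pad t j) (t j)) l y ≠ 0 := by
      by_contra! hcon
      exact h (setLIntegral_eq_zero measurableSet_Ioo hcon)
    exact isChain_of_chain_ne_zero ht α lam a l hy (right_ne_zero_of_mul hne)

end Reindex

/-! ### Blocks between consecutive times -/

section Blocks

variable {m : ℕ} {t : Fin m → ℝ}

lemma pad_lt (ht : StrictMono t) (ht0 : ∀ j, 0 < t j) (j : Fin m) : pad t j < t j := by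
  obtain ⟨j, hj⟩ := j
  cases j with
  | zero => exact ht0 _
  | succ j =>
    have : pad t (j + 1) = t ⟨j, by omega⟩ := pad_succ t ⟨j, by omega⟩
    change pad t (j + 1) < _
    rw [this]
    exact ht (Fin.mk_lt_mk.2 (Nat.lt_succ_self j))

lemma isBlocks_pad (ht : StrictMono t) (ht0 : ∀ j, 0 < t j) {T : ℝ} (hT : ∀ j, t j ≤ T) :
    IsBlocks (fun j : Fin m ↦ pad t j) t T :=
  ⟨fun _ ↦ pad_nonneg ht0 _, pad_lt ht ht0, hT⟩

lemma disjoint_siteBlock (ht : StrictMono t) (n : ℕ) :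
    Pairwise fun i j : Fin m ↦ Disjoint (siteBlock n (pad t i) (t i)) (siteBlock n (pad t j) (t j)) := by
  have key : ∀ i j : Fin m, i < j →
      Disjoint (siteBlock n (pad t i) (t i)) (siteBlock n (pad t j) (t j)) := by
    intro i j hij
    refine Finset.disjoint_left.2 fun y hi hj ↦ ?_
    have h1 := (Finset.mem_Ioc.1 hi).2
    have h2 := (Finset.mem_Ioc.1 hj).1
    have : ⌊(n : ℝ) * t i⌋₊ ≤ ⌊n * pad t j⌋₊ :=
      Nat.floor_le_floor (mul_le_mul_of_nonneg_left (le_pad_of_lt ht hij) (Nat.cast_nonneg n))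
    omega
  intro i j hij
  rcases lt_or_gt_of_ne hij with h | h
  exacts [key i j h, (key j i h).symm]

/-- The limits of the generating functions of the increments of the walks. -/
lemma tendsto_integral_exp_star (ht : StrictMono t) (ht0 : ∀ j, 0 < t j) {T : ℝ} (hT0 : 0 ≤ T)
    (hT : ∀ j, t j ≤ T) {α lam : ℝ} (hα : 0 < α) (hα1 : α ≤ 1) {s : ℕ → ℝ}
    {Q : ℕ → ProbabilityMeasure (ℕ → Bool)}
    (h : RenewalLimit α lam (siteKernel α lam) (gammaKernel α lam) T s Q) (σ : Fin m → ℂ) :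
    MgfStarConverges α lam σ t ∧
    Tendsto (fun n : ℕ ↦ ∫ ω, Complex.exp (∑ j, σ j / s n *
        ∑ y ∈ siteBlock n (pad t j) (t j), if ω y = true then 1 else 0)
        ∂(Q n : Measure (ℕ → Bool))) atTop (𝓝 (mgfStar α lam σ t)) := by
  obtain ⟨hfin, hsum, hlim⟩ := tendsto_integral_exp_sum hα hα1 hT0 (isBlocks_pad ht ht0 hT)
    (disjoint_siteBlock ht) h σ
  obtain ⟨hC, htsum⟩ := tsum_list_eq hsum fun l hl ↦
    pairwise_of_chainStart_ne_zero (q := gammaKernel α lam) (α := α) (lam := lam) ht fun h0 ↦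
      hl (by rw [h0]; simp)
  have hterm : ∀ C : Finset (Fin m), C.Nonempty → ∀ k : Fin C.card → ℕ+,
      ((multList ⟨C, k⟩).map σ).prod * ((chainStart (gammaKernel α lam) (gammaKernel α lam)
        (fun j : Fin m ↦ Set.Ioo (pad t j) (t j)) (multList ⟨C, k⟩)).toReal : ℂ)
      = mgfStarTerm α lam σ t C k := by
    intro C hCne k
    have h1 := (chainStart_star_eq C (fun i ↦ (k i : ℕ)) hCne ht ht0 hα (fun i ↦ (k i).pos)
      (hfin _)).2
    simp only [multList, h1, prod_map_blockList, mgfStarTerm]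
    rw [mul_comm]
  refine ⟨fun C hCne ↦ ⟨fun k ↦ (chainStart_star_eq C (fun i ↦ (k i : ℕ)) hCne ht ht0 hα
    (fun i ↦ (k i).pos) (hfin _)).1, ?_⟩, ?_⟩
  · exact (summable_congr (hterm C hCne)).1 (hC C)
  · convert hlim using 2
    rw [htsum, mgfStar]
    congr 1
    · simp [chainStart]
    · refine Finset.sum_congr rfl fun C hCm ↦ tsum_congr fun k ↦ ?_
      exact (hterm C (Finset.mem_filter.1 hCm).2 k).symm

/-- The start density is the constant `aT`. Its positivity allows it to be divided out, which
carries finiteness and summability over to the start density one used in `coeff`. -/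
lemma tendsto_integral_exp_stationary (ht : StrictMono t) (ht0 : ∀ j, 0 < t j) {T : ℝ}
    (hT0 : 0 ≤ T) (hT : ∀ j, t j ≤ T) {α lam b : ℝ} (hα : 0 < α) (hα1 : α ≤ 1)
    (haT : 0 < aT α lam b T) {q : ℕ → ℕ → ℝ} {s : ℕ → ℝ}
    {Q : ℕ → ProbabilityMeasure (ℕ → Bool)}
    (h : RenewalLimit α lam q (fun _ ↦ ENNReal.ofReal (aT α lam b T)) T s Q) (σ : Fin m → ℂ) :
    MgfConverges α lam σ t ∧
    Tendsto (fun n : ℕ ↦ ∫ ω, Complex.exp (∑ j, σ j / s n *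
        ∑ y ∈ siteBlock n (pad t j) (t j), if ω y = true then 1 else 0)
        ∂(Q n : Measure (ℕ → Bool))) atTop (𝓝 (mgf α lam b T σ t)) := by
  obtain ⟨hfin, hsum, hlim⟩ := tendsto_integral_exp_sum hα hα1 hT0 (isBlocks_pad ht ht0 hT)
    (disjoint_siteBlock ht) h σ
  obtain ⟨hC, htsum⟩ := tsum_list_eq hsum fun l hl ↦
    pairwise_of_chainStart_ne_zero (q := fun _ ↦ ENNReal.ofReal (aT α lam b T)) (α := α)
      (lam := lam) ht fun h0 ↦ hl (by rw [h0]; simp)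
  have hne : ∀ C : Finset (Fin m), C.Nonempty → ∀ k : Fin C.card → ℕ+,
      blockList (nth C) (fun i ↦ (k i : ℕ)) ≠ [] := by
    intro C ⟨a, ha⟩ k h0
    have := (mem_blockList (k := fun i ↦ (k i : ℕ)) (fun i ↦ (k i).pos) a).2 ha
    rw [h0] at this
    simp at this
  have hfin' : ∀ C : Finset (Fin m), C.Nonempty → ∀ k : Fin C.card → ℕ+,
      chainStart (fun _ ↦ 1) (gammaKernel α lam) (fun j : Fin m ↦ Set.Ioo (pad t j) (t j))
        (blockList (nth C) fun i ↦ (k i : ℕ)) ≠ ∞ := by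
    intro C hCne k h0
    have := hfin (blockList (nth C) fun i ↦ (k i : ℕ))
    rw [chainStart_const _ _ _ (hne C hCne k), h0,
      ENNReal.mul_top (ENNReal.ofReal_pos.2 haT).ne'] at this
    exact this rfl
  have hterm : ∀ C : Finset (Fin m), C.Nonempty → ∀ k : Fin C.card → ℕ+,
      ((multList ⟨C, k⟩).map σ).prod * ((chainStart (fun _ ↦ ENNReal.ofReal (aT α lam b T))
        (gammaKernel α lam) (fun j : Fin m ↦ Set.Ioo (pad t j) (t j))
        (multList ⟨C, k⟩)).toReal : ℂ)
      = aT α lam b T * mgfTerm α lam σ t C k := by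
    intro C hCne k
    have h1 := (chainStart_one_eq C (fun i ↦ (k i : ℕ)) hCne ht ht0 hα (fun i ↦ (k i).pos)
      (hfin' C hCne k)).2
    simp only [multList, chainStart_const _ _ _ (hne C hCne k), ENNReal.toReal_mul, h1,
      prod_map_blockList, mgfTerm, ENNReal.toReal_ofReal haT.le]
    push_cast
    ring
  refine ⟨fun C hCne ↦ ⟨fun k ↦ (chainStart_one_eq C (fun i ↦ (k i : ℕ)) hCne ht ht0 hα
    (fun i ↦ (k i).pos) (hfin' C hCne k)).1, ?_⟩, ?_⟩
  · have := (summable_congr (hterm C hCne)).1 (hC C)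
    exact (summable_mul_left_iff (Complex.ofReal_ne_zero.2 haT.ne')).1 this
  · convert hlim using 2
    rw [htsum, mgf]
    congr 1
    · simp [chainStart]
    · rw [Finset.mul_sum]
      refine Finset.sum_congr rfl fun C hCm ↦ ?_
      rw [← tsum_mul_left]
      exact tsum_congr fun k ↦ (hterm C (Finset.mem_filter.1 hCm).2 k).symm

end Blocks

/-! ### Lévy processes at random times -/

section Levy

variable {Ω : Type*} [MeasurableSpace Ω] {μ : Measure Ω} {Y : ℝ≥0 → Ω → ℝ} {ψ : ℝ → ℂ}

/-- A characteristic function has modulus at most one; take `u = 1`. This makes the exponential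
functionals of `X` bounded. -/
lemma re_le_zero_of_integral_eq [IsProbabilityMeasure μ] (hψ : ∀ (u : ℝ≥0) (s : ℝ),
    ∫ ω, Complex.exp (Complex.I * s * Y u ω) ∂μ = Complex.exp (u * ψ s)) (s : ℝ) :
    (ψ s).re ≤ 0 := by
  have h1 : ‖Complex.exp (ψ s)‖ ≤ 1 := by
    have h := hψ 1 s
    simp only [NNReal.coe_one, Complex.ofReal_one, one_mul] at h
    rw [← h]
    refine (norm_integral_le_of_norm_le_const (C := 1) (Eventually.of_forall fun ω ↦ ?_)).trans_eq
      (by simp)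
    rw [Complex.norm_exp]
    simp
  rw [Complex.norm_exp, Real.exp_le_one_iff] at h1
  exact h1

lemma IsLevy.integral_exp_increment (hY : IsLevy Y μ) (hψ : ∀ (u : ℝ≥0) (s : ℝ),
    ∫ ω, Complex.exp (Complex.I * s * Y u ω) ∂μ = Complex.exp (u * ψ s)) {v u : ℝ≥0}
    (hvu : v ≤ u) (s : ℝ) :
    ∫ ω, Complex.exp (Complex.I * s * ((Y u ω - Y v ω : ℝ) : ℂ)) ∂μ
      = Complex.exp (((u : ℝ) - v : ℝ) * ψ s) := by
  have h := (hY.stationary_increments v (u - v)).comp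
    (u := fun x : ℝ ↦ Complex.exp (Complex.I * s * x)) (by fun_prop)
  have h2 := h.integral_eq
  simp only [Function.comp_def, add_tsub_cancel_of_le hvu] at h2
  rw [h2, hψ, NNReal.coe_sub hvu]

/-- Summation by parts. -/
lemma sum_mul_eq_sum_tail_mul {m : ℕ} (s v : Fin m → ℝ) :
    ∑ j, s j * v j = ∑ i, (∑ j ∈ Finset.Ici i, s j) * (v i - pad v i) := by
  have h1 : ∀ j : Fin m, ∑ i ∈ Finset.Iic j, (v i - pad v i) = v j := by
    intro j
    have h := Finset.sum_map (Finset.Iic j) Fin.valEmbedding (fun n ↦ pad v (n + 1) - pad v n)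
    simp only [Fin.valEmbedding_apply, pad_succ] at h
    rw [← h, Fin.map_valEmbedding_Iic, ← Nat.range_succ_eq_Iic, Finset.sum_range_sub, pad_succ,
      pad, sub_zero]
  simp only [Finset.sum_mul]
  rw [Finset.sum_comm' (t' := Finset.univ) (s' := fun j ↦ Finset.Iic j) (by simp)]
  refine Finset.sum_congr rfl fun j _ ↦ ?_
  rw [← Finset.mul_sum, h1]

lemma IsLevy.integral_exp_sum [IsProbabilityMeasure μ] (hY : IsLevy Y μ) (hψ : ∀ (u : ℝ≥0) (s : ℝ),
    ∫ ω, Complex.exp (Complex.I * s * Y u ω) ∂μ = Complex.exp (u * ψ s)) {m : ℕ}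
    {u : Fin m → ℝ≥0} (hu : Monotone u) (s : Fin m → ℝ) :
    ∫ ω, Complex.exp (∑ j, Complex.I * s j * Y (u j) ω) ∂μ
      = Complex.exp (∑ i, ψ (∑ j ∈ Finset.Ici i, s j)
        * (((u i : ℝ) - pad (fun j ↦ (u j : ℝ)) i : ℝ) : ℂ)) := by
  -- Adjoining the time `0`, where `Y` vanishes almost surely, makes every term an increment.
  set τ : Fin (m + 1) → ℝ≥0 := Fin.cons 0 u with hτ
  have hmono : Monotone τ := by
    refine Fin.monotone_iff_le_succ.2 fun i ↦ ?_
    cases m with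
    | zero => exact i.elim0
    | succ m =>
      induction i using Fin.cases with
      | zero => simp [hτ]
      | succ i =>
        rw [hτ, Fin.cons_succ, ← Fin.succ_castSucc, Fin.cons_succ]
        exact hu i.castSucc_lt_succ.le
  have hpad : ∀ i : Fin m, (τ i.castSucc : ℝ) = pad (fun j ↦ (u j : ℝ)) i := by
    intro i
    rw [← cons_zero_castSucc]
    have : ∀ a : Fin (m + 1), (τ a : ℝ) = (Fin.cons 0 (fun j ↦ (u j : ℝ)) : Fin (m + 1) → ℝ) a := by
      intro a
      induction a using Fin.cases <;> simp [hτ]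
    exact this _
  have hae : ∀ᵐ ω ∂μ, Complex.exp (∑ j, Complex.I * s j * Y (u j) ω)
      = ∏ i, Complex.exp (Complex.I * ((∑ j ∈ Finset.Ici i, s j : ℝ) : ℂ)
        * ((Y (τ i.succ) ω - Y (τ i.castSucc) ω : ℝ) : ℂ)) := by
    filter_upwards [hY.zero] with ω hω
    have h1 : ∀ i : Fin m, Y (τ i.castSucc) ω = pad (fun j ↦ Y (u j) ω) i := by
      intro i
      rw [← cons_zero_castSucc]
      have : ∀ a : Fin (m + 1), Y (τ a) ω = (Fin.cons 0 (fun j ↦ Y (u j) ω) : Fin (m + 1) → ℝ) a := by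
        intro a
        induction a using Fin.cases <;> simp [hτ, hω]
      exact this _
    rw [← Complex.exp_sum]
    congr 1
    have h2 := sum_mul_eq_sum_tail_mul s fun j ↦ Y (u j) ω
    have h3 : ∑ j, Complex.I * s j * Y (u j) ω = Complex.I * ((∑ j, s j * Y (u j) ω : ℝ) : ℂ) := by
      push_cast
      rw [Finset.mul_sum]
      exact Finset.sum_congr rfl fun j _ ↦ by ring
    rw [h3, h2]
    push_cast
    rw [Finset.mul_sum]
    refine Finset.sum_congr rfl fun i _ ↦ ?_
    rw [h1, hτ, Fin.cons_succ]
    ring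
  rw [integral_congr_ae hae]
  have hindep := hY.indep_increments m τ hmono
  have hprod := hindep.integral_fun_prod_comp
    (f := fun i (x : ℝ) ↦ Complex.exp (Complex.I * ((∑ j ∈ Finset.Ici i, s j : ℝ) : ℂ) * x))
    (fun i ↦ ((hY.measurable _).sub (hY.measurable _)).aemeasurable)
    (fun i ↦ (by fun_prop : Continuous fun x : ℝ ↦ Complex.exp
      (Complex.I * ((∑ j ∈ Finset.Ici i, s j : ℝ) : ℂ) * x)).aestronglyMeasurable)
  refine hprod.trans ?_
  rw [Complex.exp_sum]
  refine Finset.prod_congr rfl fun i _ ↦ ?_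
  have h4 := hY.integral_exp_increment hψ (hmono i.castSucc_lt_succ.le) (∑ j ∈ Finset.Ici i, s j)
  refine Eq.trans ?_ (h4.trans ?_)
  · rfl
  · rw [hpad, hτ, Fin.cons_succ, mul_comm]

lemma pad_mono {m : ℕ} {v : Fin m → ℝ} (hv : Monotone v) (h0 : ∀ j, 0 ≤ v j) (i : Fin m) :
    pad v i ≤ v i := by
  obtain ⟨i, hi⟩ := i
  cases i with
  | zero => exact h0 _
  | succ i =>
    have : pad v (i + 1) = v ⟨i, by omega⟩ := pad_succ v ⟨i, by omega⟩
    change pad v (i + 1) ≤ _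
    rw [this]
    exact hv (Fin.mk_le_mk.2 (Nat.le_succ i))

lemma continuous_pad {m : ℕ} (n : ℕ) : Continuous fun v : Fin m → ℝ ↦ pad v n := by
  cases n with
  | zero => exact continuous_const
  | succ n =>
    simp only [pad]
    split_ifs
    · exact continuous_apply _
    · exact continuous_const

lemma norm_exp_sum_le_one {m : ℕ} {σ : Fin m → ℂ} (hσ : ∀ i, (σ i).re ≤ 0) {v : Fin m → ℝ}
    (hv : ∀ i, 0 ≤ v i) : ‖Complex.exp (∑ i, σ i * (v i : ℂ))‖ ≤ 1 := by
  rw [Complex.norm_exp, Real.exp_le_one_iff, Complex.re_sum]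
  refine Finset.sum_nonpos fun i _ ↦ ?_
  rw [Complex.re_mul_ofReal]
  exact mul_nonpos_of_nonpos_of_nonneg (hσ i) (hv i)

/-- The least point of `(1 / (n + 1)) ℕ` that is larger than `x`. -/
def gridPoint (n : ℕ) (a : ℕ) : ℝ≥0 := (a + 1) / (n + 1)

lemma le_gridPoint (n : ℕ) (x : ℝ≥0) : x ≤ gridPoint n ⌊(n + 1) * x⌋₊ := by
  rw [gridPoint, le_div_iff₀ (by positivity), mul_comm]
  exact (Nat.lt_floor_add_one _).le

lemma tendsto_gridPoint (x : ℝ≥0) :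
    Tendsto (fun n : ℕ ↦ gridPoint n ⌊(n + 1) * x⌋₊) atTop (𝓝 x) := by
  have h1 : Tendsto (fun n : ℕ ↦ x + 1 / ((n : ℝ≥0) + 1)) atTop (𝓝 (x + 0)) :=
    tendsto_const_nhds.add tendsto_one_div_add_atTop_nhds_zero_nat
  rw [add_zero] at h1
  refine tendsto_of_tendsto_of_tendsto_of_le_of_le tendsto_const_nhds h1
    (fun n ↦ le_gridPoint n x) fun n ↦ ?_
  have h2 : (x + 1 / ((n : ℝ≥0) + 1)) * (n + 1) = (n + 1) * x + 1 := by field_simp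
  rw [gridPoint, div_le_iff₀ (by positivity), h2]
  exact add_le_add (Nat.floor_le zero_le) le_rfl

/-- Evaluation `(u, y) ↦ y u` is not jointly measurable for the product σ-algebra on all paths, so
Fubini does not apply to `X` itself. It does apply after rounding `X` up to a countable grid;
right-continuity of `Y` then removes the rounding. -/
lemma IsLevy.integral_exp_subordinated [IsProbabilityMeasure μ] (hY : IsLevy Y μ) (hψ : ∀ (u : ℝ≥0) (s : ℝ),
    ∫ ω, Complex.exp (Complex.I * s * Y u ω) ∂μ = Complex.exp (u * ψ s)) {m : ℕ}
    {X : Fin m → Ω → ℝ≥0} (hX : ∀ j, Measurable (X j))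
    (hind : IndepFun (fun ω j ↦ X j ω) (fun ω u ↦ Y u ω) μ)
    (hmono : ∀ᵐ ω ∂μ, Monotone fun j ↦ X j ω) (s : Fin m → ℝ) :
    Integrable (fun ω ↦ Complex.exp (∑ j, Complex.I * s j * Y (X j ω) ω)) μ ∧
    ∫ ω, Complex.exp (∑ j, Complex.I * s j * Y (X j ω) ω) ∂μ
      = ∫ ω, Complex.exp (∑ i, ψ (∑ j ∈ Finset.Ici i, s j)
        * (((X i ω : ℝ) - pad (fun j ↦ (X j ω : ℝ)) i : ℝ) : ℂ)) ∂μ := by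
  have hre := re_le_zero_of_integral_eq hψ
  have hnorm : ∀ y : Fin m → ℝ, ‖Complex.exp (∑ j, Complex.I * s j * y j)‖ = 1 := by
    intro y
    rw [Complex.norm_exp]
    simp
  let N : ℕ → Ω → Fin m → ℕ := fun n ω j ↦ ⌊((n : ℝ≥0) + 1) * X j ω⌋₊
  have hN : ∀ n, Measurable (N n) := fun n ↦ measurable_pi_lambda _ fun j ↦
    Nat.measurable_floor.comp ((hX j).const_mul _)
  let Φ : ℕ → (Fin m → ℕ) × (ℝ≥0 → ℝ) → ℂ := fun n p ↦
    Complex.exp (∑ j, Complex.I * s j * p.2 (gridPoint n (p.1 j)))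
  have hΦ : ∀ n, Measurable (Φ n) := fun n ↦ by
    refine measurable_from_prod_countable_right fun a ↦ ?_
    refine Complex.measurable_exp.comp (Finset.measurable_sum _ fun j _ ↦ ?_)
    exact (Complex.measurable_ofReal.comp (measurable_pi_apply (gridPoint n (a j)))).const_mul _
  have hYm : Measurable fun ω u ↦ Y u ω := measurable_pi_lambda _ hY.measurable
  have hstep : ∀ n, ∫ ω, Φ n (N n ω, fun u ↦ Y u ω) ∂μ
      = ∫ ω, Complex.exp (∑ i, ψ (∑ j ∈ Finset.Ici i, s j)
        * (((gridPoint n (N n ω i) : ℝ) - pad (fun j ↦ (gridPoint n (N n ω j) : ℝ)) i : ℝ) : ℂ))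
        ∂μ := by
    intro n
    have hindN : IndepFun (N n) (fun ω u ↦ Y u ω) μ := by
      refine hind.comp (φ := fun (x : Fin m → ℝ≥0) j ↦ ⌊((n : ℝ≥0) + 1) * x j⌋₊) (ψ := id) ?_
        measurable_id
      exact measurable_pi_lambda _ fun j ↦
        Nat.measurable_floor.comp ((measurable_pi_apply j).const_mul _)
    have hmap := (indepFun_iff_map_prod_eq_prod_map_map (hN n).aemeasurable hYm.aemeasurable).1
      hindN
    have h1 : ∫ ω, Φ n (N n ω, fun u ↦ Y u ω) ∂μ
        = ∫ p, Φ n p ∂(μ.map fun ω ↦ (N n ω, fun u ↦ Y u ω)) :=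
      (integral_map ((hN n).prodMk hYm).aemeasurable (hΦ n).aestronglyMeasurable).symm
    have := Measure.isProbabilityMeasure_map (μ := μ) (hN n).aemeasurable
    have := Measure.isProbabilityMeasure_map (μ := μ) hYm.aemeasurable
    rw [h1, hmap, integral_prod, integral_map (hN n).aemeasurable]
    · refine integral_congr_ae ?_
      filter_upwards [hmono] with ω hω
      have hsec : Measurable fun y ↦ Φ n (N n ω, y) :=
        (hΦ n).comp (measurable_const.prodMk measurable_id)
      rw [integral_map hYm.aemeasurable hsec.aestronglyMeasurable]
      refine hY.integral_exp_sum hψ (u := fun j ↦ gridPoint n (N n ω j)) (fun i j hij ↦ ?_) s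
      simp only [gridPoint, N]
      gcongr
      exact hω hij
    · exact ((hΦ n).stronglyMeasurable.integral_prod_right (ν := μ.map fun ω u ↦ Y u ω)).aestronglyMeasurable
    · refine (integrable_const (1 : ℝ)).mono' (hΦ n).aestronglyMeasurable
        (Eventually.of_forall fun p ↦ (hnorm _).le)
  have hae : ∀ᵐ ω ∂μ, Tendsto (fun n ↦ Φ n (N n ω, fun u ↦ Y u ω)) atTop
      (𝓝 (Complex.exp (∑ j, Complex.I * s j * Y (X j ω) ω))) := by
    filter_upwards [hY.cadlag] with ω hω
    refine (Complex.continuous_exp.tendsto _).comp (tendsto_finsetSum _ fun j _ ↦ ?_)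
    refine Tendsto.const_mul _ ((Complex.continuous_ofReal.tendsto _).comp ?_)
    -- The grid points approach `X j ω` from above, which is the side on which the paths are
    -- continuous.
    exact (hω (X j ω)).1.tendsto.comp (tendsto_nhdsWithin_iff.2
      ⟨tendsto_gridPoint _, Eventually.of_forall fun n ↦ le_gridPoint n _⟩)
  have hmeas : ∀ n, AEStronglyMeasurable (fun ω ↦ Φ n (N n ω, fun u ↦ Y u ω)) μ := fun n ↦
    ((hΦ n).comp ((hN n).prodMk hYm)).aestronglyMeasurable
  have hmeas' := aestronglyMeasurable_of_tendsto_ae atTop hmeas hae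
  refine ⟨(integrable_const (1 : ℝ)).mono' hmeas'
    (Eventually.of_forall fun ω ↦ (hnorm _).le), ?_⟩
  have hL := tendsto_integral_of_dominated_convergence (fun _ ↦ (1 : ℝ)) hmeas
    (integrable_const _) (fun n ↦ Eventually.of_forall fun ω ↦ (hnorm _).le) hae
  have hR : Tendsto (fun n ↦ ∫ ω, Complex.exp (∑ i, ψ (∑ j ∈ Finset.Ici i, s j)
        * (((gridPoint n (N n ω i) : ℝ) - pad (fun j ↦ (gridPoint n (N n ω j) : ℝ)) i : ℝ) : ℂ))
        ∂μ) atTop (𝓝 (∫ ω, Complex.exp (∑ i, ψ (∑ j ∈ Finset.Ici i, s j)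
        * (((X i ω : ℝ) - pad (fun j ↦ (X j ω : ℝ)) i : ℝ) : ℂ)) ∂μ)) := by
    have hc : Continuous fun v : Fin m → ℝ ↦ Complex.exp (∑ i, ψ (∑ j ∈ Finset.Ici i, s j)
        * ((v i - pad v i : ℝ) : ℂ)) := by
      have := fun n ↦ continuous_pad (m := m) n
      fun_prop
    refine tendsto_integral_of_dominated_convergence (fun _ ↦ (1 : ℝ)) (fun n ↦ ?_)
      (integrable_const _) (fun n ↦ ?_) ?_
    · refine (hc.measurable.comp (measurable_pi_lambda _ fun j ↦ ?_)).aestronglyMeasurable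
      have : Measurable fun a : ℕ ↦ (gridPoint n a : ℝ) := measurable_from_top
      exact this.comp ((measurable_pi_apply j).comp (hN n))
    · filter_upwards [hmono] with ω hω
      refine norm_exp_sum_le_one (fun i ↦ hre _) fun i ↦ sub_nonneg.2 (pad_mono (v := fun j ↦
        (gridPoint n (N n ω j) : ℝ)) (fun i j hij ↦ ?_) (fun j ↦ NNReal.coe_nonneg _) i)
      simp only [gridPoint, N, NNReal.coe_le_coe]
      gcongr
      exact hω hij
    · refine Eventually.of_forall fun ω ↦ ?_
      refine (hc.tendsto _).comp (tendsto_pi_nhds.2 fun j ↦ ?_)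
      exact (NNReal.continuous_coe.tendsto _).comp (tendsto_gridPoint (X j ω))
  exact tendsto_nhds_unique hL (hR.congr fun n ↦ (hstep n).symm)

end Levy

/-! ### Convergence of the walks -/

/-- Identifies the scale `s_n = c Γ(α) n ^ α`. It matches the normalization `c Γ(α) X` of the limit,
and so `c` disappears. -/
lemma gbpFun_eq {α lam c : ℝ} (hα : 0 < α) {n : ℕ} (hn : 0 < n) (d : ℕ) :
    gbpFun α lam c n d = c * Real.Gamma α * (n : ℝ) ^ α * siteKernel α lam n d := by
  have hΓ := (Real.Gamma_pos_of_pos hα).ne'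
  have hn' : (n : ℝ) ^ α ≠ 0 := (Real.rpow_pos_of_pos (by exact_mod_cast hn) _).ne'
  rw [gbpFun, siteKernel]
  field_simp

lemma tendsto_scale {α ν : ℝ} (hα : 0 < α) (hν : 0 < ν) :
    Tendsto (fun n : ℕ ↦ ν * (n : ℝ) ^ α) atTop atTop :=
  ((tendsto_rpow_atTop hα).comp tendsto_natCast_atTop_atTop).const_mul_atTop hν

lemma IsGBPStar.renewalLimit {α lam c : ℝ} (hα : 0 < α) (hα1 : α ≤ 1) (hc : 0 < c)
    {Q : ℕ → ProbabilityMeasure (ℕ → Bool)}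
    (hQ : ∀ᶠ n : ℕ in atTop, IsGBPStar (gbpFun α lam c n) (Q n : Measure (ℕ → Bool))) (T : ℝ) :
    RenewalLimit α lam (siteKernel α lam) (gammaKernel α lam) T
      (fun n ↦ c * Real.Gamma α * (n : ℝ) ^ α) Q where
  start := startLimit_siteKernel hα hα1 T
  scale := tendsto_scale hα (mul_pos hc (Real.Gamma_pos_of_pos hα))
  isRenewal := by
    filter_upwards [hQ, eventually_gt_atTop 0] with n hn hn0
    have h := hn.isRenewal ⌊(n : ℝ) * T⌋₊
    rwa [show gbpFun α lam c n = fun d ↦ c * Real.Gamma α * (n : ℝ) ^ α * siteKernel α lam n d from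
      funext fun d ↦ gbpFun_eq hα hn0 d] at h

/-- The weight does not depend on the site, so `⌊n T⌋ / n → T` gives the limit, and boundedness of a
convergent sequence the majorant. -/
lemma startLimit_const {α lam b T : ℝ} (hα : 0 < α) (hb : 0 < b) (hT : 0 < T) :
    StartLimit (fun n _ ↦ b * siteKernel α lam n ⌊(n : ℝ) * T⌋₊)
      (fun _ ↦ ENNReal.ofReal (aT α lam b T)) T := by
  have hdiv : Tendsto (fun n : ℕ ↦ (⌊(n : ℝ) * T⌋₊ : ℝ) / n) atTop (𝓝 T) := by
    have := (tendsto_nat_floor_mul_div_atTop hT.le).comp tendsto_natCast_atTop_atTop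
    simpa [Function.comp_def, mul_comm] using this
  have hcont : ContinuousAt (fun d : ℝ ↦ b * (d ^ (α - 1) / Real.Gamma α * Real.exp (-lam * d))) T := by
    refine continuousAt_const.mul (ContinuousAt.mul (ContinuousAt.div_const ?_ _) (by fun_prop))
    exact Real.continuousAt_rpow_const _ _ (.inl hT.ne')
  have hlim : Tendsto (fun n : ℕ ↦ n * (b * siteKernel α lam n ⌊(n : ℝ) * T⌋₊)) atTop
      (𝓝 (aT α lam b T)) := by
    have h := hcont.tendsto.comp hdiv
    rw [show aT α lam b T = b * (T ^ (α - 1) / Real.Gamma α * Real.exp (-lam * T)) by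
      rw [aT, neg_mul]; ring]
    refine h.congr' ?_
    filter_upwards [eventually_gt_atTop 0] with n hn
    rw [mul_left_comm, mul_siteKernel α lam hn]
    rfl
  refine ⟨fun n _ ↦ mul_nonneg hb.le (siteKernel_nonneg hα lam n _),
    fun _ ↦ ENNReal.ofReal_ne_top, Eventually.of_forall fun y _ ↦
      (ENNReal.continuous_ofReal.tendsto _).comp hlim, ?_⟩
  obtain ⟨K, hK⟩ := hlim.bddAbove_range
  refine ⟨fun _ ↦ ENNReal.ofReal K, ?_, fun n _ y _ _ ↦
    ENNReal.ofReal_le_ofReal (hK (Set.mem_range_self n))⟩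
  rw [setLIntegral_const]
  exact ENNReal.mul_ne_top ENNReal.ofReal_ne_top (by simp)

lemma IsGBP.renewalLimit {α lam b c T : ℝ} (hα : 0 < α) (hb : 0 < b) (hT : 0 < T) (hc : 0 < c)
    {Q : ℕ → ProbabilityMeasure (ℕ → Bool)}
    (hQ : ∀ᶠ n : ℕ in atTop, IsGBP (gbpFun α lam c n) b ⌊(n : ℝ) * T⌋₊
      (Q n : Measure (ℕ → Bool))) :
    RenewalLimit α lam (fun n _ ↦ b * siteKernel α lam n ⌊(n : ℝ) * T⌋₊)
      (fun _ ↦ ENNReal.ofReal (aT α lam b T)) T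
      (fun n ↦ c * Real.Gamma α * (n : ℝ) ^ α) Q where
  start := startLimit_const hα hb hT
  scale := tendsto_scale hα (mul_pos hc (Real.Gamma_pos_of_pos hα))
  isRenewal := by
    filter_upwards [hQ, eventually_gt_atTop 0] with n hn hn0
    have h := hn.isRenewal
    rw [show gbpFun α lam c n = fun d ↦ c * Real.Gamma α * (n : ℝ) ^ α * siteKernel α lam n d from
      funext fun d ↦ gbpFun_eq hα hn0 d] at h
    simpa only [mul_left_comm b] using h

/-! ### Exponential functionals and monotonicity under weak convergence of the walks -/

section Walk

variable {m : ℕ} {t : Fin m → ℝ}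

lemma walk_mono (α : ℝ) (n : ℕ) {u v : ℝ} (huv : u ≤ v) (ω : ℕ → Bool) :
    walk α n u ω ≤ walk α n v ω := by
  unfold walk
  refine div_le_div_of_nonneg_right (Finset.sum_le_sum_of_subset_of_nonneg
    (Finset.Icc_subset_Icc_right (Nat.floor_le_floor (by gcongr))) fun i _ _ ↦ ?_) (by positivity)
  split_ifs <;> norm_num

lemma walk_sub_walk (α : ℝ) (n : ℕ) {u v : ℝ} (huv : u ≤ v) (ω : ℕ → Bool) :
    walk α n v ω - walk α n u ω
      = (∑ y ∈ siteBlock n u v, if ω y = true then (1 : ℝ) else 0) / (n : ℝ) ^ α := by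
  have hle : ⌊(n : ℝ) * u⌋₊ ≤ ⌊(n : ℝ) * v⌋₊ := Nat.floor_le_floor (by gcongr)
  have hI : ∀ N : ℕ, Finset.Icc 1 N = Finset.Ioc 0 N := fun N ↦ rfl
  have h := Finset.sum_Ioc_consecutive (fun y ↦ if ω y = true then (1 : ℝ) else 0)
    (Nat.zero_le _) hle
  rw [walk, walk, hI, hI, ← sub_div, ← h, add_sub_cancel_left, siteBlock]

lemma walk_sub_pad (α : ℝ) (n : ℕ) (ht : StrictMono t) (ht0 : ∀ j, 0 < t j) (ω : ℕ → Bool)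
    (j : Fin m) :
    walk α n (t j) ω - pad (fun j ↦ walk α n (t j) ω) j
      = (∑ y ∈ siteBlock n (pad t j) (t j), if ω y = true then (1 : ℝ) else 0) / (n : ℝ) ^ α := by
  have hpad : pad (fun j ↦ walk α n (t j) ω) j = walk α n (pad t j) ω := by
    obtain ⟨j, hj⟩ := j
    cases j with
    | zero => simp [pad, walk]
    | succ j =>
      have h1 := pad_succ (fun j ↦ walk α n (t j) ω) ⟨j, by omega⟩
      have h2 := pad_succ t ⟨j, by omega⟩
      simp only at h1 h2 ⊢
      rw [h1, h2]
  rw [hpad, walk_sub_walk α n (pad_lt ht ht0 j).le]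

lemma ProbabilityMeasure.tendsto_integral_of_tendstoInDistribution {E Ω' : Type*}
    [TopologicalSpace E] [MeasurableSpace E] [BorelSpace E] {Ω : ℕ → Type*}
    [∀ n, MeasurableSpace (Ω n)] [MeasurableSpace Ω'] {W : ∀ n, Ω n → E} {Z : Ω' → E}
    {P : ∀ n, Measure (Ω n)} [∀ n, IsProbabilityMeasure (P n)] {μ : Measure Ω'}
    [IsProbabilityMeasure μ] (h : TendstoInDistribution W atTop Z P μ) {f : E → ℂ}
    (hf : Continuous f) {C : ℝ} (hC : ∀ x, ‖f x‖ ≤ C) :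
    Tendsto (fun n ↦ ∫ ω, f (W n ω) ∂P n) atTop (𝓝 (∫ ω, f (Z ω) ∂μ)) := by
  have h1 := (ProbabilityMeasure.tendsto_iff_forall_integral_rclike_tendsto ℂ).1 h.tendsto
    (BoundedContinuousFunction.ofNormedAddCommGroup f hf C hC)
  simp only [BoundedContinuousFunction.coe_ofNormedAddCommGroup, ProbabilityMeasure.coe_mk] at h1
  have hfm : ∀ ρ : Measure E, AEStronglyMeasurable f ρ := fun ρ ↦
    hf.measurable.aestronglyMeasurable
  rw [integral_map h.aemeasurable_limit (hfm _)] at h1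
  exact h1.congr fun n ↦ integral_map (h.forall_aemeasurable n) (hfm _)

variable {Ω : Type*} [MeasurableSpace Ω] {μ : Measure Ω} [IsProbabilityMeasure μ]
  {X : Fin m → Ω → ℝ≥0} {α ν : ℝ} {Q : ℕ → ProbabilityMeasure (ℕ → Bool)}

/-- Monotonicity is inherited from the walks. The truncated positive part of `v i - v j` is bounded
and continuous and vanishes on all walks, so its expectation under the limit is zero. -/
lemma ae_monotone_of_tendstoInDistribution (ht : StrictMono t) (hν : 0 < ν)
    (hX : ∀ j, Measurable (X j))
    (h : TendstoInDistribution (fun (n : ℕ) ω (j : Fin m) ↦ walk α n (t j) ω) atTop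
      (fun ω (j : Fin m) ↦ ν * (X j ω : ℝ)) (fun n ↦ (Q n : Measure (ℕ → Bool))) μ) :
    ∀ᵐ ω ∂μ, Monotone fun j ↦ X j ω := by
  have hXr : ∀ j, Measurable fun ω ↦ (X j ω : ℝ) := fun j ↦
    NNReal.continuous_coe.measurable.comp (hX j)
  have key : ∀ i j : Fin m, i ≤ j → ∀ᵐ ω ∂μ, X i ω ≤ X j ω := by
    intro i j hij
    let g : (Fin m → ℝ) → ℝ := fun v ↦ min 1 (max 0 (v i - v j))
    have hg : Continuous g := by fun_prop
    have hg0 : ∀ v, 0 ≤ g v := fun v ↦ le_min zero_le_one (le_max_left _ _)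
    have hg1 : ∀ v, g v ≤ 1 := fun v ↦ min_le_left _ _
    have h1 := ProbabilityMeasure.tendsto_integral_of_tendstoInDistribution h
      (f := fun v ↦ (g v : ℂ)) (by fun_prop) (C := 1) fun v ↦ by
        rw [Complex.norm_real, Real.norm_of_nonneg (hg0 v)]; exact hg1 v
    have h2 : ∀ (n : ℕ) (ω : ℕ → Bool), g (fun j ↦ walk α n (t j) ω) = 0 := by
      intro n ω
      have := walk_mono α n (ht.monotone hij) ω
      simp only [g]
      rw [max_eq_left (by linarith), min_eq_right zero_le_one]
    simp only [h2, Complex.ofReal_zero, integral_zero] at h1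
    have h3 := tendsto_nhds_unique h1 tendsto_const_nhds
    rw [integral_complex_ofReal, Complex.ofReal_eq_zero] at h3
    have hint : Integrable (fun ω ↦ g fun j ↦ ν * (X j ω : ℝ)) μ := by
      refine (integrable_const (1 : ℝ)).mono' ?_ (Eventually.of_forall fun ω ↦ ?_)
      · exact (hg.measurable.comp (measurable_pi_lambda _ fun j ↦
          (hXr j).const_mul ν)).aestronglyMeasurable
      · rw [Real.norm_of_nonneg (hg0 fun j ↦ ν * (X j ω : ℝ))]
        exact hg1 fun j ↦ ν * (X j ω : ℝ)
    have h4 := (integral_eq_zero_iff_of_nonneg (f := fun ω ↦ g fun j ↦ ν * (X j ω : ℝ))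
      (fun ω ↦ hg0 fun j ↦ ν * (X j ω : ℝ)) hint).1 h3
    filter_upwards [h4] with ω hω
    by_contra! hlt
    have hlt' : (X j ω : ℝ) < X i ω := hlt
    have hpos : 0 < ν * (X i ω : ℝ) - ν * (X j ω : ℝ) := by
      rw [← mul_sub]; exact mul_pos hν (sub_pos.2 hlt')
    have : 0 < g fun j ↦ ν * (X j ω : ℝ) := lt_min zero_lt_one (lt_max_of_lt_right hpos)
    exact this.ne' hω
  have hall : ∀ᵐ ω ∂μ, ∀ i j : Fin m, i ≤ j → X i ω ≤ X j ω := by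
    simp only [ae_all_iff]
    exact fun i j hij ↦ key i j hij
  filter_upwards [hall] with ω hω i j hij using hω i j hij

/-- The exponential may be unbounded where increments are negative, so weak convergence is applied
with increments clamped at zero. The clamp changes nothing on the walks, nor almost surely in the
limit. -/
lemma tendsto_integral_exp_increments (ht : StrictMono t) (ht0 : ∀ j, 0 < t j) (hν : 0 < ν)
    (hX : ∀ j, Measurable (X j))
    (h : TendstoInDistribution (fun (n : ℕ) ω (j : Fin m) ↦ walk α n (t j) ω) atTop
      (fun ω (j : Fin m) ↦ ν * (X j ω : ℝ)) (fun n ↦ (Q n : Measure (ℕ → Bool))) μ)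
    {σ : Fin m → ℂ} (hσ : ∀ i, (σ i).re ≤ 0) :
    Tendsto (fun n : ℕ ↦ ∫ ω, Complex.exp (∑ j, σ j / (ν * (n : ℝ) ^ α : ℝ) *
        ∑ y ∈ siteBlock n (pad t j) (t j), if ω y = true then 1 else 0)
        ∂(Q n : Measure (ℕ → Bool))) atTop
      (𝓝 (∫ ω, Complex.exp (∑ j, σ j * (((X j ω : ℝ) - pad (fun j ↦ (X j ω : ℝ)) j : ℝ) : ℂ))
        ∂μ)) := by
  let g : (Fin m → ℝ) → ℂ := fun v ↦
    Complex.exp (∑ j, σ j * ((max 0 (v j - pad v j) / ν : ℝ) : ℂ))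
  have hg : Continuous g := by
    have := fun n ↦ continuous_pad (m := m) n
    simp only [g]
    fun_prop
  have h1 := ProbabilityMeasure.tendsto_integral_of_tendstoInDistribution h (f := g) hg (C := 1)
    fun v ↦ norm_exp_sum_le_one hσ fun j ↦ div_nonneg (le_max_left _ _) hν.le
  refine (h1.congr fun n ↦ ?_).trans_eq ?_
  · refine integral_congr_ae (Eventually.of_forall fun ω ↦ ?_)
    simp only [g]
    congr 1
    refine Finset.sum_congr rfl fun j _ ↦ ?_
    have hS : 0 ≤ ∑ y ∈ siteBlock n (pad t j) (t j), if ω y = true then (1 : ℝ) else 0 :=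
      Finset.sum_nonneg fun y _ ↦ by split_ifs <;> norm_num
    rw [walk_sub_pad α n ht ht0, max_eq_right (by positivity)]
    push_cast [apply_ite Complex.ofReal]
    ring
  · congr 1
    refine integral_congr_ae ?_
    filter_upwards [ae_monotone_of_tendstoInDistribution ht hν hX h] with ω hω
    simp only [g]
    congr 1
    refine Finset.sum_congr rfl fun j _ ↦ ?_
    have hp : pad (fun j ↦ ν * (X j ω : ℝ)) j = ν * pad (fun j ↦ (X j ω : ℝ)) j := by
      rcases j with ⟨_ | j, hj⟩
      · simp [pad]
      · simp [pad]
    have hle : pad (fun j ↦ (X j ω : ℝ)) j ≤ X j ω :=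
      pad_mono (v := fun j ↦ (X j ω : ℝ)) (fun i j hij ↦ NNReal.coe_le_coe.2 (hω hij))
        (fun j ↦ NNReal.coe_nonneg _) j
    rw [hp, ← mul_sub, max_eq_right (mul_nonneg hν.le (sub_nonneg.2 hle)),
      mul_div_cancel_left₀ _ hν.ne']

end Walk

end EMLProcess

end

/-! ### The two cases assembled: two limits of the same sequence agree -/

theorem theorem4p1 {Ω : Type*} [MeasurableSpace Ω] (μ : Measure Ω) [IsProbabilityMeasure μ]
    (Y : ℝ≥0 → Ω → ℝ) (hY : EMLProcess.IsLevy Y μ)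
    (ψ : ℝ → ℂ)
    (hψ : ∀ (u : ℝ≥0) (s : ℝ),
      ∫ ω, Complex.exp (Complex.I * s * Y u ω) ∂μ = Complex.exp (u * ψ s)) :
    (∀ (α lam b T : ℝ), 0 < α → α ≤ 1 → 0 < b → b ≤ 1 → 0 < T → (α - 1) / T ≤ lam →
      ∀ X : Set.Ioc (0 : ℝ) T → Ω → ℝ≥0, EMLProcess.IsEML α lam b T X μ →
      IndepFun (fun ω t ↦ X t ω) (fun ω u ↦ Y u ω) μ →
      ∀ (m : ℕ) (t : Fin m → Set.Ioc (0 : ℝ) T), StrictMono t → ∀ s : Fin m → ℝ,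
        EMLProcess.MgfConverges α lam (fun i ↦ ψ (∑ j ∈ Finset.Ici i, s j))
            (fun i ↦ (t i : ℝ)) ∧
        Integrable (fun ω ↦ Complex.exp (∑ j, Complex.I * s j * Y (X (t j) ω) ω)) μ ∧
        ∫ ω, Complex.exp (∑ j, Complex.I * s j * Y (X (t j) ω) ω) ∂μ
          = EMLProcess.mgf α lam b T (fun i ↦ ψ (∑ j ∈ Finset.Ici i, s j))
              (fun i ↦ (t i : ℝ))) ∧
    (∀ (α lam : ℝ), 0 < α → α ≤ 1 → 0 ≤ lam →
      ∀ X : Set.Ioi (0 : ℝ) → Ω → ℝ≥0, EMLProcess.IsEMLStar α lam X μ →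
      IndepFun (fun ω t ↦ X t ω) (fun ω u ↦ Y u ω) μ →
      ∀ (m : ℕ) (t : Fin m → Set.Ioi (0 : ℝ)), StrictMono t → ∀ s : Fin m → ℝ,
        EMLProcess.MgfStarConverges α lam (fun i ↦ ψ (∑ j ∈ Finset.Ici i, s j))
            (fun i ↦ (t i : ℝ)) ∧
        Integrable (fun ω ↦ Complex.exp (∑ j, Complex.I * s j * Y (X (t j) ω) ω)) μ ∧
        ∫ ω, Complex.exp (∑ j, Complex.I * s j * Y (X (t j) ω) ω) ∂μ
          = EMLProcess.mgfStar α lam (fun i ↦ ψ (∑ j ∈ Finset.Ici i, s j))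
              (fun i ↦ (t i : ℝ))) := by
  have hre := EMLProcess.re_le_zero_of_integral_eq hψ
  constructor
  · intro α lam b T hα hα1 hb _ hT _ X hX hind m t ht s
    obtain ⟨c, hc, _, Q, hQ, hconv⟩ := hX.scaling_limit
    have hν : 0 < c * Real.Gamma α := mul_pos hc (Real.Gamma_pos_of_pos hα)
    have hΓ := Real.Gamma_pos_of_pos hα
    have haT : 0 < EMLProcess.aT α lam b T := by unfold EMLProcess.aT; positivity
    have ht' : StrictMono fun j ↦ (t j : ℝ) := ht
    have ht0 : ∀ j, 0 < (t j : ℝ) := fun j ↦ (t j).2.1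
    obtain ⟨hsum, hlim⟩ := EMLProcess.tendsto_integral_exp_stationary ht' ht0 hT.le
      (fun j ↦ (t j).2.2) hα hα1 haT (EMLProcess.IsGBP.renewalLimit hα hb hT hc hQ)
      fun i ↦ ψ (∑ j ∈ Finset.Ici i, s j)
    have hlim' := EMLProcess.tendsto_integral_exp_increments ht' ht0 hν
      (fun j ↦ hX.measurable (t j)) (hconv m t) (σ := fun i ↦ ψ (∑ j ∈ Finset.Ici i, s j))
      fun i ↦ hre _
    obtain ⟨hint, heq⟩ := hY.integral_exp_subordinated hψ (fun j ↦ hX.measurable (t j))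
      (hind.comp (φ := fun x j ↦ x (t j)) (ψ := id)
        (measurable_pi_lambda _ fun j ↦ measurable_pi_apply _) measurable_id)
      (EMLProcess.ae_monotone_of_tendstoInDistribution ht' hν (fun j ↦ hX.measurable (t j))
        (hconv m t)) s
    exact ⟨hsum, hint, heq.trans (tendsto_nhds_unique hlim' hlim)⟩
  · intro α lam hα hα1 _ X hX hind m t ht s
    obtain ⟨c, hc, _, Q, hQ, hconv⟩ := hX.scaling_limit
    have hν : 0 < c * Real.Gamma α := mul_pos hc (Real.Gamma_pos_of_pos hα)
    have ht' : StrictMono fun j ↦ (t j : ℝ) := ht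
    have ht0 : ∀ j, 0 < (t j : ℝ) := fun j ↦ (t j).2
    -- On the half-line any horizon beyond all `t j` will do. The sum of the times is one, and it is
    -- defined for `m = 0` as well.
    obtain ⟨hsum, hlim⟩ := EMLProcess.tendsto_integral_exp_star ht' ht0
      (Finset.sum_nonneg fun j _ ↦ (ht0 j).le)
      (fun j ↦ Finset.single_le_sum (fun i _ ↦ (ht0 i).le) (Finset.mem_univ j)) hα hα1
      (EMLProcess.IsGBPStar.renewalLimit hα hα1 hc hQ (∑ j, (t j : ℝ)))
      fun i ↦ ψ (∑ j ∈ Finset.Ici i, s j)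
    have hlim' := EMLProcess.tendsto_integral_exp_increments ht' ht0 hν
      (fun j ↦ hX.measurable (t j)) (hconv m t) (σ := fun i ↦ ψ (∑ j ∈ Finset.Ici i, s j))
      fun i ↦ hre _
    obtain ⟨hint, heq⟩ := hY.integral_exp_subordinated hψ (fun j ↦ hX.measurable (t j))
      (hind.comp (φ := fun x j ↦ x (t j)) (ψ := id)
        (measurable_pi_lambda _ fun j ↦ measurable_pi_apply _) measurable_id)
      (EMLProcess.ae_monotone_of_tendstoInDistribution ht' hν (fun j ↦ hX.measurable (t j))
        (hconv m t)) s
    exact ⟨hsum, hint, heq.trans (tendsto_nhds_unique hlim' hlim)⟩
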